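/- **Setting.** Let $\mathcal T$ be a finite three-dimensional triangulation with edge set $E$ and tetrahedra $T$. A metric is a vector $\ell\in\mathbb R^{E}$ of edge lengths that makes every tetrahedron a nondegenerate Euclidean one. Let $\beta_{e<t}$ be the dihedral angle of $t$ at $e$, and put $K_e=\bigl(2\pi-\sum_{t>e}\beta_{e<t}\bigr)\ell_e$, $\mathcal L=\sum_e\ell_e$, $\mathcal V=\sum_t \mathrm{Vol}(t)$, $\mathcal{EHR}=\sum_e K_e$, $\mathcal{LEHR}=\mathcal{EHR}/\mathcal L$, $\mathcal{VEHR}=\mathcal{EHR}/\mathcal V^{1/3}$. A metric is $\mathcal L$-Einstein if for some $\lambda\in\mathbb R$ one has $K_e=\lambda\ell_e$ for all $e$, and $\mathcal V$-Einstein if for some $\lambda\in\mathbb R$ one has $K_e=\lambda\,\ell_e\,\partial\mathcal V/\partial\ell_e$ for all $e$. For a vertex $v$ let $K_v=\frac12\sum_{e>v}K_e$, $L_v=\frac12\sum_{e>v}\ell_e$ and $V_v=\frac13\sum_{t>f>v}h_{f<t}A_f$, where $A_f$ is the area of the face $f$ and $h_{f<t}$ is the signed distance from the circumcenter of $t$ to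 $f$. A metric has constant $\mathcal L$-scalar curvature if $K_v=\mathcal{LEHR}\,L_v$ for all $v$, and constant $\mathcal V$-scalar curvature if $K_v=\frac{\mathcal{EHR}}{3\mathcal V}V_v$ for all $v$. Realize the 120 vertices of the 600-cell as the unit icosian quaternions $2I\subset\mathbb H$. Its edges and tetrahedra are the pairs and quadruples of vertices at mutual distance $\varphi^{-1}$, $\varphi=\frac{1+\sqrt5}2$. Let $\mathcal P$ be the set of metrics on the 600-cell that are invariant under left multiplication by $2I$, and let $\mathcal C\subset\mathcal P$ be the set of those for which any two tetrahedra are congruent. **Theorem.** 1. The boundary complex of the 600-cell is a triangulation of $S^3$ (its geometric realization is homeomorphic to $S^3$). 2. Every metric in $\mathcal P$ (in particular, every metric in $\mathcal C$) has constant $\mathcal L$-scalar curvature and constant $\mathcal V$-scalar curvature. 3. $\mathcal C$ contains all the equal length metrics and, for each edge $e_0$ and all $a,b>0$ with $b<\sqrt3\,a$, the metric with length $b$ on the translates of $e_0$ under left multiplication by $2I$ and length $a$ on all other edges. 4. A metric in $\mathcal C$ maximizes $\mathcal{LEHR}$ over $\mathcal C$ if and only if all its edge lengths are equal, and every such maximum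 is an $\mathcal L$-Einstein metric. Likewise, a metric in $\mathcal C$ maximizes $\mathcal{VEHR}$ over $\mathcal C$ if and only if all its edge lengths are equal, and every such maximum is a $\mathcal V$-Einstein metric. 5. Within the larger family $\mathcal P$, the equal length metrics are local maxima of $\mathcal{LEHR}$ and of $\mathcal{VEHR}$. -/

import Mathlib

open scoped Classical

noncomputable section

namespace PiecewiseFlat

/-! ### Triangulations and their metrics -/

/-- A finite three-dimensional triangulation on the vertex set `V`, given by its tetrahedra.
Its vertices, edges and faces are the faces of the tetrahedra. -/
structure Triangulation (V : Type) where
  tets : Finset (Finset V)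
  card_tets : ∀ t ∈ tets, t.card = 4

variable {V : Type} [Fintype V]

namespace Triangulation

/-- The edges: two-element subsets of the tetrahedra. -/
def edges (T : Triangulation V) : Finset (Finset V) :=
  T.tets.biUnion fun t => t.powersetCard 2

/-- The geometric realization: formal convex combinations of vertices that are supported in one
tetrahedron, with the topology of `V → ℝ`. -/
def realization (T : Triangulation V) : Set (V → ℝ) :=
  {x | x ∈ stdSimplex ℝ V ∧ ∃ t ∈ T.tets, ∀ v, v ∉ t → x v = 0}

/-- The length of the edge joining `x` and `y` (and `0` if they are not joined by an edge). -/
def len (T : Triangulation V) (ℓ : T.edges → ℝ) (x y : V) : ℝ :=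
  if h : ({x, y} : Finset V) ∈ T.edges then ℓ ⟨{x, y}, h⟩ else 0

/-- The space of metrics: vectors of edge lengths for which every tetrahedron (and hence every
simplex) is realized by a nondegenerate Euclidean one. -/
def met (T : Triangulation V) : Set (T.edges → ℝ) :=
  {ℓ | ∀ t ∈ T.tets, ∃ p : t → EuclideanSpace ℝ (Fin 3),
    AffineIndependent ℝ p ∧ ∀ x y : t, dist (p x) (p y) = T.len ℓ x y}

end Triangulation

/-! ### Geometry of a Euclidean simplex in terms of its edge lengths `d x y` -/

/-- The Cayley-Menger matrix of the simplex with vertex set `s`; the index `none` is the bordering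
row and column. -/
def cayleyMenger (d : V → V → ℝ) (s : Finset V) : Matrix (Option s) (Option s) ℝ
  | none, none => 0
  | none, some _ => 1
  | some _, none => 1
  | some x, some y => if x = y then 0 else d x y ^ 2

/-- The volume of a tetrahedron. -/
def tetVolume (d : V → V → ℝ) (t : Finset V) : ℝ := √((cayleyMenger d t).det / 288)

/-- The area of a triangle. -/
def triArea (d : V → V → ℝ) (f : Finset V) : ℝ := √(-(cayleyMenger d f).det / 16)

/-- The angle at `i` in the triangle `i j k`, by the cosine law. -/
def faceAngle (d : V → V → ℝ) (i j k : V) : ℝ :=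
  Real.arccos ((d i j ^ 2 + d i k ^ 2 - d j k ^ 2) / (2 * d i j * d i k))

/-- The dihedral angle at the edge `i j` of the tetrahedron `i j k l`, by the spherical cosine law
at the vertex `i`. -/
def dihedral (d : V → V → ℝ) (i j k l : V) : ℝ :=
  Real.arccos ((Real.cos (faceAngle d i k l) -
      Real.cos (faceAngle d i j k) * Real.cos (faceAngle d i j l)) /
    (Real.sin (faceAngle d i j k) * Real.sin (faceAngle d i j l)))

/-- The dihedral angle `β_{e<t}`. For a Euclidean tetrahedron the formula above gives the same value
for all four labelings `t = {i, j, k, l}` with `e = {i, j}`; to avoid choosing one of them, this is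
written as the mean of the four values. -/
def dihedralAngle (d : V → V → ℝ) (t e : Finset V) : ℝ :=
  (∑ p ∈ e.offDiag, ∑ q ∈ (t \ e).offDiag, dihedral d p.1 p.2 q.1 q.2) / 4

/-- The barycentric coordinate at the vertex `w` of the circumcenter of `t`: the coordinates `b`
are characterized by `∑ w, b w = 1` and `∑ w, d v w ^ 2 * b w` being the same for all `v`, that is,
they are read off the column `none` of the inverse Cayley-Menger matrix. -/
def circumBary (d : V → V → ℝ) (t : Finset V) (w : t) : ℝ :=
  (cayleyMenger d t)⁻¹ (some w) none

/-- The signed distance `h_{f<t}` from the circumcenter of `t` to its face `f = t \ {w}` (this is the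
signed length of the segment between the two circumcenters), positive if the circumcenter lies on
the same side of `f` as `w`: the altitude `3 V_t / A_f` of `t` over `f`, times the barycentric
coordinate at `w`. -/
def faceHeight (d : V → V → ℝ) (t : Finset V) (w : t) : ℝ :=
  circumBary d t w * (3 * tetVolume d t / triArea d (t.erase w))

/-! ### Curvatures and functionals -/

namespace Triangulation

variable (T : Triangulation V) (ℓ : T.edges → ℝ)

/-- The edge curvature `K_e`. -/
def edgeCurvature (e : T.edges) : ℝ :=
  (2 * Real.pi - ∑ t ∈ T.tets with e.1 ⊆ t, dihedralAngle (T.len ℓ) t e.1) * ℓ e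

/-- The total length. -/
def totalLength : ℝ := ∑ e : T.edges, ℓ e

/-- The total volume. -/
def totalVolume : ℝ := ∑ t ∈ T.tets, tetVolume (T.len ℓ) t

/-- The Einstein-Hilbert-Regge functional. -/
def EHR : ℝ := ∑ e : T.edges, T.edgeCurvature ℓ e

/-- The length normalized Einstein-Hilbert-Regge functional. -/
def LEHR : ℝ := T.EHR ℓ / T.totalLength ℓ

/-- The volume normalized Einstein-Hilbert-Regge functional. -/
def VEHR : ℝ := T.EHR ℓ / T.totalVolume ℓ ^ (1 / 3 : ℝ)

/-- `V_e = ℓ_e ∂𝒱/∂ℓ_e`. -/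
def edgeVolume (e : T.edges) : ℝ :=
  ℓ e * deriv (fun s => T.totalVolume (Function.update ℓ e s)) (ℓ e)

/-- `ℒ`-Einstein metrics. -/
def IsLEinstein : Prop :=
  ℓ ∈ T.met ∧ ∃ c : ℝ, ∀ e, T.edgeCurvature ℓ e = c * ℓ e

/-- `𝒱`-Einstein metrics. -/
def IsVEinstein : Prop :=
  ℓ ∈ T.met ∧ ∃ c : ℝ, ∀ e, T.edgeCurvature ℓ e = c * T.edgeVolume ℓ e

/-- The vertex curvature `K_v`. -/
def vertexCurvature (v : V) : ℝ := (∑ e : T.edges with v ∈ e.1, T.edgeCurvature ℓ e) / 2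

/-- `L_v`, half the sum of the lengths of the edges at `v`. -/
def vertexLength (v : V) : ℝ := (∑ e : T.edges with v ∈ e.1, ℓ e) / 2

/-- `V_v = (1/3) ∑_{t > f > v} h_{f<t} A_f`. The faces `f` of `t` are indexed by the opposite
vertices `w`. -/
def vertexVolume (v : V) : ℝ :=
  (∑ t ∈ T.tets with v ∈ t, ∑ w : t with w.1 ≠ v,
    faceHeight (T.len ℓ) t w * triArea (T.len ℓ) (t.erase w)) / 3

/-- Constant `ℒ`-scalar curvature: `K_v = λ L_v` for all `v`, with `λ = ℒℰℋℛ`. -/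
def HasConstLScalarCurvature : Prop :=
  ℓ ∈ T.met ∧ ∀ v, T.vertexCurvature ℓ v = T.LEHR ℓ * T.vertexLength ℓ v

/-- Constant `𝒱`-scalar curvature: `K_v = λ V_v` for all `v`, with `λ = ℰℋℛ / (3 𝒱)`. -/
def HasConstVScalarCurvature : Prop :=
  ℓ ∈ T.met ∧
    ∀ v, T.vertexCurvature ℓ v = T.EHR ℓ / (3 * T.totalVolume ℓ) * T.vertexVolume ℓ v

/-- All edges have the same length. -/
def IsEqualLength : Prop := ∀ e e' : T.edges, ℓ e = ℓ e'

/-- Any two tetrahedra are congruent: there is a bijection of their vertices that preserves the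
edge lengths. -/
def AllTetsCongruent : Prop :=
  ∀ s ∈ T.tets, ∀ t ∈ T.tets, ∃ σ : s ≃ t, ∀ x y : s, T.len ℓ x y = T.len ℓ (σ x) (σ y)

end Triangulation

/-! ### The 600-cell -/

open scoped Quaternion

/-- The 120 vertices of the 600-cell, as unit quaternions: the 8 quaternions `±1, ±i, ±j, ±k`, the
16 quaternions `(±1 ± i ± j ± k) / 2`, and the 96 quaternions whose coordinates are the even
permutations of `(±φ, ±1, ±φ⁻¹, 0) / 2`, where `φ` is the golden ratio. -/
def icosians : Finset ℍ[ℝ] :=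
  (Finset.univ.image fun p : Fin 4 × ℤˣ =>
      let c : Fin 4 → ℝ := Pi.single p.1 ((p.2 : ℤ) : ℝ)
      (⟨c 0, c 1, c 2, c 3⟩ : ℍ[ℝ])) ∪
  (Finset.univ.image fun s : Fin 4 → ℤˣ =>
      let c : Fin 4 → ℝ := fun i => ((s i : ℤ) : ℝ) / 2
      (⟨c 0, c 1, c 2, c 3⟩ : ℍ[ℝ])) ∪
  (Finset.univ.image fun p : alternatingGroup (Fin 4) × (Fin 3 → ℤˣ) =>
      let b : Fin 4 → ℝ := ![((p.2 0 : ℤ) : ℝ) * Real.goldenRatio / 2, ((p.2 1 : ℤ) : ℝ) / 2,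
        ((p.2 2 : ℤ) : ℝ) * Real.goldenRatio⁻¹ / 2, 0]
      let c : Fin 4 → ℝ := fun i => b (p.1.1 i)
      (⟨c 0, c 1, c 2, c 3⟩ : ℍ[ℝ]))

/-- The boundary of the 600-cell: its tetrahedra are the quadruples of vertices at mutual distance
`φ⁻¹`, the edge length of the 600-cell with circumradius `1`. -/
def cell600 : Triangulation icosians where
  tets := {t | t.card = 4 ∧ ∀ x ∈ t, ∀ y ∈ t, x ≠ y →
    dist (x : ℍ[ℝ]) (y : ℍ[ℝ]) = Real.goldenRatio⁻¹}
  card_tets := fun _ ht => (Finset.mem_filter.mp ht).2.1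

/-- The edge `e'` is a left translate of the edge `e` by one of the icosians (these form a group
under quaternion multiplication, which acts simply transitively on the vertices). -/
def IsTranslate (e e' : cell600.edges) : Prop :=
  ∃ g : icosians, e'.1.image (fun x => (x : ℍ[ℝ])) = e.1.image (fun x => (g : ℍ[ℝ]) * (x : ℍ[ℝ]))

/-- The metrics on the 600-cell that are invariant under left translation by the icosians. -/
def invariantMetrics : Set (cell600.edges → ℝ) :=
  {ℓ | ℓ ∈ cell600.met ∧ ∀ e e', IsTranslate e e' → ℓ e' = ℓ e}

/-- The invariant metrics for which all tetrahedra are congruent. -/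
def congruentMetrics : Set (cell600.edges → ℝ) :=
  {ℓ | ℓ ∈ invariantMetrics ∧ cell600.AllTetsCongruent ℓ}

end PiecewiseFlat

end

/-! Left multiplication by the icosians is simply transitive on the vertices. Invariant quantities
at vertices are therefore constant and equal to their means, and summing `K_v`, `L_v`, `V_v` over
all vertices gives `EHR`, `totalLength` and `3 * totalVolume`. This is part 2
(`Triangulation.hasConstScalarCurvature`).

The sphere is obtained by radial projection. For a tetrahedron `t`, the linear functional
`Icosian.height t` is constant on the vertices of `t` and strictly smaller on all others, because
the largest inner product of distinct vertices is `φ / 2 < 1`. So the tetrahedra are facets of the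
convex hull. Every face lies in a second tetrahedron (`exists_flip`), and moving across faces until
the height of a given point is maximal shows that the cones over the tetrahedra cover the space.

Up to translation there are six types of edges, and the decisive combinatorial fact, checked on the
twenty tetrahedra at `1`, is that every tetrahedron has exactly one edge of each type
(`lab_injective`). An invariant metric is thus a vector of six lengths, and up to the number of
vertices the functionals become `ehrOf`, the sum of the lengths, and `volumeOf`. Prescribing `b` on
one type and `a` on the others makes all tetrahedra congruent. Conversely, a finite check on which
level sets of the lengths contain opposite edges shows that congruence of all tetrahedra forces five
of the six lengths to agree (`param_eq_update`).

On this family, scale to `a = 1`. By Schläfli's formula the angle-weighted length `OneEdge.weighted`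
has derivative `OneEdge.angle`, which is increasing, so it lies strictly above its tangent at `b =
1`; this settles `LEHR`. For `VEHR` the comparison is the sixth-power inequality
`OneEdge.ehr_pow_six_lt`, proved by explicit estimates on four ranges of `b`.

For the local statement, scale to mean length `1`. The linear terms of the expansions at the regular
metric then vanish, and the quadratic terms are negative multiples of the sum of squares, with the
bound `OneEdge.defect_bounds` on the angle defect entering for `VEHR`. Equal length metrics are
Einstein because every edge lies in exactly five tetrahedra (`degree_eq_five`). -/

open scoped Classical

namespace PiecewiseFlat

noncomputable section

/-! ### Euclidean tetrahedra in terms of squared edge lengths -/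

/-- Sixteen times the squared area of the triangle with squared side lengths `a`, `b`, `c`. -/
def heron (a b c : ℝ) : ℝ := 2 * a * b + 2 * b * c + 2 * c * a - a ^ 2 - b ^ 2 - c ^ 2

/-- The numerator of the cosine of the dihedral angle at the first edge of the tetrahedron with
squared edge lengths `a = ij`, `b = ik`, `c = il`, `d = jk`, `e = jl`, `f = kl`. -/
def hinge (a b c d e f : ℝ) : ℝ := 2 * a * (b + c - f) - (a + b - d) * (a + c - e)

/-- The Cayley-Menger determinant of the tetrahedron with squared edge lengths `a = ij`, `b = ik`,
`c = il`, `d = jk`, `e = jl`, `f = kl`. -/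
def cmPoly (a b c d e f : ℝ) : ℝ :=
  8 * a * b * c + 2 * (a + b - d) * (a + c - e) * (b + c - f) - 2 * a * (b + c - f) ^ 2
    - 2 * b * (a + c - e) ^ 2 - 2 * c * (a + b - d) ^ 2

/-- The dihedral angle at the first edge, in terms of the squared edge lengths. -/
def edgeAngle (a b c d e f : ℝ) : ℝ :=
  Real.arccos (hinge a b c d e f / (√(heron a b d) * √(heron a c e)))

/-- Since `heron (x²) (y²) (z²) = (2xy)² - (x² + y² - z²)²`, its nonnegativity says that `arccos` is
not clamped. -/
theorem cos_faceAngle {x y z : ℝ} (hx : 0 < x) (hy : 0 < y)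
    (h : 0 ≤ heron (x ^ 2) (y ^ 2) (z ^ 2)) :
    Real.cos (Real.arccos ((x ^ 2 + y ^ 2 - z ^ 2) / (2 * x * y)))
      = (x ^ 2 + y ^ 2 - z ^ 2) / (2 * x * y) := by
  have hxy : 0 < 2 * x * y := by positivity
  have : |x ^ 2 + y ^ 2 - z ^ 2| ≤ 2 * x * y := by
    apply abs_le_of_sq_le_sq _ hxy.le
    unfold heron at h
    nlinarith
  rw [abs_le] at this
  apply Real.cos_arccos
  · rw [le_div_iff₀ hxy]; linarith [this.1]
  · rw [div_le_iff₀ hxy]; linarith [this.2]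

/-- This is `1 - cos²` over a common denominator. When the triangle inequality fails, both sides are
zero, so no condition on `heron` is needed. -/
theorem sin_faceAngle {x y z : ℝ} (hx : 0 < x) (hy : 0 < y) :
    Real.sin (Real.arccos ((x ^ 2 + y ^ 2 - z ^ 2) / (2 * x * y)))
      = √(heron (x ^ 2) (y ^ 2) (z ^ 2)) / (2 * x * y) := by
  have hxy : 0 < 2 * x * y := by positivity
  rw [Real.sin_arccos, ← Real.sqrt_sq hxy.le, ← Real.sqrt_div' _ (sq_nonneg _),
    Real.sqrt_sq hxy.le]
  congr 1
  unfold heron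
  field_simp
  ring

/-- Positivity of the six lengths, the four areas and the volume. -/
structure IsNondegenerate (a b c d e f : ℝ) : Prop where
  a_pos : 0 < a
  b_pos : 0 < b
  c_pos : 0 < c
  d_pos : 0 < d
  e_pos : 0 < e
  f_pos : 0 < f
  abd : 0 < heron (a ^ 2) (b ^ 2) (d ^ 2)
  ace : 0 < heron (a ^ 2) (c ^ 2) (e ^ 2)
  bcf : 0 < heron (b ^ 2) (c ^ 2) (f ^ 2)
  def' : 0 < heron (d ^ 2) (e ^ 2) (f ^ 2)
  vol : 0 < cmPoly (a ^ 2) (b ^ 2) (c ^ 2) (d ^ 2) (e ^ 2) (f ^ 2)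

/-- The three swaps exchange `i, j`, then `k, l`, then `j, k`; they generate all relabelings of the
tetrahedron. The first two preserve the edge `ij`, hence also its dihedral angle. -/
theorem IsNondegenerate.swap_first {a b c d e f : ℝ} (h : IsNondegenerate a b c d e f) :
    IsNondegenerate a d e b c f := by
  obtain ⟨h1, h2, h3, h4, h5, h6, h7, h8, h9, h10, h11⟩ := h
  refine ⟨h1, h4, h5, h2, h3, h6, ?_, ?_, h10, h9, ?_⟩
  · convert h7 using 1; unfold heron; ring
  · convert h8 using 1; unfold heron; ring
  · convert h11 using 1; unfold cmPoly; ring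

theorem IsNondegenerate.swap_last {a b c d e f : ℝ} (h : IsNondegenerate a b c d e f) :
    IsNondegenerate a c b e d f := by
  obtain ⟨h1, h2, h3, h4, h5, h6, h7, h8, h9, h10, h11⟩ := h
  refine ⟨h1, h3, h2, h5, h4, h6, h8, h7, ?_, ?_, ?_⟩
  · convert h9 using 1; unfold heron; ring
  · convert h10 using 1; unfold heron; ring
  · convert h11 using 1; unfold cmPoly; ring

theorem IsNondegenerate.swap_middle {a b c d e f : ℝ} (h : IsNondegenerate a b c d e f) :
    IsNondegenerate b a c d f e := by
  obtain ⟨h1, h2, h3, h4, h5, h6, h7, h8, h9, h10, h11⟩ := h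
  refine ⟨h2, h1, h3, h4, h6, h5, ?_, h9, h8, ?_, ?_⟩
  · convert h7 using 1; unfold heron; ring
  · convert h10 using 1; unfold heron; ring
  · convert h11 using 1; unfold cmPoly; ring

theorem edgeAngle_swap_first (a b c d e f : ℝ) : edgeAngle a d e b c f = edgeAngle a b c d e f := by
  unfold edgeAngle
  congr 2
  · unfold hinge; ring
  · congr 2 <;> unfold heron <;> ring

theorem edgeAngle_swap_last (a b c d e f : ℝ) : edgeAngle a c b e d f = edgeAngle a b c d e f := by
  unfold edgeAngle
  rw [mul_comm (√(heron a c e))]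
  congr 2
  unfold hinge; ring

variable {V : Type}

/-- The function `F` of six lengths at the tetrahedron `i j k l`. -/
abbrev atTet {α : Type*} (F : ℝ → ℝ → ℝ → ℝ → ℝ → ℝ → α) (d : V → V → ℝ) (i j k l : V) : α :=
  F (d i j) (d i k) (d i l) (d j k) (d j l) (d k l)

/-- The dihedral angle at the first edge, in terms of the edge lengths. -/
def tetAngle (a b c d e f : ℝ) : ℝ := edgeAngle (a ^ 2) (b ^ 2) (c ^ 2) (d ^ 2) (e ^ 2) (f ^ 2)

/-- In the spherical cosine law, numerator and denominator both carry the factor `1 / (4 a² b c)`,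
which cancels. -/
theorem dihedral_eq (d : V → V → ℝ) {i j k l : V} (h : atTet IsNondegenerate d i j k l) :
    dihedral d i j k l = atTet tetAngle d i j k l := by
  have := Real.sqrt_pos.2 h.abd
  have := Real.sqrt_pos.2 h.ace
  have h1 := h.a_pos
  have h2 := h.b_pos
  have h3 := h.c_pos
  unfold atTet tetAngle
  rw [dihedral, faceAngle, faceAngle, faceAngle, cos_faceAngle h.b_pos h.c_pos h.bcf.le,
    cos_faceAngle h.a_pos h.b_pos h.abd.le, cos_faceAngle h.a_pos h.c_pos h.ace.le,
    sin_faceAngle h.a_pos h.b_pos, sin_faceAngle h.a_pos h.c_pos, edgeAngle]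
  congr 1
  unfold hinge
  field_simp

theorem dihedralAngle_quad (d : V → V → ℝ) (hd : ∀ x y, d x y = d y x) {i j k l : V}
    (h : atTet IsNondegenerate d i j k l) (hij : i ≠ j) (hik : i ≠ k) (hil : i ≠ l) (hjk : j ≠ k)
    (hjl : j ≠ l) (hkl : k ≠ l) :
    dihedralAngle d {i, j, k, l} {i, j} = atTet tetAngle d i j k l := by
  have hs : ({i, j, k, l} : Finset V) \ {i, j} = {k, l} := by
    ext x; simp only [Finset.mem_sdiff, Finset.mem_insert, Finset.mem_singleton]
    constructor
    · tauto
    · rintro (rfl | rfl)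
      · exact ⟨by tauto, by rintro (h | h); exacts [hik h.symm, hjk h.symm]⟩
      · exact ⟨by tauto, by rintro (h | h); exacts [hil h.symm, hjl h.symm]⟩
  have ho : ∀ {x y : V}, x ≠ y → ({x, y} : Finset V).offDiag = {(x, y), (y, x)} := by
    intro x y hxy
    ext ⟨u, v⟩
    simp only [Finset.mem_offDiag, Finset.mem_insert, Finset.mem_singleton, Prod.mk.injEq]
    constructor
    · rintro ⟨rfl | rfl, rfl | rfl, h⟩ <;> simp_all
    · rintro (⟨rfl, rfl⟩ | ⟨rfl, rfl⟩) <;> simp [hxy, hxy.symm]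
  have e1 : dihedral d i j l k = atTet tetAngle d i j k l := by
    rw [dihedral_eq d (by unfold atTet; rw [hd l k]; exact h.swap_last)]
    unfold atTet tetAngle; rw [hd l k, edgeAngle_swap_last]
  have e2 : dihedral d j i k l = atTet tetAngle d i j k l := by
    rw [dihedral_eq d (by unfold atTet; rw [hd j i]; exact h.swap_first)]
    unfold atTet tetAngle; rw [hd j i, edgeAngle_swap_first]
  have e3 : dihedral d j i l k = atTet tetAngle d i j k l := by
    rw [dihedral_eq d (by unfold atTet; rw [hd j i, hd l k]; exact h.swap_first.swap_last)]
    unfold atTet tetAngle; rw [hd j i, hd l k, edgeAngle_swap_last, edgeAngle_swap_first]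
  unfold dihedralAngle
  rw [hs, ho hij, ho hkl]
  have n1 : (i, j) ≠ (j, i) := by simp [hij]
  have n2 : (k, l) ≠ (l, k) := by simp [hkl]
  simp only [Finset.sum_pair n1, Finset.sum_pair n2, e1, e2, e3, dihedral_eq d h]
  ring

/-! ### Cayley-Menger determinants and their positivity -/

section

/-- The Cayley-Menger matrix on the indices of a list of vertices. -/
theorem det_cayleyMenger_eq {n : ℕ} (d : V → V → ℝ) {s : Finset V} (f : Fin n ≃ s) :
    (cayleyMenger d s).det = (Matrix.of fun a b : Fin (n + 1) => Fin.cases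
      (Fin.cases (0 : ℝ) (fun _ => 1) b)
      (fun x => Fin.cases 1 (fun y => if x = y then 0 else d (f x) (f y) ^ 2) b) a).det := by
  rw [← Matrix.det_submatrix_equiv_self ((finSuccEquiv n).trans (Equiv.optionCongr f))]
  congr 1
  ext a b
  refine Fin.cases ?_ (fun x => ?_) a <;> refine Fin.cases ?_ (fun y => ?_) b
  · simp [cayleyMenger, Matrix.of_apply]
  · simp [cayleyMenger, Matrix.of_apply]
  · simp [cayleyMenger, Matrix.of_apply]
  · simp [cayleyMenger, Matrix.of_apply, f.injective.eq_iff]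

/-- The enumeration of the range of an injective tuple. -/
def enumSet {n : ℕ} (f : Fin n → V) (hf : Function.Injective f) (s : Finset V)
    (hs : ∀ x, x ∈ s ↔ ∃ a, f a = x) : Fin n ≃ s :=
  Equiv.ofBijective (fun a => ⟨f a, (hs _).2 ⟨a, rfl⟩⟩)
    ⟨fun a b h => hf (by simpa using h), fun x => by
      obtain ⟨a, ha⟩ := (hs x.1).1 x.2; exact ⟨a, Subtype.ext ha⟩⟩

theorem det_cayleyMenger_triple (d : V → V → ℝ) (hd : ∀ x y, d x y = d y x) {i j k : V}
    (hij : i ≠ j) (hik : i ≠ k) (hjk : j ≠ k) :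
    (cayleyMenger d {i, j, k}).det = - heron (d i j ^ 2) (d i k ^ 2) (d j k ^ 2) := by
  have hinj : Function.Injective ![i, j, k] := by
    intro a b; fin_cases a <;> fin_cases b <;> simp [hij, hik, hjk, hij.symm, hik.symm, hjk.symm]
  have hs : ∀ x, x ∈ ({i, j, k} : Finset V) ↔ ∃ a, ![i, j, k] a = x := by
    intro x; simp [Fin.exists_fin_succ, eq_comm]
  rw [det_cayleyMenger_eq d (enumSet _ hinj _ hs), show Matrix.of _ =
    !![0, 1, 1, 1;
       1, 0, d i j ^ 2, d i k ^ 2;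
       1, d j i ^ 2, 0, d j k ^ 2;
       1, d k i ^ 2, d k j ^ 2, 0] by
    ext a b
    fin_cases a <;> fin_cases b <;> rfl]
  rw [hd j i, hd k i, hd k j]
  simp [Matrix.det_succ_row_zero, Fin.sum_univ_succ, Fin.succAbove, heron]
  ring

theorem det_cayleyMenger_quad (d : V → V → ℝ) (hd : ∀ x y, d x y = d y x) {i j k l : V}
    (hij : i ≠ j) (hik : i ≠ k) (hil : i ≠ l) (hjk : j ≠ k) (hjl : j ≠ l) (hkl : k ≠ l) :
    (cayleyMenger d {i, j, k, l}).det =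
      cmPoly (d i j ^ 2) (d i k ^ 2) (d i l ^ 2) (d j k ^ 2) (d j l ^ 2) (d k l ^ 2) := by
  have hinj : Function.Injective ![i, j, k, l] := by
    intro a b; fin_cases a <;> fin_cases b <;>
      simp [hij, hik, hjk, hij.symm, hik.symm, hjk.symm, hil, hil.symm, hjl, hjl.symm, hkl,
        hkl.symm]
  have hs : ∀ x, x ∈ ({i, j, k, l} : Finset V) ↔ ∃ a, ![i, j, k, l] a = x := by
    intro x; simp [Fin.exists_fin_succ, eq_comm]
  rw [det_cayleyMenger_eq d (enumSet _ hinj _ hs), show Matrix.of _ =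
    !![0, 1, 1, 1, 1;
       1, 0, d i j ^ 2, d i k ^ 2, d i l ^ 2;
       1, d j i ^ 2, 0, d j k ^ 2, d j l ^ 2;
       1, d k i ^ 2, d k j ^ 2, 0, d k l ^ 2;
       1, d l i ^ 2, d l j ^ 2, d l k ^ 2, 0] by
    ext a b
    fin_cases a <;> fin_cases b <;> rfl]
  rw [hd j i, hd k i, hd k j, hd l i, hd l j, hd l k]
  simp [Matrix.det_succ_row_zero, Fin.sum_univ_succ, Fin.succAbove, cmPoly]
  ring

/-- Affinely independent points have nondegenerate distances. -/
theorem isNondegenerate_of_affineIndependent (p : Fin 4 → EuclideanSpace ℝ (Fin 3))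
    (hp : AffineIndependent ℝ p) :
    IsNondegenerate (dist (p 0) (p 1)) (dist (p 0) (p 2)) (dist (p 0) (p 3)) (dist (p 1) (p 2))
      (dist (p 1) (p 3)) (dist (p 2) (p 3)) := by
  have key : ∀ (x y : EuclideanSpace ℝ (Fin 3)) (a : EuclideanSpace ℝ (Fin 3)),
      dist x y ^ 2 = inner ℝ (x - a) (x - a) + inner ℝ (y - a) (y - a)
        - 2 * inner ℝ (x - a) (y - a) := by
    intro x y a
    rw [dist_eq_norm, show x - y = (x - a) - (y - a) by abel, norm_sub_sq_real,
      real_inner_self_eq_norm_sq, real_inner_self_eq_norm_sq]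
    ring
  -- Gram determinants of independent edge vectors are positive; `heron` is four times the one of a
  -- triangle and `cmPoly` eight times the one of the tetrahedron.
  have hgram : ∀ {n : ℕ} (v : Fin n → EuclideanSpace ℝ (Fin 3)), LinearIndependent ℝ v →
      0 < (Matrix.gram ℝ v).det := fun v hv => (Matrix.posDef_gram_of_linearIndependent hv).det_pos
  have tri : ∀ i j k : Fin 4, i ≠ j → i ≠ k → j ≠ k →
      0 < heron (dist (p i) (p j) ^ 2) (dist (p i) (p k) ^ 2) (dist (p j) (p k) ^ 2) := by
    intro i j k hij hik hjk
    have hli := (affineIndependent_iff_linearIndependent_vsub ℝ p i).1 hp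
    have := hgram _ (hli.comp ![⟨j, hij.symm⟩, ⟨k, hik.symm⟩] (by
      intro a b; fin_cases a <;> fin_cases b <;> simp [hjk, hjk.symm]))
    rw [Matrix.det_fin_two] at this
    simp only [Matrix.gram_apply, Function.comp, Matrix.cons_val_zero, Matrix.cons_val_one,
      vsub_eq_sub] at this
    rw [key (p i) (p j) (p i), key (p i) (p k) (p i), key (p j) (p k) (p i)]
    rw [real_inner_comm (p j - p i) (p k - p i)] at this
    simp only [sub_self, inner_zero_left, heron]
    nlinarith
  have hdist : ∀ i j : Fin 4, i ≠ j → 0 < dist (p i) (p j) := fun i j h =>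
    dist_pos.2 (hp.injective.ne h)
  refine ⟨hdist _ _ (by decide), hdist _ _ (by decide), hdist _ _ (by decide),
    hdist _ _ (by decide), hdist _ _ (by decide), hdist _ _ (by decide),
    tri _ _ _ (by decide) (by decide) (by decide), tri _ _ _ (by decide) (by decide) (by decide),
    tri _ _ _ (by decide) (by decide) (by decide), tri _ _ _ (by decide) (by decide) (by decide),
    ?_⟩
  have hli := (affineIndependent_iff_linearIndependent_vsub ℝ p 0).1 hp
  have := hgram _ (hli.comp ![⟨1, by decide⟩, ⟨2, by decide⟩, ⟨3, by decide⟩] (by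
      intro a b; fin_cases a <;> fin_cases b <;> simp))
  rw [Matrix.det_fin_three] at this
  simp only [Matrix.gram_apply, Function.comp, Matrix.cons_val_zero, Matrix.cons_val_one,
      Matrix.cons_val, vsub_eq_sub] at this
  rw [key (p 0) (p 1) (p 0), key (p 0) (p 2) (p 0), key (p 0) (p 3) (p 0), key (p 1) (p 2) (p 0),
    key (p 1) (p 3) (p 0), key (p 2) (p 3) (p 0)]
  rw [real_inner_comm (p 1 - p 0) (p 2 - p 0), real_inner_comm (p 1 - p 0) (p 3 - p 0),
    real_inner_comm (p 2 - p 0) (p 3 - p 0)] at this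
  simp only [sub_self, inner_zero_left, cmPoly]
  nlinarith

end

end

end PiecewiseFlat

namespace PiecewiseFlat

noncomputable section

variable {V : Type}

/-! ### Sums over the simplices of a triangulation -/

theorem exists_eq_quad {s : Finset V} (h : s.card = 4) : ∃ i j k l, i ≠ j ∧ i ≠ k ∧ i ≠ l ∧ j ≠ k ∧
    j ≠ l ∧ k ≠ l ∧ s = {i, j, k, l} := by
  obtain ⟨a, t, ha, rfl, ht⟩ := Finset.card_eq_succ.1 h
  obtain ⟨b, c, d, h1, h2, h3, rfl⟩ := Finset.card_eq_three.1 ht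
  simp only [Finset.mem_insert, Finset.mem_singleton, not_or] at ha
  exact ⟨a, b, c, d, ha.1, ha.2.1, ha.2.2, h1, h2, h3, rfl⟩

namespace Triangulation

variable (T : Triangulation V) (ℓ : T.edges → ℝ)

/-- The length of an edge, extended by zero to all sets of vertices. -/
def lenSet (e : Finset V) : ℝ := if h : e ∈ T.edges then ℓ ⟨e, h⟩ else 0

theorem len_eq_lenSet (x y : V) : T.len ℓ x y = T.lenSet ℓ {x, y} := rfl

theorem lenSet_coe (e : T.edges) : T.lenSet ℓ e.1 = ℓ e := by
  simp [lenSet, e.2]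

theorem len_comm (x y : V) : T.len ℓ x y = T.len ℓ y x := by
  rw [len_eq_lenSet, len_eq_lenSet, Finset.pair_comm]

theorem card_of_mem_edges {e : Finset V} (he : e ∈ T.edges) : e.card = 2 := by
  obtain ⟨t, ht, h⟩ := Finset.mem_biUnion.1 he
  exact (Finset.mem_powersetCard.1 h).2

theorem exists_tet_of_mem_edges {e : Finset V} (he : e ∈ T.edges) : ∃ t ∈ T.tets, e ⊆ t := by
  obtain ⟨t, ht, h⟩ := Finset.mem_biUnion.1 he
  exact ⟨t, ht, (Finset.mem_powersetCard.1 h).1⟩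

theorem mem_edges {t : Finset V} (ht : t ∈ T.tets) {e : Finset V} (he : e ⊆ t) (hc : e.card = 2) :
    e ∈ T.edges :=
  Finset.mem_biUnion.2 ⟨t, ht, Finset.mem_powersetCard.2 ⟨he, hc⟩⟩

theorem isNondegenerate {T : Triangulation V} {ℓ : T.edges → ℝ} (hℓ : ℓ ∈ T.met) {i j k l : V}
    (ht : {i, j, k, l} ∈ T.tets) (hij : i ≠ j) (hik : i ≠ k) (hil : i ≠ l) (hjk : j ≠ k)
    (hjl : j ≠ l) (hkl : k ≠ l) : atTet IsNondegenerate (T.len ℓ) i j k l := by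
  obtain ⟨p, hp, hd⟩ := hℓ _ ht
  have hinj : Function.Injective ![i, j, k, l] := by
    intro a b; fin_cases a <;> fin_cases b <;>
      simp [hij, hik, hjk, hij.symm, hik.symm, hjk.symm, hil, hil.symm, hjl, hjl.symm, hkl,
        hkl.symm]
  have hs : ∀ x, x ∈ ({i, j, k, l} : Finset V) ↔ ∃ a, ![i, j, k, l] a = x := by
    intro x; simp [Fin.exists_fin_succ, eq_comm]
  have := isNondegenerate_of_affineIndependent (p ∘ enumSet _ hinj _ hs)
    (hp.comp_embedding (enumSet _ hinj _ hs).toEmbedding)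
  simp only [Function.comp, hd] at this
  exact this

theorem sum_edges (F : Finset V → ℝ) : ∑ e : T.edges, F e.1 = ∑ e ∈ T.edges, F e :=
  Finset.sum_coe_sort T.edges F

/-- Interchange of summation over incident pairs `e ⊆ t`; it turns the angle part of `EHR` into a
sum of contributions of single tetrahedra. -/
theorem sum_edges_sum_tets (g : Finset V → Finset V → ℝ) :
    ∑ e : T.edges, (∑ t ∈ T.tets with e.1 ⊆ t, g t e.1) * ℓ e =
      ∑ t ∈ T.tets, ∑ e ∈ t.powersetCard 2, g t e * T.lenSet ℓ e := by
  have h1 : ∀ e : T.edges, (∑ t ∈ T.tets with e.1 ⊆ t, g t e.1) * ℓ e =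
      ∑ t ∈ T.tets, if e.1 ⊆ t then g t e.1 * T.lenSet ℓ e.1 else 0 := by
    intro e
    rw [Finset.sum_mul, Finset.sum_filter, lenSet_coe]
  rw [Finset.sum_congr rfl fun e _ => h1 e, T.sum_edges fun e =>
    ∑ t ∈ T.tets, if e ⊆ t then g t e * T.lenSet ℓ e else 0, Finset.sum_comm]
  refine Finset.sum_congr rfl fun t ht => ?_
  rw [← Finset.sum_filter]
  refine Finset.sum_congr ?_ fun _ _ => rfl
  ext e
  simp only [Finset.mem_filter, Finset.mem_powersetCard]
  exact ⟨fun h => ⟨h.2, T.card_of_mem_edges h.1⟩, fun h => ⟨T.mem_edges ht h.1 h.2, h.1⟩⟩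

/-- The sum of the edge lengths of a tetrahedron, weighted by the dihedral angles. -/
def tetSum (t : Finset V) : ℝ :=
  ∑ e ∈ t.powersetCard 2, dihedralAngle (T.len ℓ) t e * T.lenSet ℓ e

theorem EHR_eq : T.EHR ℓ = 2 * Real.pi * T.totalLength ℓ - ∑ t ∈ T.tets, T.tetSum ℓ t := by
  unfold EHR edgeCurvature totalLength tetSum
  rw [← sum_edges_sum_tets, Finset.mul_sum, ← Finset.sum_sub_distrib]
  exact Finset.sum_congr rfl fun e _ => by ring

theorem pair_eq_pair_iff {a b c d : V} :
    ({a, b} : Finset V) = {c, d} ↔ a = c ∧ b = d ∨ a = d ∧ b = c := by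
  rw [← Finset.coe_inj]
  simpa using Set.pair_eq_pair_iff

theorem powersetCard_two_quad {i j k l : V} (hij : i ≠ j) (hik : i ≠ k) (hil : i ≠ l) (hjk : j ≠ k)
    (hjl : j ≠ l) (hkl : k ≠ l) : ({i, j, k, l} : Finset V).powersetCard 2 =
      {{i, j}, {i, k}, {i, l}, {j, k}, {j, l}, {k, l}} := by
  ext e
  simp only [Finset.mem_powersetCard, Finset.mem_insert, Finset.mem_singleton]
  constructor
  · rintro ⟨hs, hc⟩
    obtain ⟨x, y, hxy, rfl⟩ := Finset.card_eq_two.1 hc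
    have hx : x ∈ ({i, j, k, l} : Finset V) := hs (by simp)
    have hy : y ∈ ({i, j, k, l} : Finset V) := hs (by simp)
    simp only [Finset.mem_insert, Finset.mem_singleton] at hx hy
    rcases hx with rfl | rfl | rfl | rfl <;> rcases hy with rfl | rfl | rfl | rfl <;>
      first
      | exact absurd rfl hxy
      | (simp only [true_or, or_true])
      | (simp only [Finset.pair_comm x y, true_or, or_true])
  · rintro (rfl | rfl | rfl | rfl | rfl | rfl) <;>
      refine ⟨?_, Finset.card_pair (by assumption)⟩ <;> intro x <;>
      simp only [Finset.mem_insert, Finset.mem_singleton] <;> tauto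

theorem sum_powersetCard_two_quad {i j k l : V} (hij : i ≠ j) (hik : i ≠ k) (hil : i ≠ l)
    (hjk : j ≠ k) (hjl : j ≠ l) (hkl : k ≠ l) (F : Finset V → ℝ) :
    ∑ e ∈ ({i, j, k, l} : Finset V).powersetCard 2, F e =
      F {i, j} + F {i, k} + F {i, l} + F {j, k} + F {j, l} + F {k, l} := by
  rw [powersetCard_two_quad hij hik hil hjk hjl hkl, Finset.sum_insert, Finset.sum_insert,
    Finset.sum_insert, Finset.sum_insert, Finset.sum_insert, Finset.sum_singleton]
  · ring
  all_goals simp only [Finset.mem_insert, Finset.mem_singleton, pair_eq_pair_iff, hij, hik, hil, hjk, hjl,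
    hkl, hij.symm, hik.symm, hjk.symm, hjl.symm, hkl.symm, false_and, and_false, or_self,
    not_false_eq_true]

/-- The sum of the edge lengths of a tetrahedron with given edge lengths, weighted by the dihedral
angles. -/
def angleSum (a b c d e f : ℝ) : ℝ :=
  -- Each term relabels the tetrahedron so that the edge in question comes first.
  tetAngle a b c d e f * a + tetAngle b a c d f e * b + tetAngle c a b e f d * c +
    tetAngle d a e b f c * d + tetAngle e a d c f b * e + tetAngle f b d c e a * f

section
variable {T ℓ} (hℓ : ℓ ∈ T.met) {i j k l : V} (ht : {i, j, k, l} ∈ T.tets)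
  (hij : i ≠ j) (hik : i ≠ k) (hil : i ≠ l) (hjk : j ≠ k) (hjl : j ≠ l) (hkl : k ≠ l)
include hℓ ht hij hik hil hjk hjl hkl

theorem dihedralAngle_first : dihedralAngle (T.len ℓ) {i, j, k, l} {i, j} =
    atTet tetAngle (T.len ℓ) i j k l :=
  dihedralAngle_quad _ (T.len_comm ℓ) (isNondegenerate hℓ ht hij hik hil hjk hjl hkl)
    hij hik hil hjk hjl hkl

theorem tetSum_insert : T.tetSum ℓ {i, j, k, l} = atTet angleSum (T.len ℓ) i j k l := by
  have p1 : ({i, j, k, l} : Finset V) = {i, k, j, l} := by ext; simp; tauto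
  have p2 : ({i, j, k, l} : Finset V) = {i, l, j, k} := by ext; simp; tauto
  have p3 : ({i, j, k, l} : Finset V) = {j, k, i, l} := by ext; simp; tauto
  have p4 : ({i, j, k, l} : Finset V) = {j, l, i, k} := by ext; simp; tauto
  have p5 : ({i, j, k, l} : Finset V) = {k, l, i, j} := by ext; simp; tauto
  have h0 := dihedralAngle_first hℓ ht hij hik hil hjk hjl hkl
  have h1 := dihedralAngle_first hℓ (p1 ▸ ht) hik hij hil hjk.symm hkl hjl
  have h2 := dihedralAngle_first hℓ (p2 ▸ ht) hil hij hik hjl.symm hkl.symm hjk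
  have h3 := dihedralAngle_first hℓ (p3 ▸ ht) hjk hij.symm hjl hik.symm hkl hil
  have h4 := dihedralAngle_first hℓ (p4 ▸ ht) hjl hij.symm hjk hil.symm hkl.symm hik
  have h5 := dihedralAngle_first hℓ (p5 ▸ ht) hkl hik.symm hjk.symm hil.symm hjl.symm hij
  rw [← p1] at h1
  rw [← p2] at h2
  rw [← p3] at h3
  rw [← p4] at h4
  rw [← p5] at h5
  unfold tetSum
  rw [sum_powersetCard_two_quad hij hik hil hjk hjl hkl, h0, h1, h2, h3, h4, h5]
  simp only [atTet, angleSum, len_comm T ℓ j i, len_comm T ℓ k i, len_comm T ℓ k j,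
    len_comm T ℓ l i, len_comm T ℓ l j, len_comm T ℓ l k, ← len_eq_lenSet]

end

/-! ### Vertex sets as named terms, and the geometry of a single tetrahedron -/

/-- The set of four vertices. -/
def quad (i j k l : V) : Finset V := {i, j, k, l}

theorem mem_quad {i j k l x : V} : x ∈ quad i j k l ↔ x = i ∨ x = j ∨ x = k ∨ x = l := by
  simp [quad]

theorem exists_eq_quad_of_mem {s : Finset V} (h : s.card = 4) {x : V} (hx : x ∈ s) :
    ∃ j k l, x ≠ j ∧ x ≠ k ∧ x ≠ l ∧ j ≠ k ∧ j ≠ l ∧ k ≠ l ∧ s = quad x j k l := by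
  have hc : (s.erase x).card = 3 := by rw [Finset.card_erase_of_mem hx, h]
  obtain ⟨j, k, l, h1, h2, h3, hs⟩ := Finset.card_eq_three.1 hc
  have hx' : x ∉ s.erase x := by simp
  rw [hs] at hx'
  simp only [Finset.mem_insert, Finset.mem_singleton, not_or] at hx'
  exact ⟨j, k, l, hx'.1, hx'.2.1, hx'.2.2, h1, h2, h3, by rw [quad, ← hs, Finset.insert_erase hx]⟩

theorem card_quad {i j k l : V} (hij : i ≠ j) (hik : i ≠ k) (hil : i ≠ l) (hjk : j ≠ k)
    (hjl : j ≠ l) (hkl : k ≠ l) : (quad i j k l).card = 4 := by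
  rw [quad, Finset.card_insert_of_notMem, Finset.card_insert_of_notMem, Finset.card_pair hkl]
  · simp [hjk, hjl]
  · simp [hij, hik, hil]

/-- The set of two vertices. -/
def duo (i j : V) : Finset V := {i, j}

theorem mem_duo {i j x : V} : x ∈ duo i j ↔ x = i ∨ x = j := by
  simp [duo]

theorem card_duo {i j : V} (h : i ≠ j) : (duo i j).card = 2 := Finset.card_pair h

theorem duo_eq_duo_iff {i j k l : V} : duo i j = duo k l ↔ i = k ∧ j = l ∨ i = l ∧ j = k :=
  pair_eq_pair_iff

theorem exists_eq_duo {e : Finset V} (h : e.card = 2) : ∃ i j, i ≠ j ∧ e = duo i j :=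
  Finset.card_eq_two.1 h

theorem len_eq_lenSet_duo (x y : V) : T.len ℓ x y = T.lenSet ℓ (duo x y) := rfl

/-- The volume of the tetrahedron with given edge lengths. -/
def volOf (a b c d e f : ℝ) : ℝ :=
  √(cmPoly (a ^ 2) (b ^ 2) (c ^ 2) (d ^ 2) (e ^ 2) (f ^ 2) / 288)

theorem tetVolume_insert {i j k l : V} (hij : i ≠ j) (hik : i ≠ k) (hil : i ≠ l) (hjk : j ≠ k)
    (hjl : j ≠ l) (hkl : k ≠ l) :
    tetVolume (T.len ℓ) {i, j, k, l} = atTet volOf (T.len ℓ) i j k l := by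
  rw [tetVolume, det_cayleyMenger_quad _ (T.len_comm ℓ) hij hik hil hjk hjl hkl]
  rfl

variable {T ℓ}

theorem tetVolume_pos (hℓ : ℓ ∈ T.met) {t : Finset V} (ht : t ∈ T.tets) :
    0 < tetVolume (T.len ℓ) t := by
  obtain ⟨i, j, k, l, hij, hik, hil, hjk, hjl, hkl, rfl⟩ := exists_eq_quad (T.card_tets t ht)
  rw [tetVolume_insert T ℓ hij hik hil hjk hjl hkl]
  have := (isNondegenerate hℓ ht hij hik hil hjk hjl hkl).vol
  unfold atTet volOf
  positivity

section
variable (hℓ : ℓ ∈ T.met) {i j k l : V} (ht : quad i j k l ∈ T.tets)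
  (hij : i ≠ j) (hik : i ≠ k) (hil : i ≠ l) (hjk : j ≠ k) (hjl : j ≠ l) (hkl : k ≠ l)
include hℓ ht hij hik hil hjk hjl hkl

theorem isNondegenerate_quad : atTet IsNondegenerate (T.len ℓ) i j k l :=
  isNondegenerate hℓ ht hij hik hil hjk hjl hkl

theorem tetSum_quad : T.tetSum ℓ (quad i j k l) = atTet angleSum (T.len ℓ) i j k l :=
  tetSum_insert hℓ ht hij hik hil hjk hjl hkl

theorem dihedralAngle_quad_duo : dihedralAngle (T.len ℓ) (quad i j k l) (duo i j) =
    atTet tetAngle (T.len ℓ) i j k l :=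
  dihedralAngle_first hℓ ht hij hik hil hjk hjl hkl

omit hℓ ht in
theorem tetVolume_quad :
    tetVolume (T.len ℓ) (quad i j k l) = atTet volOf (T.len ℓ) i j k l :=
  tetVolume_insert T ℓ hij hik hil hjk hjl hkl

end

/-- A zero determinant would give zero volume. Invertibility is what gives `circumBary`, an entry of
the inverse matrix, its meaning. -/
theorem det_cayleyMenger_ne_zero (hℓ : ℓ ∈ T.met) {t : Finset V} (ht : t ∈ T.tets) :
    (cayleyMenger (T.len ℓ) t).det ≠ 0 := by
  intro h
  have := tetVolume_pos hℓ ht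
  simp [tetVolume, h] at this

theorem triArea_pos (hℓ : ℓ ∈ T.met) {t : Finset V} (ht : t ∈ T.tets) {w : V} (hw : w ∈ t) :
    0 < triArea (T.len ℓ) (t.erase w) := by
  have hc : (t.erase w).card = 3 := by rw [Finset.card_erase_of_mem hw, T.card_tets t ht]
  obtain ⟨i, j, k, hij, hik, hjk, h⟩ := Finset.card_eq_three.1 hc
  have hwi : w ∉ t.erase w := by simp
  rw [h] at hwi
  simp only [Finset.mem_insert, Finset.mem_singleton, not_or] at hwi
  have htw : t = {w, i, j, k} := by rw [← h, Finset.insert_erase hw]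
  have := (isNondegenerate hℓ (htw ▸ ht) hwi.1 hwi.2.1 hwi.2.2 hij hik hjk).def'
  rw [h, triArea, det_cayleyMenger_triple _ (T.len_comm ℓ) hij hik hjk, neg_neg]
  positivity

theorem pos_of_mem_met (hℓ : ℓ ∈ T.met) (e : T.edges) : 0 < ℓ e := by
  obtain ⟨t, ht, h⟩ := Finset.mem_biUnion.1 e.2
  obtain ⟨hs, hc⟩ := Finset.mem_powersetCard.1 h
  obtain ⟨x, y, hxy, he⟩ := Finset.card_eq_two.1 hc
  obtain ⟨p, hp, hd⟩ := hℓ t ht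
  have hx : x ∈ t := hs (by simp [he])
  have hy : y ∈ t := hs (by simp [he])
  rw [← T.lenSet_coe ℓ e, he, ← len_eq_lenSet, ← hd ⟨x, hx⟩ ⟨y, hy⟩, dist_pos]
  exact hp.injective.ne (by simpa using hxy)

/-- The bordering row of the Cayley-Menger matrix is `(0, 1, …, 1)`; multiply it by the bordering
column of the inverse. -/
theorem sum_circumBary (hℓ : ℓ ∈ T.met) {t : Finset V} (ht : t ∈ T.tets) :
    ∑ w : t, circumBary (T.len ℓ) t w = 1 := by
  have h := Matrix.mul_nonsing_inv _ (det_cayleyMenger_ne_zero hℓ ht).isUnit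
  have h2 := congrFun (congrFun h none) none
  rw [Matrix.mul_apply, Fintype.sum_option, Matrix.one_apply_eq] at h2
  simpa [cayleyMenger, circumBary] using h2

/-! ### Automorphisms -/

/-- A permutation of the vertices that preserves the tetrahedra and the edge lengths. -/
structure IsIsometry (T : Triangulation V) (ℓ : T.edges → ℝ) (π : Equiv.Perm V) : Prop where
  map_mem : ∀ t, t.map π.toEmbedding ∈ T.tets ↔ t ∈ T.tets
  len_map : ∀ x y, T.len ℓ (π x) (π y) = T.len ℓ x y

/-- The action of a permutation on the subsets of a set. -/
def mapEquiv (π : Equiv.Perm V) : Finset V ≃ Finset V := Equiv.finsetCongr π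

theorem mapEquiv_apply (π : Equiv.Perm V) (s : Finset V) : mapEquiv π s = s.map π.toEmbedding := rfl

theorem mem_mapEquiv (π : Equiv.Perm V) (s : Finset V) (x : V) : π x ∈ mapEquiv π s ↔ x ∈ s := by
  simp [mapEquiv_apply]

theorem mapEquiv_duo (π : Equiv.Perm V) (x y : V) : mapEquiv π (duo x y) = duo (π x) (π y) := by
  simp [mapEquiv_apply, duo]

theorem subset_mapEquiv (π : Equiv.Perm V) (s t : Finset V) :
    mapEquiv π s ⊆ mapEquiv π t ↔ s ⊆ t := by
  simp [mapEquiv_apply]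

theorem sum_offDiag_mapEquiv (π : Equiv.Perm V) (s : Finset V) (F : V × V → ℝ) :
    ∑ p ∈ (mapEquiv π s).offDiag, F p = ∑ p ∈ s.offDiag, F (π p.1, π p.2) := by
  symm
  refine Finset.sum_nbij' (fun p => (π p.1, π p.2)) (fun p => (π.symm p.1, π.symm p.2)) ?_ ?_ ?_ ?_
    ?_ <;> simp [mapEquiv_apply, Finset.mem_offDiag]

theorem dihedralAngle_map (d : V → V → ℝ) (π : Equiv.Perm V) (hd : ∀ x y, d (π x) (π y) = d x y)
    (t e : Finset V) : dihedralAngle d (mapEquiv π t) (mapEquiv π e) = dihedralAngle d t e := by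
  have : mapEquiv π t \ mapEquiv π e = mapEquiv π (t \ e) := by
    simp [mapEquiv_apply, Finset.map_sdiff]
  unfold dihedralAngle
  rw [this]
  simp only [sum_offDiag_mapEquiv, dihedral, faceAngle, hd]

/-- The bijection between a set of vertices and its image. -/
def restrictEquiv (π : Equiv.Perm V) (s : Finset V) : s ≃ mapEquiv π s :=
  π.subtypeEquiv fun x => (mem_mapEquiv π s x).symm

/-- An isometry permutes rows and columns simultaneously. This preserves the determinant and
commutes with inversion, so volumes, areas and circumcentric coordinates are all carried along. -/
theorem cayleyMenger_map (d : V → V → ℝ) (π : Equiv.Perm V) (hd : ∀ x y, d (π x) (π y) = d x y)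
    (s : Finset V) : (cayleyMenger d (mapEquiv π s)).submatrix (restrictEquiv π s).optionCongr
      (restrictEquiv π s).optionCongr = cayleyMenger d s := by
  ext a b
  cases a <;> cases b
  case some.some a b =>
    change (if restrictEquiv π s a = restrictEquiv π s b then (0 : ℝ) else d (π a) (π b) ^ 2) =
      if a = b then 0 else d a b ^ 2
    simp only [(restrictEquiv π s).injective.eq_iff, hd]
  all_goals rfl

theorem det_cayleyMenger_map (d : V → V → ℝ) (π : Equiv.Perm V)
    (hd : ∀ x y, d (π x) (π y) = d x y) (s : Finset V) :
    (cayleyMenger d (mapEquiv π s)).det = (cayleyMenger d s).det := by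
  rw [← cayleyMenger_map d π hd s, Matrix.det_submatrix_equiv_self]

theorem circumBary_map (d : V → V → ℝ) (π : Equiv.Perm V) (hd : ∀ x y, d (π x) (π y) = d x y)
    (s : Finset V) (w : s) :
    circumBary d (mapEquiv π s) (restrictEquiv π s w) = circumBary d s w := by
  unfold circumBary
  rw [← cayleyMenger_map d π hd s, Matrix.inv_submatrix_equiv]
  rfl

theorem faceHeight_map (d : V → V → ℝ) (π : Equiv.Perm V) (hd : ∀ x y, d (π x) (π y) = d x y)
    (t : Finset V) (w : t) : faceHeight d (mapEquiv π t) (restrictEquiv π t w) *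
        triArea d ((mapEquiv π t).erase (restrictEquiv π t w)) =
      faceHeight d t w * triArea d (t.erase w) := by
  have : (mapEquiv π t).erase (restrictEquiv π t w) = mapEquiv π (t.erase w) := by
    rw [mapEquiv_apply π (t.erase w), Finset.map_erase]; rfl
  unfold faceHeight tetVolume triArea
  rw [this, circumBary_map d π hd, det_cayleyMenger_map d π hd, det_cayleyMenger_map d π hd]

theorem mapEquiv_mem_edges {π : Equiv.Perm V} (h : ∀ t, mapEquiv π t ∈ T.tets ↔ t ∈ T.tets)
    (e : Finset V) : mapEquiv π e ∈ T.edges ↔ e ∈ T.edges := by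
  have key : ∀ (t e : Finset V), e ∈ t.powersetCard 2 ↔
      mapEquiv π e ∈ (mapEquiv π t).powersetCard 2 := by
    intro t e
    simp [Finset.mem_powersetCard, mapEquiv_apply]
  unfold edges
  simp only [Finset.mem_biUnion]
  constructor
  · rintro ⟨t, ht, he⟩
    obtain ⟨t, rfl⟩ := (mapEquiv π).surjective t
    exact ⟨t, (h t).1 ht, (key _ _).2 he⟩
  · rintro ⟨t, ht, he⟩
    exact ⟨_, (h t).2 ht, (key _ _).1 he⟩

theorem sum_tets_mapEquiv {π : Equiv.Perm V}
    (h : ∀ t, mapEquiv π t ∈ T.tets ↔ t ∈ T.tets) (F : Finset V → ℝ) : ∑ t ∈ T.tets, F (mapEquiv π t) = ∑ t ∈ T.tets, F t := by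
  refine Finset.sum_bij (fun t _ => mapEquiv π t) (fun t ht => (h t).2 ht)
    (fun _ _ _ _ => (mapEquiv π).injective.eq_iff.1) (fun t ht => ?_) (fun _ _ => rfl)
  obtain ⟨t, rfl⟩ := (mapEquiv π).surjective t
  exact ⟨t, (h t).1 ht, rfl⟩

namespace IsIsometry

variable {π : Equiv.Perm V} (h : T.IsIsometry ℓ π)
include h

theorem mem_edges (e : Finset V) : mapEquiv π e ∈ T.edges ↔ e ∈ T.edges :=
  mapEquiv_mem_edges h.map_mem e

/-- The induced permutation of the edges. -/
def edgeEquiv : T.edges ≃ T.edges := (mapEquiv π).subtypeEquiv fun e => (h.mem_edges e).symm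

theorem sum_tets (F : Finset V → ℝ) : ∑ t ∈ T.tets, F (mapEquiv π t) = ∑ t ∈ T.tets, F t :=
  sum_tets_mapEquiv h.map_mem F

theorem apply_edgeEquiv (e : T.edges) : ℓ (h.edgeEquiv e) = ℓ e := by
  obtain ⟨x, y, hxy, he⟩ := Finset.card_eq_two.1 (T.card_of_mem_edges e.2)
  have h1 : (h.edgeEquiv e).1 = {π x, π y} := by
    change mapEquiv π e.1 = _
    rw [he, mapEquiv_apply]; simp
  rw [← T.lenSet_coe ℓ e, ← T.lenSet_coe ℓ (h.edgeEquiv e), h1, he]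
  exact h.len_map x y

theorem edgeCurvature (e : T.edges) :
    T.edgeCurvature ℓ (h.edgeEquiv e) = T.edgeCurvature ℓ e := by
  unfold Triangulation.edgeCurvature
  rw [h.apply_edgeEquiv, Finset.sum_filter, Finset.sum_filter, ← h.sum_tets]
  change (_ - ∑ t ∈ T.tets, if mapEquiv π e.1 ⊆ mapEquiv π t then
    dihedralAngle (T.len ℓ) (mapEquiv π t) (mapEquiv π e.1) else 0) * _ = _
  simp only [subset_mapEquiv, dihedralAngle_map _ π h.len_map]

theorem lenSet (e : Finset V) (he : e.card = 2) :
    T.lenSet ℓ (mapEquiv π e) = T.lenSet ℓ e := by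
  obtain ⟨x, y, hxy, rfl⟩ := exists_eq_duo he
  rw [mapEquiv_duo]
  exact h.len_map x y

theorem tetSum (t : Finset V) : T.tetSum ℓ (mapEquiv π t) = T.tetSum ℓ t := by
  unfold Triangulation.tetSum
  rw [mapEquiv_apply, Finset.powersetCard_map, Finset.sum_map]
  refine Finset.sum_congr rfl fun e he => ?_
  change dihedralAngle _ (mapEquiv π t) (mapEquiv π e) * T.lenSet ℓ (mapEquiv π e) = _
  rw [dihedralAngle_map _ π h.len_map, h.lenSet e (Finset.mem_powersetCard.1 he).2]

theorem tetVolume (t : Finset V) :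
    tetVolume (T.len ℓ) (mapEquiv π t) = tetVolume (T.len ℓ) t := by
  unfold PiecewiseFlat.tetVolume
  rw [det_cayleyMenger_map _ π h.len_map]

theorem sum_edges_at (F : T.edges → ℝ) (hF : ∀ e, F (h.edgeEquiv e) = F e) (v : V) :
    ∑ e : T.edges with π v ∈ e.1, F e = ∑ e : T.edges with v ∈ e.1, F e := by
  rw [Finset.sum_filter, Finset.sum_filter, ← Equiv.sum_comp h.edgeEquiv]
  refine Finset.sum_congr rfl fun e _ => ?_
  rw [hF]
  change (if π v ∈ mapEquiv π e.1 then _ else _) = _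
  simp only [mem_mapEquiv]

theorem vertexCurvature (v : V) : T.vertexCurvature ℓ (π v) = T.vertexCurvature ℓ v := by
  unfold Triangulation.vertexCurvature
  rw [h.sum_edges_at _ h.edgeCurvature]

theorem vertexLength (v : V) : T.vertexLength ℓ (π v) = T.vertexLength ℓ v := by
  unfold Triangulation.vertexLength
  rw [h.sum_edges_at _ h.apply_edgeEquiv]

theorem vertexVolume (v : V) : T.vertexVolume ℓ (π v) = T.vertexVolume ℓ v := by
  unfold Triangulation.vertexVolume
  rw [Finset.sum_filter, Finset.sum_filter, ← h.sum_tets]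
  congr 1
  refine Finset.sum_congr rfl fun t _ => ?_
  simp only [mem_mapEquiv]
  congr 1
  rw [Finset.sum_filter, Finset.sum_filter, ← Equiv.sum_comp (restrictEquiv π t)]
  refine Finset.sum_congr rfl fun w _ => ?_
  rw [faceHeight_map _ π h.len_map]
  have : ((restrictEquiv π t w).1 ≠ π v) = (w.1 ≠ v) := by simp [restrictEquiv]
  simp only [this]

end IsIsometry

/-! ### Averaging over a vertex transitive group -/

section
variable [Fintype V]

/-- Every edge has two endpoints, which cancels the factor one half. -/
theorem sum_sum_edges_at (F : T.edges → ℝ) :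
    ∑ v : V, (∑ e : T.edges with v ∈ e.1, F e) / 2 = ∑ e, F e := by
  simp only [Finset.sum_filter]
  rw [← Finset.sum_div, Finset.sum_comm, Finset.sum_div]
  refine Finset.sum_congr rfl fun e _ => ?_
  rw [← Finset.sum_filter]
  simp [T.card_of_mem_edges e.2]

/-- The area cancels in `h_{f<t} A_f`, leaving three volumes times the barycentric coordinate at the
opposite vertex. Each face is counted at its three vertices and the coordinates sum to one, so a
tetrahedron contributes nine thirds of its volume. -/
theorem sum_vertexVolume (hℓ : ℓ ∈ T.met) : ∑ v, T.vertexVolume ℓ v = 3 * T.totalVolume ℓ := by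
  unfold vertexVolume
  simp only [Finset.sum_filter]
  rw [← Finset.sum_div, Finset.sum_comm, totalVolume, Finset.sum_div, Finset.mul_sum]
  refine Finset.sum_congr rfl fun t ht => ?_
  have h1 : ∀ v, (if v ∈ t then ∑ w : t, (if w.1 ≠ v then faceHeight (T.len ℓ) t w *
      triArea (T.len ℓ) (t.erase w) else 0) else 0) = ∑ w : t, if v ∈ t.erase w.1 then
        circumBary (T.len ℓ) t w * (3 * tetVolume (T.len ℓ) t) else 0 := by
    intro v
    by_cases hv : v ∈ t
    · rw [if_pos hv]
      refine Finset.sum_congr rfl fun w _ => ?_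
      have := (triArea_pos hℓ ht w.2).ne'
      simp only [Finset.mem_erase, hv, and_true, ne_comm (a := w.1)]
      congr 1
      unfold faceHeight
      field_simp
    · simp [hv]
  simp only [h1]
  rw [Finset.sum_comm]
  have h2 : ∀ w : t, (∑ v, if v ∈ t.erase w.1 then
      circumBary (T.len ℓ) t w * (3 * tetVolume (T.len ℓ) t) else 0) =
      circumBary (T.len ℓ) t w * (9 * tetVolume (T.len ℓ) t) := by
    intro w
    rw [← Finset.sum_filter, Finset.filter_mem_eq_inter, Finset.univ_inter, Finset.sum_const,
      Finset.card_erase_of_mem w.2, T.card_tets t ht, nsmul_eq_mul]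
    push_cast
    ring
  simp only [h2]
  rw [← Finset.sum_mul, sum_circumBary hℓ ht]
  ring

/-- A metric with a vertex transitive group of isometries has constant scalar curvature. -/
theorem hasConstScalarCurvature (hℓ : ℓ ∈ T.met) (hne : T.tets.Nonempty)
    (htrans : ∀ v w : V, ∃ π, T.IsIsometry ℓ π ∧ π v = w) :
    T.HasConstLScalarCurvature ℓ ∧ T.HasConstVScalarCurvature ℓ := by
  obtain ⟨t, ht⟩ := hne
  obtain ⟨i, j, k, l, hij, hik, hil, hjk, hjl, hkl, rfl⟩ := exists_eq_quad (T.card_tets t ht)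
  have e₀ : T.edges := ⟨{i, j}, T.mem_edges ht (by intro; simp; tauto) (Finset.card_pair hij)⟩
  have : Nonempty V := ⟨i⟩
  have hn : (0 : ℝ) < Fintype.card V := by exact_mod_cast Fintype.card_pos
  -- An invariant function equals its mean by transitivity, so it is enough to compare totals over
  -- all vertices.
  have havg : ∀ (F : V → ℝ), (∀ π, T.IsIsometry ℓ π → ∀ v, F (π v) = F v) →
      ∀ v, F v = (∑ w, F w) / Fintype.card V := by
    intro F hF v
    have : ∀ w, F w = F v := by
      intro w
      obtain ⟨π, h, rfl⟩ := htrans v w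
      exact hF π h v
    rw [Finset.sum_congr rfl fun w _ => this w]
    simp [hn.ne']
  have hL : 0 < T.totalLength ℓ := Finset.sum_pos (fun e _ => pos_of_mem_met hℓ e) ⟨e₀, by simp⟩
  have hV : 0 < T.totalVolume ℓ := Finset.sum_pos (fun t ht => tetVolume_pos hℓ ht) ⟨_, ht⟩
  have hK : ∀ v, T.vertexCurvature ℓ v = T.EHR ℓ / Fintype.card V := fun v => by
    rw [havg _ (fun π h => h.vertexCurvature) v]
    congr 1
    exact sum_sum_edges_at _
  refine ⟨⟨hℓ, fun v => ?_⟩, ⟨hℓ, fun v => ?_⟩⟩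
  · rw [hK, havg _ (fun π h => h.vertexLength) v]
    have : ∑ w, T.vertexLength ℓ w = T.totalLength ℓ := sum_sum_edges_at _
    rw [this, LEHR]
    field_simp
  · rw [hK, havg _ (fun π h => h.vertexVolume) v, sum_vertexVolume hℓ]
    field_simp

/-- The sum of an invariant function over all tetrahedra is determined by those at one vertex. -/
theorem sum_tets_eq_sum_at (F : Finset V → ℝ) (v : V) (htrans : ∀ w : V, ∃ π : Equiv.Perm V,
      (∀ t, mapEquiv π t ∈ T.tets ↔ t ∈ T.tets) ∧ (∀ t, F (mapEquiv π t) = F t) ∧ π v = w) :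
    ∑ t ∈ T.tets, F t = Fintype.card V * ((∑ t ∈ T.tets with v ∈ t, F t) / 4) := by
  -- Count pairs of a tetrahedron and one of its four vertices.
  have h1 : ∑ w : V, ∑ t ∈ T.tets with w ∈ t, F t = 4 * ∑ t ∈ T.tets, F t := by
    simp only [Finset.sum_filter]
    rw [Finset.sum_comm, Finset.mul_sum]
    refine Finset.sum_congr rfl fun t ht => ?_
    rw [← Finset.sum_filter, Finset.filter_mem_eq_inter, Finset.univ_inter, Finset.sum_const,
      T.card_tets t ht, nsmul_eq_mul]
    norm_num
  have h2 : ∀ w, ∑ t ∈ T.tets with w ∈ t, F t = ∑ t ∈ T.tets with v ∈ t, F t := by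
    intro w
    obtain ⟨π, hπ, hF, rfl⟩ := htrans w
    rw [Finset.sum_filter, Finset.sum_filter, ← sum_tets_mapEquiv hπ]
    simp only [mem_mapEquiv, hF]
  rw [Finset.sum_congr rfl fun w _ => h2 w, Finset.sum_const, nsmul_eq_mul, Finset.card_univ] at h1
  linarith

theorem sum_tets_eq {ι : Type*} [Fintype ι] {F : Finset V → ℝ} {v : V} {b : ι → Finset V}
    (hb : Function.Injective b) (hmem : ∀ i, b i ∈ T.tets) (hv : ∀ i, v ∈ b i)
    (hsurj : ∀ t ∈ T.tets, v ∈ t → ∃ i, b i = t) (htrans : ∀ w : V, ∃ π : Equiv.Perm V,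
      (∀ t, mapEquiv π t ∈ T.tets ↔ t ∈ T.tets) ∧ (∀ t, F (mapEquiv π t) = F t) ∧ π v = w) :
    ∑ t ∈ T.tets, F t = Fintype.card V * ((∑ i, F (b i)) / 4) := by
  rw [sum_tets_eq_sum_at F v htrans]
  congr 2
  symm
  refine Finset.sum_bij (fun i _ => b i) (fun i _ => ?_) (fun _ _ _ _ h => hb h)
    (fun t ht => ?_) (fun _ _ => rfl)
  · exact Finset.mem_filter.2 ⟨hmem i, hv i⟩
  · obtain ⟨ht, h1⟩ := Finset.mem_filter.1 ht
    obtain ⟨i, hi⟩ := hsurj t ht h1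
    exact ⟨i, Finset.mem_univ _, hi⟩

theorem totalLength_eq {ι : Type*} [Fintype ι] {v : V} {b : ι → T.edges}
    (hb : Function.Injective b) (hv : ∀ i, v ∈ (b i).1)
    (hsurj : ∀ e : T.edges, v ∈ e.1 → ∃ i, b i = e)
    (htrans : ∀ w : V, ∃ π, T.IsIsometry ℓ π ∧ π v = w) :
    T.totalLength ℓ = Fintype.card V * ((∑ i, ℓ (b i)) / 2) := by
  have h1 : ∀ w, T.vertexLength ℓ w = T.vertexLength ℓ v := by
    intro w
    obtain ⟨π, hπ, rfl⟩ := htrans w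
    exact hπ.vertexLength v
  have h2 : T.totalLength ℓ = ∑ w, T.vertexLength ℓ w := (sum_sum_edges_at _).symm
  rw [h2, Finset.sum_congr rfl fun w _ => h1 w, Finset.sum_const, nsmul_eq_mul, Finset.card_univ,
    vertexLength]
  congr 2
  symm
  refine Finset.sum_bij (fun i _ => b i) (fun i _ => ?_) (fun _ _ _ _ h => hb h)
    (fun e he => ?_) (fun _ _ => rfl)
  · exact Finset.mem_filter.2 ⟨Finset.mem_univ _, hv i⟩
  · obtain ⟨i, hi⟩ := hsurj e (Finset.mem_filter.1 he).2
    exact ⟨i, Finset.mem_univ _, hi⟩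

end

end Triangulation

end

end PiecewiseFlat

namespace PiecewiseFlat
noncomputable section
/-! ### The icosians -/

/-- A quaternion with coordinates `(a + b φ) / 2`, given by the four pairs `(a, b)` of integers. -/
abbrev Ico : Type := (ℤ × ℤ) × (ℤ × ℤ) × (ℤ × ℤ) × (ℤ × ℤ)

namespace Ico
/-- The product of `a + b φ` and `c + d φ`. -/
def zmul (p q : ℤ × ℤ) : ℤ × ℤ := (p.1 * q.1 + p.2 * q.2, p.1 * q.2 + p.2 * q.1 + p.2 * q.2)

/-- Twice the product. -/
def dmul (x y : Ico) : Ico :=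
  (zmul x.1 y.1 - zmul x.2.1 y.2.1 - zmul x.2.2.1 y.2.2.1 - zmul x.2.2.2 y.2.2.2,
   zmul x.1 y.2.1 + zmul x.2.1 y.1 + zmul x.2.2.1 y.2.2.2 - zmul x.2.2.2 y.2.2.1,
   zmul x.1 y.2.2.1 - zmul x.2.1 y.2.2.2 + zmul x.2.2.1 y.1 + zmul x.2.2.2 y.2.1,
   zmul x.1 y.2.2.2 + zmul x.2.1 y.2.2.1 - zmul x.2.2.1 y.2.1 + zmul x.2.2.2 y.1)

/-- Integer division rounds, so this is a genuine half only for even entries. Wherever `act` is used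
as a product, exactness is certified by an identity `dmul x y = act x y + act x y`. -/
def zhalf (p : ℤ × ℤ) : ℤ × ℤ := (p.1 / 2, p.2 / 2)
def half (x : Ico) : Ico := (zhalf x.1, zhalf x.2.1, zhalf x.2.2.1, zhalf x.2.2.2)
/-- The product, if it has the above form. -/
def act (x y : Ico) : Ico := half (dmul x y)

def evenPerms : List (Fin 4 → Fin 4) := [![0, 1, 2, 3], ![0, 2, 3, 1], ![0, 3, 1, 2], ![1, 0, 3, 2],
  ![1, 2, 0, 3], ![1, 3, 2, 0], ![2, 0, 1, 3], ![2, 1, 3, 0], ![2, 3, 0, 1], ![3, 0, 2, 1],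
  ![3, 1, 0, 2], ![3, 2, 1, 0]]

def ofFun (c : Fin 4 → ℤ × ℤ) : Ico := (c 0, c 1, c 2, c 3)
def signs : List ℤ := [1, -1]
def model₁ (i : Fin 4) (s : ℤ) : Ico := ofFun fun j => if j = i then (2 * s, 0) else (0, 0)
def model₂ (a b c d : ℤ) : Ico := ((a, 0), (b, 0), (c, 0), (d, 0))
-- The pair `(-c, c)` stands for `c φ⁻¹`, since `φ⁻¹ = φ - 1`.
def model₃ (f : Fin 4 → Fin 4) (a b c : ℤ) : Ico := ofFun fun j => ![(0, a), (b, 0), (-c, c), (0, 0)] (f j)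

def families : List Ico :=
  (List.finRange 4).flatMap (fun i => signs.map (model₁ i)) ++
  signs.flatMap (fun a => signs.flatMap fun b => signs.flatMap fun c => signs.map (model₂ a b c)) ++
  evenPerms.flatMap fun f => signs.flatMap fun a => signs.flatMap fun b => signs.map (model₃ f a b)

def one : Ico := ((2, 0), (0, 0), (0, 0), (0, 0))
def gi : Ico := ((0, 0), (2, 0), (0, 0), (0, 0))
def gj : Ico := ((0, 0), (0, 0), (2, 0), (0, 0))
def gw : Ico := ((-1, 0), (1, 0), (1, 0), (1, 0))
def gg : Ico := ((-1, 1), (0, 1), (1, 0), (0, 0))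
-- The elements `i`, `j` generate the quaternion group, `gw` of order three extends it to the binary
-- tetrahedral group, and the powers of `gg`, of order five, represent the cosets: `4 * 2 * 3 * 5 =
-- 120`. With these words, closure under multiplication needs checking for four generators only.
def word (a b c k : ℕ) : Ico := (act gi)^[a] ((act gj)^[b] ((act gw)^[c] ((act gg)^[k] one)))
def words : List Ico := (List.range 4).flatMap fun a => (List.range 2).flatMap fun b =>
  (List.range 3).flatMap fun c => (List.range 5).map fun k => word a b c k

def conj (x : Ico) : Ico := (x.1, -x.2.1, -x.2.2.1, -x.2.2.2)

/-- The elements of the model with real part `φ / 2`; the last six are the conjugates of the first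
six. -/
def nbrs : List Ico :=
  [((0, 1), (-1, 0), (-1, 1), (0, 0)),
   ((0, 1), (-1, 0), (1, -1), (0, 0)),
   ((0, 1), (-1, 1), (0, 0), (-1, 0)),
   ((0, 1), (-1, 1), (0, 0), (1, 0)),
   ((0, 1), (0, 0), (-1, 0), (-1, 1)),
   ((0, 1), (0, 0), (-1, 0), (1, -1)),
   ((0, 1), (1, 0), (1, -1), (0, 0)),
   ((0, 1), (1, 0), (-1, 1), (0, 0)),
   ((0, 1), (1, -1), (0, 0), (1, 0)),
   ((0, 1), (1, -1), (0, 0), (-1, 0)),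
   ((0, 1), (0, 0), (1, 0), (1, -1)),
   ((0, 1), (0, 0), (1, 0), (-1, 1))]

def nbr (i : Fin 12) : Ico := nbrs.get i

/-- The indices of the quotients of the elements with real part `φ / 2` that have real part `φ / 2`
themselves, with `12` in all other places. -/
def quotTable : List (List ℕ) :=
  [[12, 5, 12, 12, 12, 12, 12, 12, 4, 2, 7, 3],
   [11, 12, 12, 12, 6, 2, 12, 12, 3, 10, 12, 12],
   [12, 12, 12, 12, 12, 4, 3, 11, 12, 1, 0, 12],
   [12, 12, 12, 12, 1, 12, 5, 2, 0, 12, 12, 10],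
   [12, 0, 12, 7, 12, 9, 2, 12, 11, 12, 12, 12],
   [12, 8, 10, 12, 3, 12, 7, 12, 12, 0, 12, 12],
   [12, 12, 9, 11, 8, 1, 12, 10, 12, 12, 12, 12],
   [12, 12, 5, 8, 12, 12, 4, 12, 12, 12, 9, 0],
   [10, 9, 12, 6, 5, 12, 12, 12, 12, 12, 12, 7],
   [8, 4, 7, 12, 12, 6, 12, 12, 12, 12, 11, 12],
   [1, 12, 6, 12, 12, 12, 12, 3, 12, 5, 12, 8],
   [9, 12, 12, 4, 12, 12, 12, 6, 1, 12, 2, 12]]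

/-- The index of the quotient of two elements with real part `φ / 2`, if it has real part `φ / 2`
itself. -/
def quot (i j : Fin 12) : Option (Fin 12) :=
  let n := (quotTable.getD i []).getD j 12
  if h : n < 12 then some ⟨n, h⟩ else none

/-! ### Finite facts about the integer model -/

set_option maxRecDepth 100000

theorem words_subset_families : ∀ m ∈ words, m ∈ families := by decide +kernel

theorem families_subset_words : ∀ m ∈ families, m ∈ words := by decide +kernel

theorem act_mem_families : ∀ x ∈ [gi, gj, gw, gg], ∀ m ∈ families,
    act x m ∈ families ∧ dmul x m = act x m + act x m := by decide +kernel

theorem mem_evenPerms : ∀ σ : Equiv.Perm (Fin 4), σ.sign = 1 → (⇑σ) ∈ evenPerms := by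
  decide +kernel

theorem exists_of_mem_evenPerms :
    ∀ f ∈ evenPerms, ∃ σ : Equiv.Perm (Fin 4), σ.sign = 1 ∧ ⇑σ = f := by decide +kernel

theorem conj_mem_families : ∀ m ∈ families, conj m ∈ families := by decide +kernel

/-- The real parts are the possible inner products of vertices. The largest one apart from that of
the identity is `φ / 2`, which makes `nbrs` the nearest neighbours of `1`. -/
theorem re_of_mem_families : ∀ m ∈ families, m = one ∨ m.1 ∈
    [((0, 1) : ℤ × ℤ), (1, 0), (-1, 1), (0, 0), (1, -1), (-1, 0), (0, -1), (-2, 0)] := by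
  decide +kernel

theorem exists_nbr_of_mem_families : ∀ m ∈ families, m.1 = (0, 1) → ∃ i, nbr i = m := by
  decide +kernel

theorem nbr_mem_families : ∀ i, nbr i ∈ families := by decide +kernel

theorem nbr_injective : ∀ i j, nbr i = nbr j → i = j := by decide +kernel

theorem nbr_fst : ∀ i, (nbr i).1 = (0, 1) := by decide +kernel

theorem nbr_add_six : ∀ i, nbr (i + 6) = conj (nbr i) := by decide +kernel

theorem dmul_conj_nbr : ∀ i j, dmul (conj (nbr i)) (nbr j) =
    act (conj (nbr i)) (nbr j) + act (conj (nbr i)) (nbr j) := by decide +kernel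

theorem re_of_quot_eq_none : ∀ i j, quot i j = none → (act (conj (nbr i)) (nbr j)).1 ≠ (0, 1) := by
  decide +kernel

theorem nbr_of_quot_eq_some : ∀ i j k, quot i j = some k →
    nbr k = act (conj (nbr i)) (nbr j) := by decide +kernel

end Ico

/-! ### From the integer model to real quaternions -/

namespace Ico

open Real (goldenRatio)
open scoped goldenRatio Quaternion

def toReal (p : ℤ × ℤ) : ℝ := p.1 + p.2 * φ

theorem toReal_add (p q : ℤ × ℤ) : toReal (p + q) = toReal p + toReal q := by
  simp [toReal]; ring

theorem toReal_sub (p q : ℤ × ℤ) : toReal (p - q) = toReal p - toReal q := by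
  simp [toReal]; ring

theorem toReal_neg (p : ℤ × ℤ) : toReal (-p) = -toReal p := by
  simp [toReal]; ring

theorem toReal_zmul (p q : ℤ × ℤ) : toReal (zmul p q) = toReal p * toReal q := by
  simp only [toReal, zmul]
  push_cast
  linear_combination (-(p.2 * q.2 : ℝ)) * Real.goldenRatio_sq

/-- Irrationality of `φ`. Hence equalities and inequalities `≠` between real coordinates can be
decided on pairs of integers. -/
theorem toReal_injective : Function.Injective toReal := by
  intro p q h
  have hirr := Real.goldenRatio_irrational
  unfold toReal at h
  have h2 : p.2 = q.2 := by
    by_contra hne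
    have hne' : ((p.2 - q.2 : ℤ) : ℝ) ≠ 0 := by exact_mod_cast sub_ne_zero.2 hne
    apply hirr
    refine ⟨(q.1 - p.1 : ℤ) / (p.2 - q.2 : ℤ), ?_⟩
    push_cast at hne' ⊢
    rw [div_eq_iff hne']
    linarith
  have h1 : p.1 = q.1 := by
    rw [h2] at h
    exact_mod_cast add_right_cancel h
  exact Prod.ext h1 h2

/-- The quaternion represented by an element of the model. -/
def toH (x : Ico) : ℍ[ℝ] :=
  ⟨toReal x.1 / 2, toReal x.2.1 / 2, toReal x.2.2.1 / 2, toReal x.2.2.2 / 2⟩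

theorem half_injective {a b : ℝ} (h : a / 2 = b / 2) : a = b := by linarith

theorem re_toH (x : Ico) : (toH x).re = toReal x.1 / 2 := rfl

theorem imI_toH (x : Ico) : (toH x).imI = toReal x.2.1 / 2 := rfl

theorem imJ_toH (x : Ico) : (toH x).imJ = toReal x.2.2.1 / 2 := rfl

theorem imK_toH (x : Ico) : (toH x).imK = toReal x.2.2.2 / 2 := rfl

theorem toH_injective : Function.Injective toH := by
  rintro ⟨a, b, c, d⟩ ⟨a', b', c', d'⟩ h
  have h1 := congrArg QuaternionAlgebra.re h
  have h2 := congrArg QuaternionAlgebra.imI h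
  have h3 := congrArg QuaternionAlgebra.imJ h
  have h4 := congrArg QuaternionAlgebra.imK h
  simp only [toH] at h1 h2 h3 h4
  rw [toReal_injective (half_injective h1),
    toReal_injective (half_injective h2),
    toReal_injective (half_injective h3),
    toReal_injective (half_injective h4)]

/-- The coordinates carry a denominator two, so a product of two elements carries four; the
hypothesis is the product identity with denominators cleared. -/
theorem toH_mul {x y z : Ico} (h : dmul x y = z + z) : toH z = toH x * toH y := by
  have h1 := congrArg (fun m : Ico => toReal m.1) h
  have h2 := congrArg (fun m : Ico => toReal m.2.1) h
  have h3 := congrArg (fun m : Ico => toReal m.2.2.1) h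
  have h4 := congrArg (fun m : Ico => toReal m.2.2.2) h
  simp only [dmul, Prod.fst_add, Prod.snd_add, toReal_add, toReal_sub, toReal_zmul] at h1 h2 h3 h4
  ext <;> simp only [re_toH, imI_toH, imJ_toH, imK_toH, Quaternion.re_mul, Quaternion.imI_mul,
    Quaternion.imJ_mul, Quaternion.imK_mul] <;> linarith

theorem toH_conj (x : Ico) : toH (conj x) = star (toH x) := by
  ext <;> simp [re_toH, imI_toH, imJ_toH, imK_toH, conj, toReal_neg, neg_div]

theorem toH_one : toH one = 1 := by
  ext <;> simp [re_toH, imI_toH, imJ_toH, imK_toH, one, toReal]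

theorem mem_signs {a : ℤ} : a ∈ signs ↔ ∃ s : ℤˣ, (s : ℤ) = a := by
  simp only [signs, List.mem_cons, List.not_mem_nil, or_false]
  constructor
  · rintro (rfl | rfl)
    · exact ⟨1, rfl⟩
    · exact ⟨-1, rfl⟩
  · rintro ⟨s, rfl⟩
    rcases Int.units_eq_one_or s with rfl | rfl <;> simp

theorem toH_model₁ (i : Fin 4) (s : ℤˣ) : toH (model₁ i s) =
    ⟨(Pi.single i ((s : ℤ) : ℝ) : Fin 4 → ℝ) 0, (Pi.single i ((s : ℤ) : ℝ) : Fin 4 → ℝ) 1,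
      (Pi.single i ((s : ℤ) : ℝ) : Fin 4 → ℝ) 2, (Pi.single i ((s : ℤ) : ℝ) : Fin 4 → ℝ) 3⟩ := by
  have : ∀ j, toReal (if j = i then (2 * (s : ℤ), 0) else (0, 0)) / 2 =
      (Pi.single i ((s : ℤ) : ℝ) : Fin 4 → ℝ) j := by
    intro j
    rw [Pi.single_apply]
    split_ifs <;> simp [toReal]
  simp only [toH, model₁, ofFun, this]
  rfl

theorem toH_model₂ (a b c d : ℤ) : toH (model₂ a b c d) = ⟨a / 2, b / 2, c / 2, d / 2⟩ := by
  simp [toH, model₂, toReal]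
  rfl

theorem toH_model₃ (f : Fin 4 → Fin 4) (a b c : ℤ) : toH (model₃ f a b c) =
    ⟨(![(a : ℝ) * φ / 2, (b : ℝ) / 2, (c : ℝ) * φ⁻¹ / 2, 0] : Fin 4 → ℝ) (f 0),
      (![(a : ℝ) * φ / 2, (b : ℝ) / 2, (c : ℝ) * φ⁻¹ / 2, 0] : Fin 4 → ℝ) (f 1),
      (![(a : ℝ) * φ / 2, (b : ℝ) / 2, (c : ℝ) * φ⁻¹ / 2, 0] : Fin 4 → ℝ) (f 2),
      (![(a : ℝ) * φ / 2, (b : ℝ) / 2, (c : ℝ) * φ⁻¹ / 2, 0] : Fin 4 → ℝ) (f 3)⟩ := by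
  have hφ : φ⁻¹ = φ - 1 := by
    rw [Real.inv_goldenRatio]; linarith [Real.goldenRatio_add_goldenConj]
  have : ∀ j, toReal ((![(0, a), (b, 0), (-c, c), (0, 0)] : Fin 4 → ℤ × ℤ) j) / 2 =
      (![(a : ℝ) * φ / 2, (b : ℝ) / 2, (c : ℝ) * φ⁻¹ / 2, 0] : Fin 4 → ℝ) j := by
    intro j
    fin_cases j <;> simp [toReal, hφ]
    ring
  simp only [toH, model₃, ofFun, this]
  rfl

theorem mem_icosians {x : ℍ[ℝ]} : x ∈ icosians ↔ ∃ m ∈ families, toH m = x := by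
  unfold icosians
  rw [Finset.mem_union, Finset.mem_union]
  refine (or_congr (or_congr Finset.mem_image Finset.mem_image) Finset.mem_image).trans ?_
  simp only [families, Finset.mem_univ, true_and, List.mem_append, List.mem_flatMap, List.mem_map,
    List.mem_finRange, mem_signs]
  constructor
  · rintro ((⟨⟨i, s⟩, rfl⟩ | ⟨s, rfl⟩) | ⟨⟨⟨σ, hσ⟩, s⟩, rfl⟩)
    · exact ⟨_, .inl (.inl ⟨i, s, ⟨s, rfl⟩, rfl⟩), toH_model₁ i s⟩
    · exact ⟨_, .inl (.inr ⟨_, ⟨s 0, rfl⟩, _, ⟨s 1, rfl⟩, _, ⟨s 2, rfl⟩, _, ⟨s 3, rfl⟩, rfl⟩),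
        toH_model₂ _ _ _ _⟩
    · exact ⟨_, .inr ⟨_, mem_evenPerms σ (by simpa using hσ), _, ⟨s 0, rfl⟩, _, ⟨s 1, rfl⟩,
        _, ⟨s 2, rfl⟩, rfl⟩, toH_model₃ _ _ _ _⟩
  · rintro ⟨_, (⟨i, _, ⟨s, rfl⟩, rfl⟩ | ⟨_, ⟨s₀, rfl⟩, _, ⟨s₁, rfl⟩, _, ⟨s₂, rfl⟩, _, ⟨s₃, rfl⟩, rfl⟩) |
      ⟨f, hf, _, ⟨s₀, rfl⟩, _, ⟨s₁, rfl⟩, _, ⟨s₂, rfl⟩, rfl⟩, rfl⟩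
    · exact .inl (.inl ⟨(i, s), (toH_model₁ i s).symm⟩)
    · exact .inl (.inr ⟨![s₀, s₁, s₂, s₃], (toH_model₂ _ _ _ _).symm⟩)
    · obtain ⟨σ, hσ, rfl⟩ := exists_of_mem_evenPerms f hf
      exact .inr ⟨(⟨σ, by simpa using hσ⟩, ![s₀, s₁, s₂]), (toH_model₃ _ _ _ _).symm⟩

/-- The elements whose left multiplication preserves the icosians contain `1` and are stable under
the four generators by associativity; by `families_subset_words` they are all of the model. -/
theorem toH_mul_mem : ∀ m ∈ families, ∀ y ∈ icosians, toH m * y ∈ icosians := by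
  have hgen : ∀ x ∈ [gi, gj, gw, gg], ∀ m ∈ families, (∀ y ∈ icosians, toH m * y ∈ icosians) →
      act x m ∈ families ∧ ∀ y ∈ icosians, toH (act x m) * y ∈ icosians := by
    intro x hx m hm h
    obtain ⟨h1, h2⟩ := act_mem_families x hx m hm
    refine ⟨h1, fun y hy => ?_⟩
    rw [toH_mul h2, mul_assoc]
    obtain ⟨m', hm', h'⟩ := mem_icosians.1 (h y hy)
    rw [← h', ← toH_mul (act_mem_families x hx m' hm').2]
    exact mem_icosians.2 ⟨_, (act_mem_families x hx m' hm').1, rfl⟩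
  have hiter : ∀ x ∈ [gi, gj, gw, gg], ∀ (n : ℕ) (m : Ico),
      (m ∈ families ∧ ∀ y ∈ icosians, toH m * y ∈ icosians) →
      ((act x)^[n] m ∈ families ∧ ∀ y ∈ icosians, toH ((act x)^[n] m) * y ∈ icosians) := by
    intro x hx n m hm
    induction n with
    | zero => exact hm
    | succ n ih => rw [Function.iterate_succ_apply']; exact hgen x hx _ ih.1 ih.2
  have hone : one ∈ families ∧ ∀ y ∈ icosians, toH one * y ∈ icosians :=
    ⟨words_subset_families _ (by decide), fun y hy => by rwa [toH_one, one_mul]⟩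
  intro m hm
  have hw := families_subset_words m hm
  simp only [words, List.mem_flatMap, List.mem_map] at hw
  obtain ⟨a, -, b, -, c, -, k, -, rfl⟩ := hw
  exact (hiter gi (by simp) a _ (hiter gj (by simp) b _ (hiter gw (by simp) c _
    (hiter gg (by simp) k _ hone)))).2

end Ico

/-! ### The binary icosahedral group and adjacency of vertices -/

namespace Icosian

open Ico
open Real (goldenRatio)
open scoped goldenRatio Quaternion

theorem mul_mem {x y : ℍ[ℝ]} (hx : x ∈ icosians) (hy : y ∈ icosians) : x * y ∈ icosians := by
  obtain ⟨m, hm, rfl⟩ := mem_icosians.1 hx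
  exact toH_mul_mem m hm y hy

theorem star_mem {x : ℍ[ℝ]} (hx : x ∈ icosians) : star x ∈ icosians := by
  obtain ⟨m, hm, rfl⟩ := mem_icosians.1 hx
  exact mem_icosians.2 ⟨_, conj_mem_families m hm, toH_conj m⟩

theorem one_mem : (1 : ℍ[ℝ]) ∈ icosians :=
  mem_icosians.2 ⟨one, words_subset_families _ (by decide), toH_one⟩

theorem re_le {x : ℍ[ℝ]} (hx : x ∈ icosians) (h1 : x ≠ 1) : x.re ≤ φ / 2 := by
  obtain ⟨m, hm, rfl⟩ := mem_icosians.1 hx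
  have hφ := Real.one_lt_goldenRatio
  rcases re_of_mem_families m hm with rfl | h
  · exact absurd toH_one h1
  · change toReal m.1 / 2 ≤ _
    simp only [List.mem_cons, List.not_mem_nil, or_false] at h
    rcases h with h | h | h | h | h | h | h | h <;> rw [h] <;> simp [toReal] <;> linarith

theorem norm_eq_one {x : ℍ[ℝ]} (hx : x ∈ icosians) : ‖x‖ = 1 := by
  have : ∀ m ∈ families, dmul (conj m) m = one + one := by decide +kernel
  obtain ⟨m, hm, rfl⟩ := mem_icosians.1 hx
  have h := toH_mul (this m hm)
  rw [toH_one, toH_conj] at h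
  have h2 := congrArg norm h
  rw [norm_mul, norm_star, norm_one] at h2
  nlinarith [norm_nonneg (toH m)]

theorem star_mul_self {x : ℍ[ℝ]} (hx : x ∈ icosians) : star x * x = 1 := by
  rw [Quaternion.star_mul_self, Quaternion.normSq_eq_norm_mul_self, norm_eq_one hx]; simp

/-- The binary icosahedral group. -/
instance : Group icosians where
  mul x y := ⟨x * y, mul_mem x.2 y.2⟩
  one := ⟨1, one_mem⟩
  inv x := ⟨star x.1, star_mem x.2⟩
  mul_assoc _ _ _ := Subtype.ext (mul_assoc _ _ _)
  one_mul _ := Subtype.ext (one_mul _)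
  mul_one _ := Subtype.ext (mul_one _)
  inv_mul_cancel x := Subtype.ext (star_mul_self x.2)

theorem coe_mul (x y : icosians) : ((x * y : icosians) : ℍ[ℝ]) = x * y := rfl

theorem coe_inv (x : icosians) : ((x⁻¹ : icosians) : ℍ[ℝ]) = star (x : ℍ[ℝ]) := rfl

/-- The inner product is `Re (x̄ y)` and `x̄ = x⁻¹` for unit quaternions. Adjacency therefore
depends only on `x⁻¹ * y`, which is what makes it left invariant and reducible to the vertex `1`. -/
theorem inner_eq (x y : icosians) : inner ℝ (x : ℍ[ℝ]) y = ((x⁻¹ * y : icosians) : ℍ[ℝ]).re := by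
  rw [Quaternion.inner_def, coe_mul, coe_inv]
  simp

theorem inner_mul_left (g x y : icosians) :
    inner ℝ ((g * x : icosians) : ℍ[ℝ]) (g * y : icosians) = inner ℝ (x : ℍ[ℝ]) y := by
  rw [inner_eq, inner_eq, mul_inv_rev, mul_assoc, inv_mul_cancel_left]

theorem inner_self (x : icosians) : inner ℝ (x : ℍ[ℝ]) x = 1 := by
  rw [real_inner_self_eq_norm_sq, norm_eq_one x.2]; norm_num

theorem inner_le {x y : icosians} (h : x ≠ y) : inner ℝ (x : ℍ[ℝ]) y ≤ φ / 2 := by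
  rw [inner_eq]
  refine re_le (x⁻¹ * y : icosians).2 fun h1 => h ?_
  have : x⁻¹ * y = 1 := Subtype.ext h1
  exact (inv_mul_eq_one.1 this)

/-- Use `‖x - y‖² = 2 - 2 ⟨x, y⟩` for unit vectors and `(φ - 1)² = 2 - φ`. -/
theorem dist_eq_iff (x y : icosians) :
    dist (x : ℍ[ℝ]) (y : ℍ[ℝ]) = φ⁻¹ ↔ inner ℝ (x : ℍ[ℝ]) y = φ / 2 := by
  have hφ : φ⁻¹ = φ - 1 := by
    rw [Real.inv_goldenRatio]; linarith [Real.goldenRatio_add_goldenConj]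
  have h1 := norm_sub_sq_real (x : ℍ[ℝ]) y
  rw [norm_eq_one x.2, norm_eq_one y.2] at h1
  rw [dist_eq_norm, hφ, ← sq_eq_sq₀ (norm_nonneg _) (by linarith [Real.one_lt_goldenRatio]), h1]
  have := Real.goldenRatio_sq
  constructor <;> intro h <;> nlinarith

/-- The vertices adjacent to `1`. -/
def nbr (i : Fin 12) : icosians := ⟨toH (Ico.nbr i), mem_icosians.2 ⟨_, nbr_mem_families i, rfl⟩⟩

theorem nbr_inj {i j : Fin 12} : nbr i = nbr j ↔ i = j :=
  ⟨fun h => nbr_injective _ _ (toH_injective (congrArg Subtype.val h)), fun h => h ▸ rfl⟩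

theorem re_eq_iff (m : Ico) : (toH m).re = φ / 2 ↔ m.1 = (0, 1) := by
  have : φ = toReal (0, 1) := by simp [toReal]
  change toReal m.1 / 2 = _ ↔ _
  rw [this]
  exact ⟨fun h => toReal_injective (half_injective h), fun h => by rw [h]⟩

theorem re_eq_iff_exists_nbr (x : icosians) : (x : ℍ[ℝ]).re = φ / 2 ↔ ∃ i, nbr i = x := by
  constructor
  · intro h
    obtain ⟨m, hm, hx⟩ := mem_icosians.1 x.2
    rw [← hx, re_eq_iff] at h
    obtain ⟨i, rfl⟩ := exists_nbr_of_mem_families m hm h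
    exact ⟨i, Subtype.ext hx⟩
  · rintro ⟨i, rfl⟩
    exact (re_eq_iff _).2 (nbr_fst i)

theorem inner_eq_iff (x y : icosians) :
    inner ℝ (x : ℍ[ℝ]) y = φ / 2 ↔ ∃ i, nbr i = x⁻¹ * y := by
  rw [inner_eq, re_eq_iff_exists_nbr]

theorem nbr_add_six (i : Fin 12) : nbr (i + 6) = (nbr i)⁻¹ :=
  Subtype.ext ((congrArg toH (Ico.nbr_add_six i)).trans (toH_conj _))

theorem coe_inv_mul_nbr (i j : Fin 12) : (((nbr i)⁻¹ * nbr j : icosians) : ℍ[ℝ]) =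
    toH (act (Ico.conj (Ico.nbr i)) (Ico.nbr j)) := by
  rw [toH_mul (dmul_conj_nbr i j), toH_conj]; rfl

theorem inv_mul_nbr {i j k : Fin 12} (h : quot i j = some k) : (nbr i)⁻¹ * nbr j = nbr k := by
  apply Subtype.ext
  rw [coe_inv_mul_nbr, ← nbr_of_quot_eq_some _ _ _ h]; rfl

theorem inner_nbr_eq_iff (i j : Fin 12) :
    inner ℝ (nbr i : ℍ[ℝ]) (nbr j) = φ / 2 ↔ ∃ k, quot i j = some k := by
  constructor
  · intro h
    rw [inner_eq, coe_inv_mul_nbr, re_eq_iff] at h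
    rcases hq : quot i j with _ | k
    · exact absurd h (re_of_quot_eq_none i j hq)
    · exact ⟨k, rfl⟩
  · rintro ⟨k, hk⟩
    rw [inner_eq_iff]
    exact ⟨k, (inv_mul_nbr hk).symm⟩

end Icosian

end

end PiecewiseFlat

namespace PiecewiseFlat

noncomputable section

open Real (goldenRatio)
open scoped goldenRatio Quaternion

namespace Icosian

/-! ### The tetrahedra of the 600-cell -/

theorem mem_tets {t : Finset icosians} : t ∈ cell600.tets ↔ t.card = 4 ∧ ∀ x ∈ t, ∀ y ∈ t, x ≠ y →
    inner ℝ (x : ℍ[ℝ]) y = φ / 2 := by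
  refine Finset.mem_filter.trans ?_
  simp only [Finset.mem_univ, true_and, dist_eq_iff]

/-- Translated to `1`, a face is a pair of adjacent neighbours `i`, `j` and its apex a common
neighbour `k`; the table provides a second common neighbour. -/
theorem exists_flip_index : ∀ i j k : Fin 12, (Ico.quot i j).isSome → (Ico.quot i k).isSome →
    (Ico.quot j k).isSome → ∃ l, l ≠ k ∧ (Ico.quot i l).isSome ∧ (Ico.quot j l).isSome := by
  decide +kernel

theorem inner_nbr_eq_iff_isSome (i j : Fin 12) :
    inner ℝ (nbr i : ℍ[ℝ]) (nbr j) = φ / 2 ↔ (Ico.quot i j).isSome := by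
  rw [inner_nbr_eq_iff, Option.isSome_iff_exists]

/-- Every face of a tetrahedron is a face of another one. -/
theorem exists_flip {a b c w : icosians} (hab : inner ℝ (a : ℍ[ℝ]) b = φ / 2)
    (hac : inner ℝ (a : ℍ[ℝ]) c = φ / 2) (haw : inner ℝ (a : ℍ[ℝ]) w = φ / 2)
    (hbc : inner ℝ (b : ℍ[ℝ]) c = φ / 2) (hbw : inner ℝ (b : ℍ[ℝ]) w = φ / 2)
    (hcw : inner ℝ (c : ℍ[ℝ]) w = φ / 2) :
    ∃ w' : icosians, w' ≠ w ∧ inner ℝ (a : ℍ[ℝ]) w' = φ / 2 ∧ inner ℝ (b : ℍ[ℝ]) w' = φ / 2 ∧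
      inner ℝ (c : ℍ[ℝ]) w' = φ / 2 := by
  obtain ⟨i, hi⟩ := (inner_eq_iff _ _).1 hab
  obtain ⟨j, hj⟩ := (inner_eq_iff _ _).1 hac
  obtain ⟨k, hk⟩ := (inner_eq_iff _ _).1 haw
  obtain rfl : b = a * nbr i := by rw [hi, mul_inv_cancel_left]
  obtain rfl : c = a * nbr j := by rw [hj, mul_inv_cancel_left]
  obtain rfl : w = a * nbr k := by rw [hk, mul_inv_cancel_left]
  rw [inner_mul_left, inner_nbr_eq_iff_isSome] at hbc hbw hcw
  obtain ⟨l, hl, h1, h2⟩ := exists_flip_index i j k hbc hbw hcw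
  refine ⟨a * nbr l, fun h => hl (nbr_inj.1 (mul_left_cancel h)), ?_, ?_, ?_⟩
  · rw [inner_eq_iff]; exact ⟨l, by rw [inv_mul_cancel_left]⟩
  · rwa [inner_mul_left, inner_nbr_eq_iff_isSome]
  · rwa [inner_mul_left, inner_nbr_eq_iff_isSome]

theorem inner_of_ne {t : Finset icosians} (ht : t ∈ cell600.tets) {x y : icosians} (hx : x ∈ t)
    (hy : y ∈ t) (h : x ≠ y) : inner ℝ (x : ℍ[ℝ]) y = φ / 2 := (mem_tets.1 ht).2 x hx y hy h

theorem quad_mem_tets {a b c w : icosians} (hab : inner ℝ (a : ℍ[ℝ]) b = φ / 2)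
    (hac : inner ℝ (a : ℍ[ℝ]) c = φ / 2) (haw : inner ℝ (a : ℍ[ℝ]) w = φ / 2)
    (hbc : inner ℝ (b : ℍ[ℝ]) c = φ / 2) (hbw : inner ℝ (b : ℍ[ℝ]) w = φ / 2)
    (hcw : inner ℝ (c : ℍ[ℝ]) w = φ / 2) : Triangulation.quad a b c w ∈ cell600.tets := by
  have hφ : φ / 2 ≠ 1 := by
    have := Real.goldenRatio_lt_two; intro h; linarith
  have hne : ∀ {x y : icosians}, inner ℝ (x : ℍ[ℝ]) y = φ / 2 → x ≠ y := by
    rintro x y h rfl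
    exact hφ (h.symm.trans (inner_self x))
  have hcomm : ∀ {x y : icosians}, inner ℝ (x : ℍ[ℝ]) y = φ / 2 → inner ℝ (y : ℍ[ℝ]) x = φ / 2 :=
    fun h => (real_inner_comm _ _).trans h
  refine mem_tets.2 ⟨?_, ?_⟩
  · exact Triangulation.card_quad (hne hab) (hne hac) (hne haw) (hne hbc) (hne hbw) (hne hcw)
  · intro x hx y hy hxy
    rw [Triangulation.mem_quad] at hx hy
    rcases hx with rfl | rfl | rfl | rfl <;> rcases hy with rfl | rfl | rfl | rfl <;>
      first
      | exact absurd rfl hxy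
      | assumption
      | exact hcomm (by assumption)

theorem exists_flip_of_mem {t : Finset icosians} (ht : t ∈ cell600.tets) {w : icosians}
    (hw : w ∈ t) : ∃ w', w' ∉ t ∧ insert w' (t.erase w) ∈ cell600.tets := by
  have hc : (t.erase w).card = 3 := by rw [Finset.card_erase_of_mem hw, cell600.card_tets t ht]
  obtain ⟨a, b, c, hab, hac, hbc, h⟩ := Finset.card_eq_three.1 hc
  have hmem : ∀ x ∈ ({a, b, c} : Finset icosians), x ∈ t ∧ x ≠ w := by
    intro x hx
    rw [← h, Finset.mem_erase] at hx
    exact ⟨hx.2, hx.1⟩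
  obtain ⟨ha, haw⟩ := hmem a (by simp)
  obtain ⟨hb, hbw⟩ := hmem b (by simp)
  obtain ⟨hc, hcw⟩ := hmem c (by simp)
  obtain ⟨w', h0, h1, h2, h3⟩ := exists_flip (inner_of_ne ht ha hb hab) (inner_of_ne ht ha hc hac)
    (inner_of_ne ht ha hw haw) (inner_of_ne ht hb hc hbc) (inner_of_ne ht hb hw hbw)
    (inner_of_ne ht hc hw hcw)
  have hφ : φ / 2 ≠ 1 := by
    have := Real.goldenRatio_lt_two; intro h; linarith
  have hne : ∀ {x : icosians}, inner ℝ (x : ℍ[ℝ]) w' = φ / 2 → w' ≠ x := by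
    rintro x h rfl
    exact hφ (h.symm.trans (inner_self _))
  refine ⟨w', ?_, ?_⟩
  · rw [← Finset.insert_erase hw, h]
    simp [h0, hne h1, hne h2, hne h3]
  · have : insert w' (t.erase w) = Triangulation.quad a b c w' := by
      rw [h]; ext x
      simp only [Finset.mem_insert, Finset.mem_singleton, Triangulation.mem_quad]
      tauto
    rw [this]
    exact quad_mem_tets (inner_of_ne ht ha hb hab) (inner_of_ne ht ha hc hac) h1
      (inner_of_ne ht hb hc hbc) h2 h3

theorem tets_nonempty : cell600.tets.Nonempty := by
  have h1 : ∀ i, inner ℝ ((1 : icosians) : ℍ[ℝ]) (nbr i) = φ / 2 := fun i =>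
    (inner_eq_iff _ _).2 ⟨i, by rw [inv_one, one_mul]⟩
  exact ⟨_, quad_mem_tets (h1 0) (h1 1) (h1 8) ((inner_nbr_eq_iff_isSome _ _).2 (by decide))
    ((inner_nbr_eq_iff_isSome _ _).2 (by decide)) ((inner_nbr_eq_iff_isSome _ _).2 (by decide))⟩

/-! ### The radial projection -/

/-- The sum of the inner products with the vertices of a tetrahedron. -/
def height (t : Finset icosians) (y : ℍ[ℝ]) : ℝ := ∑ w ∈ t, inner ℝ (w : ℍ[ℝ]) y

theorem height_of_mem {t : Finset icosians} (ht : t ∈ cell600.tets) {v : icosians} (hv : v ∈ t) :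
    height t v = 1 + 3 * (φ / 2) := by
  unfold height
  rw [← Finset.add_sum_erase _ _ hv, inner_self, Finset.sum_congr rfl
    fun w hw => inner_of_ne ht (Finset.mem_of_mem_erase hw) hv (Finset.ne_of_mem_erase hw),
    Finset.sum_const, Finset.card_erase_of_mem hv, cell600.card_tets t ht]
  simp

/-- Each of the four inner products is at most `φ / 2`, and `4 (φ / 2) < 1 + 3 (φ / 2)` because `φ <
2`. Together with `height_of_mem` this makes `height t` a supporting functional of the convex hull
that touches it exactly along `t`. -/
theorem height_lt {t : Finset icosians} (ht : t ∈ cell600.tets) {v : icosians} (hv : v ∉ t) :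
    height t v < 1 + 3 * (φ / 2) := by
  have : height t v ≤ ∑ w ∈ t, φ / 2 :=
    Finset.sum_le_sum fun w hw => inner_le fun h => hv (h ▸ hw)
  rw [Finset.sum_const, cell600.card_tets t ht, nsmul_eq_mul] at this
  have := Real.goldenRatio_lt_two
  push_cast at *
  linarith

theorem height_sum (t s : Finset icosians) (c : icosians → ℝ) :
    height t (∑ v ∈ s, c v • (v : ℍ[ℝ])) = ∑ v ∈ s, c v * height t v := by
  unfold height
  simp only [inner_sum, real_inner_smul_right, Finset.mul_sum]
  rw [Finset.sum_comm]

/-- The Gram matrix has ones on the diagonal and `φ / 2` elsewhere. Applying `height t` to the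
relation gives `∑ c = 0`, and pairing with `w` then leaves `(1 - φ / 2) * c w = 0`. -/
theorem linearIndependent_tet {t : Finset icosians} (ht : t ∈ cell600.tets) {c : icosians → ℝ}
    (h : ∑ v ∈ t, c v • (v : ℍ[ℝ]) = 0) : ∀ v ∈ t, c v = 0 := by
  have hφ := Real.goldenRatio_lt_two
  have hφ' := Real.goldenRatio_pos
  have hsum : ∑ v ∈ t, c v = 0 := by
    have := height_sum t t c
    rw [h, Finset.sum_congr rfl fun v hv => by rw [height_of_mem ht hv], ← Finset.sum_mul] at this
    have h0 : height t 0 = 0 := by simp [height]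
    rw [h0] at this
    rcases mul_eq_zero.1 this.symm with h | h
    · exact h
    · linarith
  intro w hw
  have h1 := congrArg (inner ℝ (w : ℍ[ℝ])) h
  rw [inner_sum, inner_zero_right, ← Finset.add_sum_erase _ _ hw, real_inner_smul_right, inner_self,
    Finset.sum_congr rfl fun v hv => by
      rw [real_inner_smul_right, inner_of_ne ht hw (Finset.mem_of_mem_erase hv)
        (Finset.ne_of_mem_erase hv).symm], ← Finset.sum_mul] at h1
  rw [← Finset.add_sum_erase _ _ hw] at hsum
  have h2 : ∑ v ∈ t.erase w, c v = - c w := by linarith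
  rw [h2] at h1
  have h3 : c w * (1 - φ / 2) = 0 := by linarith
  rcases mul_eq_zero.1 h3 with h | h
  · exact h
  · linarith

theorem exists_coeff {t : Finset icosians} (ht : t ∈ cell600.tets) (y : ℍ[ℝ]) :
    ∃ c : icosians → ℝ, ∑ v ∈ t, c v • (v : ℍ[ℝ]) = y := by
  have hli : LinearIndependent ℝ fun v : t => ((v : icosians) : ℍ[ℝ]) := by
    rw [Fintype.linearIndependent_iff]
    intro g hg v
    have := linearIndependent_tet ht (c := fun v => if h : v ∈ t then g ⟨v, h⟩ else 0) (by
      rw [← hg, ← Finset.sum_coe_sort t]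
      simp) v v.2
    simpa using this
  have hsp := hli.span_eq_top_of_card_eq_finrank' (by
    rw [Fintype.card_coe, cell600.card_tets t ht, Quaternion.finrank_eq_four])
  have hy : y ∈ Submodule.span ℝ (Set.range fun v : t => ((v : icosians) : ℍ[ℝ])) :=
    hsp ▸ Submodule.mem_top
  obtain ⟨g, hg⟩ := (Submodule.mem_span_range_iff_exists_fun ℝ).1 hy
  refine ⟨fun v => if h : v ∈ t then g ⟨v, h⟩ else 0, ?_⟩
  rw [← hg, ← Finset.sum_coe_sort t]
  simp

/-- Every quaternion is in the cone over a tetrahedron. -/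
theorem exists_nonneg_coeff (y : ℍ[ℝ]) : ∃ t ∈ cell600.tets, ∃ c : icosians → ℝ,
    (∀ v ∈ t, 0 ≤ c v) ∧ ∑ v ∈ t, c v • (v : ℍ[ℝ]) = y := by
  -- The cone containing `y` is found by maximizing the supporting functionals at `y`.
  obtain ⟨t, ht, hmax⟩ := Finset.exists_max_image cell600.tets (fun t => height t y) tets_nonempty
  obtain ⟨c, rfl⟩ := exists_coeff ht y
  refine ⟨t, ht, c, fun w hw => ?_, rfl⟩
  by_contra! hneg
  -- Flipping across the face opposite to `w` changes only the term of `w` in the height of `y`.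
  -- That vertex has a smaller height for the new tetrahedron, so a negative coefficient would
  -- increase the total, against maximality.
  obtain ⟨w', hw', ht'⟩ := exists_flip_of_mem ht hw
  have h1 := hmax _ ht'
  rw [height_sum, height_sum, ← Finset.add_sum_erase _ _ hw, ← Finset.add_sum_erase _ _ hw,
    height_of_mem ht hw, Finset.sum_congr rfl fun v hv => by
      rw [height_of_mem ht' (Finset.mem_insert_of_mem hv)]] at h1
  have h3 : ∑ v ∈ t.erase w, c v * height t v = ∑ v ∈ t.erase w, c v * (1 + 3 * (φ / 2)) :=
    Finset.sum_congr rfl fun v hv => by rw [height_of_mem ht (Finset.mem_of_mem_erase hv)]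
  rw [h3] at h1
  have h2 := height_lt ht' (v := w) (by
    simp only [Finset.mem_insert, Finset.mem_erase, not_or]
    exact ⟨fun h => hw' (h ▸ hw), by simp⟩)
  nlinarith

/-- The point of `ℝ⁴` with the given barycentric coordinates. -/
def bary (x : icosians → ℝ) : ℍ[ℝ] := ∑ v, x v • (v : ℍ[ℝ])

theorem bary_eq_sum {x : icosians → ℝ} {t : Finset icosians} (h : ∀ v, v ∉ t → x v = 0) :
    bary x = ∑ v ∈ t, x v • (v : ℍ[ℝ]) := by
  unfold bary
  rw [← Finset.sum_subset (Finset.subset_univ t)]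
  intro v _ hv
  rw [h v hv, zero_smul]

theorem height_bary (s : Finset icosians) (x : icosians → ℝ) :
    height s (bary x) = ∑ v, x v * height s v := height_sum _ _ _

/-- A convex combination of vertex heights is at most the maximal vertex height, with equality only
if all the weight lies on vertices where it is attained. -/
theorem height_bary_le {x : icosians → ℝ} (hx : x ∈ stdSimplex ℝ icosians) {t : Finset icosians}
    (ht : t ∈ cell600.tets) : height t (bary x) ≤ 1 + 3 * (φ / 2) ∧
      (height t (bary x) = 1 + 3 * (φ / 2) → ∀ v, v ∉ t → x v = 0) := by
  have hle : ∀ v ∈ Finset.univ, x v * height t v ≤ x v * (1 + 3 * (φ / 2)) := by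
    intro v _
    apply mul_le_mul_of_nonneg_left _ (hx.1 v)
    by_cases hv : v ∈ t
    · exact (height_of_mem ht hv).le
    · exact (height_lt ht hv).le
  have hs : ∑ v, x v * (1 + 3 * (φ / 2)) = 1 + 3 * (φ / 2) := by
    rw [← Finset.sum_mul, hx.2, one_mul]
  rw [height_bary]
  refine ⟨(Finset.sum_le_sum hle).trans_eq hs, fun h v hv => ?_⟩
  have := (Finset.sum_eq_sum_iff_of_le hle).1 (h.trans hs.symm) v (Finset.mem_univ v)
  by_contra h0
  exact (height_lt ht hv).ne (mul_left_cancel₀ h0 this)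

theorem height_bary_of_supported {x : icosians → ℝ} (hx : x ∈ stdSimplex ℝ icosians)
    {t : Finset icosians} (ht : t ∈ cell600.tets) (h : ∀ v, v ∉ t → x v = 0) :
    height t (bary x) = 1 + 3 * (φ / 2) := by
  rw [height_bary]
  have : ∀ v ∈ Finset.univ, x v * height t v = x v * (1 + 3 * (φ / 2)) := by
    intro v _
    by_cases hv : v ∈ t
    · rw [height_of_mem ht hv]
    · rw [h v hv, zero_mul, zero_mul]
  rw [Finset.sum_congr rfl this, ← Finset.sum_mul, hx.2, one_mul]

theorem height_smul (t : Finset icosians) (r : ℝ) (y : ℍ[ℝ]) : height t (r • y) = r * height t y := by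
  simp [height, real_inner_smul_right, Finset.mul_sum]

theorem bary_ne_zero {x : icosians → ℝ} (hx : x ∈ cell600.realization) : bary x ≠ 0 := by
  obtain ⟨hx, t, ht, h⟩ := hx
  intro h0
  have := height_bary_of_supported hx ht h
  have hφ := Real.goldenRatio_pos
  rw [h0] at this
  simp [height] at this
  linarith

/-- The supporting functional of the carrier of `x'` gives `r ≤ 1`, that of the carrier of `x` gives
`r ≥ 1`. Now equality in `height_bary_le` puts `x'` into the carrier of `x`, where linear
independence finishes. -/
theorem eq_of_bary_eq_smul {x x' : icosians → ℝ} (hx : x ∈ cell600.realization)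
    (hx' : x' ∈ cell600.realization) {r : ℝ} (hr0 : 0 < r)
    (h : bary x = r • bary x') : x = x' := by
  obtain ⟨hx, t, ht, hs⟩ := hx
  obtain ⟨hx', t', ht', hs'⟩ := hx'
  have hφ := Real.goldenRatio_pos
  have hpos : 0 < 1 + 3 * (φ / 2) := by linarith
  have h1 := height_bary_of_supported hx ht hs
  have h2 := height_bary_of_supported hx' ht' hs'
  have h3 := height_bary_le hx' ht
  have h4 := (height_bary_le hx ht').1
  have h1' := h1
  rw [h, height_smul] at h1' h4
  rw [h2] at h4
  have hr1 : r ≤ 1 := by nlinarith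
  have hr : r = 1 := by nlinarith [h3.1]
  subst hr
  rw [one_smul] at h
  rw [one_mul] at h1'
  have hs2 := h3.2 h1'
  have hdiff : ∑ v ∈ t, (x v - x' v) • (v : ℍ[ℝ]) = 0 := by
    simp only [sub_smul]
    rw [Finset.sum_sub_distrib, ← bary_eq_sum hs, ← bary_eq_sum hs2, h, sub_self]
  funext v
  by_cases hv : v ∈ t
  · exact sub_eq_zero.1 (linearIndependent_tet ht hdiff v hv)
  · rw [hs v hv, hs2 v hv]

theorem isCompact_realization : IsCompact cell600.realization := by
  have : cell600.realization = ⋃ t ∈ cell600.tets, stdSimplex ℝ icosians ∩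
      {x | ∀ v, v ∉ t → x v = 0} := by
    ext x
    simp only [Triangulation.realization, Set.mem_ofPred_eq, Set.mem_iUnion, Set.mem_inter_iff,
      exists_prop]
    constructor
    · rintro ⟨h, t, ht, hs⟩; exact ⟨t, ht, h, hs⟩
    · rintro ⟨t, ht, h, hs⟩; exact ⟨h, t, ht, hs⟩
  rw [this]
  refine cell600.tets.finite_toSet.isCompact_biUnion fun t _ => (isCompact_stdSimplex ℝ _).inter_right ?_
  simp only [Set.ofPred_forall]
  exact isClosed_iInter fun v => isClosed_iInter fun _ =>
    isClosed_eq (continuous_apply v) continuous_const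

/-- The boundary of the 600-cell is a triangulation of the three-sphere. -/
theorem nonempty_homeomorph_sphere :
    Nonempty (cell600.realization ≃ₜ Metric.sphere (0 : EuclideanSpace ℝ (Fin 4)) 1) := by
  have : CompactSpace cell600.realization := isCompact_iff_compactSpace.1 isCompact_realization
  let L := Quaternion.linearIsometryEquivTuple
  let F : cell600.realization → Metric.sphere (0 : EuclideanSpace ℝ (Fin 4)) 1 := fun x =>
    ⟨L ((‖bary x‖)⁻¹ • bary x), by
      have := norm_ne_zero_iff.2 (bary_ne_zero x.2)
      rw [mem_sphere_zero_iff_norm, LinearIsometryEquiv.norm_map, norm_smul, norm_inv, norm_norm,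
        inv_mul_cancel₀ this]⟩
  have hc : Continuous fun x : cell600.realization => bary x :=
    continuous_finsetSum _ fun v _ =>
      ((continuous_apply v).comp continuous_subtype_val).smul continuous_const
  have hF : Continuous F := by
    refine Continuous.subtype_mk (L.continuous.comp ((hc.norm.inv₀ fun x => ?_).smul hc)) _
    exact norm_ne_zero_iff.2 (bary_ne_zero x.2)
  refine ⟨hF.homeoOfEquivCompactToT2 (f := Equiv.ofBijective F ⟨?_, ?_⟩)⟩
  · intro x x' h
    have h1 := L.injective (congrArg Subtype.val h)
    -- Equal projections mean equal directions, so the two points differ by the ratio of their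
    -- norms.
    refine Subtype.ext (eq_of_bary_eq_smul x.2 x'.2 (r := ‖bary x‖ * ‖bary x'‖⁻¹) ?_ ?_)
    · exact mul_pos (norm_pos_iff.2 (bary_ne_zero x.2)) (inv_pos.2 (norm_pos_iff.2 (bary_ne_zero x'.2)))
    rw [mul_smul, ← h1, smul_smul, mul_inv_cancel₀ (norm_ne_zero_iff.2 (bary_ne_zero x.2)), one_smul]
  · rintro ⟨y, hy⟩
    rw [mem_sphere_zero_iff_norm] at hy
    obtain ⟨t, ht, c, hc0, hcy⟩ := exists_nonneg_coeff (L.symm y)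
    have hy1 : ‖L.symm y‖ = 1 := by rw [LinearIsometryEquiv.norm_map, hy]
    have hS : 0 < ∑ v ∈ t, c v := by
      refine lt_of_le_of_ne (Finset.sum_nonneg hc0) fun h => ?_
      have hz := (Finset.sum_eq_zero_iff_of_nonneg hc0).1 h.symm
      rw [← hcy, Finset.sum_eq_zero fun v hv => by rw [hz v hv, zero_smul], norm_zero] at hy1
      exact zero_ne_one hy1
    let x : icosians → ℝ := fun v => if v ∈ t then c v / ∑ v ∈ t, c v else 0
    have hxt : ∀ v, v ∉ t → x v = 0 := fun v hv => if_neg hv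
    have hx : x ∈ cell600.realization := by
      refine ⟨⟨fun v => ?_, ?_⟩, t, ht, hxt⟩
      · by_cases hv : v ∈ t
        · rw [show x v = _ from if_pos hv]; exact div_nonneg (hc0 v hv) hS.le
        · rw [hxt v hv]
      · rw [Finset.sum_ite_mem, Finset.univ_inter, ← Finset.sum_div, div_self hS.ne']
    have hb : bary x = (∑ v ∈ t, c v)⁻¹ • L.symm y := by
      rw [bary_eq_sum hxt, ← hcy, Finset.smul_sum]
      refine Finset.sum_congr rfl fun v hv => ?_
      rw [show x v = _ from if_pos hv, smul_smul, div_eq_inv_mul]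
    refine ⟨⟨x, hx⟩, Subtype.ext ?_⟩
    change L ((‖bary x‖)⁻¹ • bary x) = y
    rw [hb, norm_smul, hy1, mul_one, norm_inv, Real.norm_of_nonneg hS.le, inv_inv, smul_smul,
      mul_inv_cancel₀ hS.ne', one_smul, L.apply_symm_apply]

end Icosian

end

end PiecewiseFlat

namespace PiecewiseFlat

noncomputable section

open Real (goldenRatio)
open scoped goldenRatio Quaternion

namespace Icosian

open Triangulation

/-! ### Left translations -/

/-- Left translation by an icosian. -/
def shift (g : icosians) : Equiv.Perm icosians := Equiv.mulLeft g

theorem shift_apply (g x : icosians) : shift g x = g * x := rfl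

theorem mapEquiv_shift_mem (g : icosians) (t : Finset icosians) :
    mapEquiv (shift g) t ∈ cell600.tets ↔ t ∈ cell600.tets := by
  rw [mem_tets, mem_tets, show (mapEquiv (shift g) t).card = t.card from Finset.card_map _]
  refine and_congr_right fun _ => ⟨fun h x hx y hy hxy => ?_, fun h x hx y hy hxy => ?_⟩
  · have := h (shift g x) ((mem_mapEquiv _ _ _).2 hx) (shift g y) ((mem_mapEquiv _ _ _).2 hy)
      ((shift g).injective.ne hxy)
    rwa [shift_apply, shift_apply, inner_mul_left] at this
  · obtain ⟨x, rfl⟩ := (shift g).surjective x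
    obtain ⟨y, rfl⟩ := (shift g).surjective y
    rw [mem_mapEquiv] at hx hy
    rw [shift_apply, shift_apply, inner_mul_left]
    exact h x hx y hy fun h => hxy (by rw [h])

theorem isTranslate_iff (e e' : cell600.edges) :
    IsTranslate e e' ↔ ∃ g, e'.1 = mapEquiv (shift g) e.1 := by
  refine exists_congr fun g => ?_
  have h1 : e.1.image (fun x => (g : ℍ[ℝ]) * (x : ℍ[ℝ])) =
      (mapEquiv (shift g) e.1).image (fun x => (x : ℍ[ℝ])) := by
    ext y
    simp [mapEquiv_apply, shift_apply, coe_mul, eq_comm]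
  have h2 : ∀ (s : Finset icosians) (x : icosians),
      (x : ℍ[ℝ]) ∈ s.image (fun x => (x : ℍ[ℝ])) ↔ x ∈ s := by
    simp
  rw [h1]
  exact ⟨fun h => Finset.ext fun x => by rw [← h2, h, h2], fun h => by rw [h]⟩

theorem mapEquiv_shift_duo (g x y : icosians) :
    mapEquiv (shift g) (duo x y) = duo (g * x) (g * y) := mapEquiv_duo _ _ _

theorem isIsometry_shift {ℓ : cell600.edges → ℝ} (hℓ : ∀ e e', IsTranslate e e' → ℓ e' = ℓ e)
    (g : icosians) :
    cell600.IsIsometry ℓ (shift g) := by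
  refine ⟨mapEquiv_shift_mem g, fun x y => ?_⟩
  rw [shift_apply, shift_apply, len_eq_lenSet_duo, len_eq_lenSet_duo, ← mapEquiv_shift_duo]
  have hiff := mapEquiv_mem_edges (mapEquiv_shift_mem g) (duo x y)
  unfold lenSet
  by_cases h : duo x y ∈ cell600.edges
  · rw [dif_pos (hiff.2 h), dif_pos h]
    exact hℓ ⟨_, h⟩ ⟨_, hiff.2 h⟩ ((isTranslate_iff _ _).2 ⟨g, rfl⟩)
  · rw [dif_neg (mt hiff.1 h), dif_neg h]

theorem hasConstScalarCurvature {ℓ : cell600.edges → ℝ} (hℓ : ℓ ∈ invariantMetrics) :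
    cell600.HasConstLScalarCurvature ℓ ∧ cell600.HasConstVScalarCurvature ℓ :=
  Triangulation.hasConstScalarCurvature hℓ.1 tets_nonempty fun v w =>
    ⟨shift (w * v⁻¹), isIsometry_shift hℓ.2 _, by rw [shift_apply, inv_mul_cancel_right]⟩

/-! ### The simplices at the vertex `1` -/

/-- Guarantees that each pair `1, nbr i` lies in a tetrahedron, so that all pairs of vertices at
minimal distance really are edges. -/
theorem exists_pair_index : ∀ i : Fin 12, ∃ j k, (Ico.quot i j).isSome ∧ (Ico.quot i k).isSome ∧
    (Ico.quot j k).isSome := by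
  decide +kernel

theorem ne_of_inner_eq {x y : icosians} (h : inner ℝ (x : ℍ[ℝ]) y = φ / 2) : x ≠ y := by
  rintro rfl
  have := Real.goldenRatio_lt_two
  rw [inner_self] at h
  linarith

theorem inner_one_nbr (i : Fin 12) : inner ℝ ((1 : icosians) : ℍ[ℝ]) (nbr i) = φ / 2 :=
  (inner_eq_iff _ _).2 ⟨i, by rw [inv_one, one_mul]⟩

theorem duo_mem_edges {x y : icosians} :
    duo x y ∈ cell600.edges ↔ inner ℝ (x : ℍ[ℝ]) y = φ / 2 := by
  constructor
  · intro h
    have hxy : x ≠ y := by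
      rintro rfl
      have := cell600.card_of_mem_edges h
      simp [duo] at this
    obtain ⟨t, ht, hs⟩ := cell600.exists_tet_of_mem_edges h
    exact inner_of_ne ht (hs (mem_duo.2 (.inl rfl))) (hs (mem_duo.2 (.inr rfl))) hxy
  · intro h
    obtain ⟨i, hi⟩ := (inner_eq_iff _ _).1 h
    obtain rfl : y = x * nbr i := by rw [hi, mul_inv_cancel_left]
    obtain ⟨j, k, hj, hk, hjk⟩ := exists_pair_index i
    rw [← inner_nbr_eq_iff_isSome] at hj hk hjk
    have hx : ∀ l, inner ℝ (x : ℍ[ℝ]) (x * nbr l : icosians) = φ / 2 := fun l =>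
      (inner_eq_iff _ _).2 ⟨l, by rw [inv_mul_cancel_left]⟩
    refine cell600.mem_edges (quad_mem_tets (hx i) (hx j) (hx k) (by rwa [inner_mul_left])
      (by rwa [inner_mul_left]) (by rwa [inner_mul_left])) (fun z hz => ?_)
      (card_duo (ne_of_inner_eq h))
    rw [mem_duo] at hz
    rw [mem_quad]
    tauto

/-- The tetrahedra at `1`: the indices of the other three vertices. -/
def triTable : List (List (Fin 12)) :=
  [[0, 1, 8], [0, 1, 9], [0, 8, 11], [0, 9, 10], [0, 10, 11], [1, 4, 5], [1, 4, 8], [1, 5, 9],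
   [2, 5, 6], [2, 5, 9], [2, 6, 7], [2, 7, 10], [2, 9, 10], [3, 4, 6], [3, 4, 8], [3, 6, 7], [3,
   7, 11], [3, 8, 11], [4, 5, 6], [7, 10, 11]]

def tri (m : Fin 20) (c : Fin 3) : Fin 12 := (triTable.getD m []).getD c 0

/-- The types of the edges of the tetrahedra at `1`, in the order `01, 02, 03, 12, 13, 23`. -/
def labTable : List (List (Fin 6)) :=
  [[0, 1, 2, 5, 4, 3], [0, 1, 3, 5, 2, 4], [0, 2, 5, 4, 3, 1], [0, 3, 4, 2, 1, 5], [0, 4, 5, 1,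
   3, 2], [1, 4, 5, 0, 2, 3], [1, 4, 2, 0, 3, 5], [1, 5, 3, 2, 4, 0], [2, 5, 0, 4, 3, 1], [2, 5,
   3, 4, 1, 0], [2, 0, 1, 3, 5, 4], [2, 1, 4, 5, 0, 3], [2, 3, 4, 1, 0, 5], [3, 4, 0, 1, 5, 2],
   [3, 4, 2, 1, 0, 5], [3, 0, 1, 5, 2, 4], [3, 1, 5, 2, 4, 0], [3, 2, 5, 0, 4, 1], [4, 5, 0, 3,
   2, 1], [1, 4, 5, 3, 0, 2]]

def lab (m : Fin 20) (c : Fin 6) : Fin 6 := (labTable.getD m []).getD c 0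

/-- The type of an edge at `1`. -/
def edgeType (i : Fin 12) : Fin 6 := ⟨i % 6, Nat.mod_lt _ (by norm_num)⟩

theorem exists_tri : ∀ i j k : Fin 12, (Ico.quot i j).isSome → (Ico.quot i k).isSome →
    (Ico.quot j k).isSome → ∃ m, ∀ l, (l = i ∨ l = j ∨ l = k) ↔
      (l = tri m 0 ∨ l = tri m 1 ∨ l = tri m 2) := by
  decide +kernel

theorem tri_injective : ∀ m m', (∀ l, (l = tri m 0 ∨ l = tri m 1 ∨ l = tri m 2) ↔
    (l = tri m' 0 ∨ l = tri m' 1 ∨ l = tri m' 2)) → m = m' := by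
  decide +kernel

theorem edgeType_tri : ∀ m, edgeType (tri m 0) = lab m 0 ∧ edgeType (tri m 1) = lab m 1 ∧
    edgeType (tri m 2) = lab m 2 := by
  decide +kernel

/-- Translating by the inverse of its first endpoint moves an edge between two neighbours of `1` to
`1`, so its type is that of the quotient. -/
theorem edgeType_quot : ∀ m, (Ico.quot (tri m 0) (tri m 1)).map edgeType = some (lab m 3) ∧
    (Ico.quot (tri m 0) (tri m 2)).map edgeType = some (lab m 4) ∧
    (Ico.quot (tri m 1) (tri m 2)).map edgeType = some (lab m 5) := by
  decide +kernel

/-- The combinatorial key: the six edges of a tetrahedron represent the six types, each once.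
Consequently a metric that is exceptional on one type is exceptional on exactly one edge of every
tetrahedron. -/
theorem lab_injective : ∀ m c c', lab m c = lab m c' → c = c' := by
  decide +kernel

theorem inner_tri (m : Fin 20) : inner ℝ (nbr (tri m 0) : ℍ[ℝ]) (nbr (tri m 1)) = φ / 2 ∧
    inner ℝ (nbr (tri m 0) : ℍ[ℝ]) (nbr (tri m 2)) = φ / 2 ∧
    inner ℝ (nbr (tri m 1) : ℍ[ℝ]) (nbr (tri m 2)) = φ / 2 := by
  have h : ∀ {i j : Fin 12} {c : Fin 6}, (Ico.quot i j).map edgeType = some c →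
      inner ℝ (nbr i : ℍ[ℝ]) (nbr j) = φ / 2 := by
    intro i j c h
    rw [inner_nbr_eq_iff]
    rcases hq : Ico.quot i j with _ | k
    · rw [hq] at h; cases h
    · exact ⟨k, rfl⟩
  obtain ⟨h1, h2, h3⟩ := edgeType_quot m
  exact ⟨h h1, h h2, h h3⟩

/-- The tetrahedra at `1`. -/
def base (m : Fin 20) : Finset icosians :=
  quad 1 (nbr (tri m 0)) (nbr (tri m 1)) (nbr (tri m 2))

theorem base_mem_tets (m : Fin 20) : base m ∈ cell600.tets := by
  obtain ⟨h1, h2, h3⟩ := inner_tri m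
  exact quad_mem_tets (inner_one_nbr _) (inner_one_nbr _) (inner_one_nbr _) h1 h2 h3

theorem nbr_mem_base {m : Fin 20} {i : Fin 12} :
    nbr i ∈ base m ↔ (i = tri m 0 ∨ i = tri m 1 ∨ i = tri m 2) := by
  rw [base, mem_quad, nbr_inj, nbr_inj, nbr_inj, or_iff_right (ne_of_inner_eq (inner_one_nbr i)).symm]

theorem base_injective : Function.Injective base := fun m m' h =>
  tri_injective m m' fun l => by rw [← nbr_mem_base, ← nbr_mem_base, h]

theorem exists_base {t : Finset icosians} (ht : t ∈ cell600.tets) (h1 : 1 ∈ t) : ∃ m, base m = t := by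
  obtain ⟨a, b, c, ha, hb, hc, hab, hac, hbc, rfl⟩ :=
    exists_eq_quad_of_mem (cell600.card_tets t ht) h1
  have hmem : a ∈ quad 1 a b c ∧ b ∈ quad 1 a b c ∧ c ∈ quad 1 a b c := by simp [mem_quad]
  obtain ⟨i, hi⟩ := (inner_eq_iff _ _).1 (inner_of_ne ht h1 hmem.1 ha)
  obtain ⟨j, hj⟩ := (inner_eq_iff _ _).1 (inner_of_ne ht h1 hmem.2.1 hb)
  obtain ⟨k, hk⟩ := (inner_eq_iff _ _).1 (inner_of_ne ht h1 hmem.2.2 hc)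
  rw [inv_one, one_mul] at hi hj hk
  subst hi hj hk
  obtain ⟨m, hm⟩ := exists_tri i j k
    ((inner_nbr_eq_iff_isSome _ _).1 (inner_of_ne ht hmem.1 hmem.2.1 hab))
    ((inner_nbr_eq_iff_isSome _ _).1 (inner_of_ne ht hmem.1 hmem.2.2 hac))
    ((inner_nbr_eq_iff_isSome _ _).1 (inner_of_ne ht hmem.2.1 hmem.2.2 hbc))
  refine ⟨m, Finset.eq_of_subset_of_card_le (fun x hx => ?_) ?_⟩
  · have h : ∀ l, (l = tri m 0 ∨ l = tri m 1 ∨ l = tri m 2) → nbr l ∈ quad 1 (nbr i) (nbr j) (nbr k) := by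
      intro l hl
      rw [mem_quad, nbr_inj, nbr_inj, nbr_inj]
      exact .inr ((hm l).2 hl)
    rw [base, mem_quad] at hx
    rcases hx with rfl | rfl | rfl | rfl
    · exact h1
    · exact h _ (.inl rfl)
    · exact h _ (.inr (.inl rfl))
    · exact h _ (.inr (.inr rfl))
  · rw [cell600.card_tets _ ht, cell600.card_tets _ (base_mem_tets m)]

/-! ### Reduction to the six edge types -/

/-- The function `F` of six lengths at the tetrahedron `base m`, if the edges of type `i` have
length `x i`. -/
abbrev onLab {α : Type*} (F : ℝ → ℝ → ℝ → ℝ → ℝ → ℝ → α) (x : Fin 6 → ℝ) (m : Fin 20) : α :=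
  F (x (lab m 0)) (x (lab m 1)) (x (lab m 2)) (x (lab m 3)) (x (lab m 4)) (x (lab m 5))

/-- The lengths of the six types of edges. -/
def param (ℓ : cell600.edges → ℝ) (i : Fin 6) : ℝ :=
  cell600.len ℓ 1 (nbr (i.castLE (by norm_num)))

theorem eq_castLE_or : ∀ i : Fin 12, i = (edgeType i).castLE (by norm_num) ∨
    i = (edgeType i).castLE (by norm_num) + 6 := by
  decide +kernel

section

variable {ℓ : cell600.edges → ℝ} (hℓ : ∀ e e', IsTranslate e e' → ℓ e' = ℓ e)
include hℓ

theorem len_mul_left (g x y : icosians) : cell600.len ℓ (g * x) (g * y) = cell600.len ℓ x y :=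
  (isIsometry_shift hℓ g).len_map x y

/-- The edge from `1` to `(nbr j)⁻¹` is carried by left multiplication with `nbr j` to the edge from
`nbr j` to `1`. Hence the twelve edges at `1` carry only six lengths. -/
theorem len_one_nbr (i : Fin 12) : cell600.len ℓ 1 (nbr i) = param ℓ (edgeType i) := by
  rcases eq_castLE_or i with h | h
  · rw [param, ← h]
  · have : ∀ j, cell600.len ℓ 1 (nbr (j + 6)) = cell600.len ℓ 1 (nbr j) := by
      intro j
      rw [← len_mul_left hℓ (nbr j), nbr_add_six, mul_inv_cancel, mul_one, len_comm]
    rw [h, this, param, ← h]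

theorem len_nbr_nbr {i j : Fin 12} {c : Fin 6} (h : (Ico.quot i j).map edgeType = some c) :
    cell600.len ℓ (nbr i) (nbr j) = param ℓ c := by
  rcases hq : Ico.quot i j with _ | k
  · rw [hq] at h; cases h
  · rw [hq, Option.map_some, Option.some.injEq] at h
    rw [← len_mul_left hℓ (nbr i)⁻¹, inv_mul_cancel, inv_mul_nbr hq, len_one_nbr hℓ, h]

theorem atTet_base {α : Type*} (F : ℝ → ℝ → ℝ → ℝ → ℝ → ℝ → α) (m : Fin 20) :
    atTet F (cell600.len ℓ) 1 (nbr (tri m 0)) (nbr (tri m 1)) (nbr (tri m 2)) =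
      onLab F (param ℓ) m := by
  obtain ⟨h1, h2, h3⟩ := edgeType_quot m
  obtain ⟨h4, h5, h6⟩ := edgeType_tri m
  simp only [atTet, onLab, len_one_nbr hℓ, len_nbr_nbr hℓ h1, len_nbr_nbr hℓ h2, len_nbr_nbr hℓ h3,
    h4, h5, h6]

end

section

variable {ℓ : cell600.edges → ℝ} (hℓ : ℓ ∈ invariantMetrics)
include hℓ

theorem isNondegenerate_onLab (m : Fin 20) : onLab IsNondegenerate (param ℓ) m := by
  obtain ⟨h1, h2, h3⟩ := inner_tri m
  rw [← atTet_base hℓ.2]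
  exact isNondegenerate_quad hℓ.1 (base_mem_tets m) (ne_of_inner_eq (inner_one_nbr _))
    (ne_of_inner_eq (inner_one_nbr _)) (ne_of_inner_eq (inner_one_nbr _)) (ne_of_inner_eq h1)
    (ne_of_inner_eq h2) (ne_of_inner_eq h3)

theorem tetSum_base (m : Fin 20) : cell600.tetSum ℓ (base m) = onLab angleSum (param ℓ) m := by
  obtain ⟨h1, h2, h3⟩ := inner_tri m
  rw [← atTet_base hℓ.2]
  exact tetSum_quad hℓ.1 (base_mem_tets m) (ne_of_inner_eq (inner_one_nbr _))
    (ne_of_inner_eq (inner_one_nbr _)) (ne_of_inner_eq (inner_one_nbr _)) (ne_of_inner_eq h1)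
    (ne_of_inner_eq h2) (ne_of_inner_eq h3)

theorem tetVolume_base (m : Fin 20) :
    tetVolume (cell600.len ℓ) (base m) = onLab volOf (param ℓ) m := by
  obtain ⟨h1, h2, h3⟩ := inner_tri m
  rw [← atTet_base hℓ.2]
  exact tetVolume_quad (ne_of_inner_eq (inner_one_nbr _))
    (ne_of_inner_eq (inner_one_nbr _)) (ne_of_inner_eq (inner_one_nbr _)) (ne_of_inner_eq h1)
    (ne_of_inner_eq h2) (ne_of_inner_eq h3)

omit hℓ in
theorem sum_tets_eq_sum_base (F : Finset icosians → ℝ)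
    (hF : ∀ g t, F (mapEquiv (shift g) t) = F t) :
    ∑ t ∈ cell600.tets, F t = Fintype.card icosians * ((∑ m, F (base m)) / 4) :=
  sum_tets_eq base_injective base_mem_tets (fun _ => mem_quad.2 (.inl rfl))
    (fun _ ht h1 => exists_base ht h1) fun w =>
      ⟨shift w, mapEquiv_shift_mem w, hF w, mul_one w⟩

theorem totalVolume_eq : cell600.totalVolume ℓ =
    Fintype.card icosians * ((∑ m, onLab volOf (param ℓ) m) / 4) := by
  unfold totalVolume
  rw [sum_tets_eq_sum_base _ fun g t => (isIsometry_shift hℓ.2 g).tetVolume t]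
  simp only [tetVolume_base hℓ]

omit hℓ in
/-- The edge from `1` to an adjacent vertex. -/
def edgeAt (i : Fin 12) : cell600.edges := ⟨duo 1 (nbr i), duo_mem_edges.2 (inner_one_nbr i)⟩

omit hℓ in
theorem edgeAt_injective : Function.Injective edgeAt := fun i j h => by
  rcases duo_eq_duo_iff.1 (congrArg Subtype.val h) with h | h
  · exact nbr_inj.1 h.2
  · exact absurd h.1 (ne_of_inner_eq (inner_one_nbr j))

omit hℓ in
theorem exists_edgeAt {e : cell600.edges} (h1 : 1 ∈ e.1) : ∃ i, edgeAt i = e := by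
  obtain ⟨x, y, hxy, hd⟩ := exists_eq_duo (cell600.card_of_mem_edges e.2)
  have : ∃ z, e.1 = duo 1 z := by
    rw [hd, mem_duo] at h1
    rcases h1 with rfl | rfl
    · exact ⟨y, hd⟩
    · exact ⟨x, hd.trans (duo_eq_duo_iff.2 (.inr ⟨rfl, rfl⟩))⟩
  obtain ⟨z, hz⟩ := this
  obtain ⟨i, hi⟩ := (inner_eq_iff _ _).1 (duo_mem_edges.1 (hz ▸ e.2))
  rw [inv_one, one_mul] at hi
  exact ⟨i, Subtype.ext (by rw [hz, ← hi]; rfl)⟩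

omit hℓ in
theorem apply_edgeAt (i : Fin 12) : ℓ (edgeAt i) = cell600.len ℓ 1 (nbr i) :=
  (cell600.lenSet_coe ℓ (edgeAt i)).symm

omit hℓ in
theorem sum_edgeType (x : Fin 6 → ℝ) : ∑ i, x (edgeType i) = 2 * ∑ i, x i := by
  simp only [Fin.sum_univ_succ, Fin.sum_univ_zero, edgeType]
  norm_num [Fin.succ]
  ring

/-- At each vertex every type occurs twice, and counting edges at all vertices counts each edge
twice. -/
theorem totalLength_eq_param :
    cell600.totalLength ℓ = Fintype.card icosians * ∑ i, param ℓ i := by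
  rw [totalLength_eq edgeAt_injective (fun _ => mem_duo.2 (.inl rfl)) (fun _ => exists_edgeAt)
    fun w => ⟨shift w, isIsometry_shift hℓ.2 w, mul_one w⟩]
  simp only [apply_edgeAt, len_one_nbr hℓ.2, sum_edgeType]
  ring

theorem EHR_eq_param : cell600.EHR ℓ = Fintype.card icosians *
    (2 * Real.pi * ∑ i, param ℓ i - (∑ m, onLab angleSum (param ℓ) m) / 4) := by
  rw [EHR_eq, totalLength_eq_param hℓ, sum_tets_eq_sum_base _ fun g t => (isIsometry_shift hℓ.2 g).tetSum t]
  simp only [tetSum_base hℓ]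
  ring

end

end Icosian

end

end PiecewiseFlat

namespace PiecewiseFlat

noncomputable section

open Real Set

/-! ### Tetrahedra with five equal edges -/

namespace OneEdge

theorem le_of_deriv_nonneg {f f' : ℝ → ℝ} {a b : ℝ} (hab : a ≤ b) (hc : ContinuousOn f (Icc a b))
    (hd : ∀ x ∈ Ioo a b, HasDerivAt f (f' x) x) (h : ∀ x ∈ Ioo a b, 0 ≤ f' x) : f a ≤ f b := by
  refine monotoneOn_of_deriv_nonneg (convex_Icc a b) hc ?_ ?_ (left_mem_Icc.2 hab)
    (right_mem_Icc.2 hab) hab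
  · rw [interior_Icc]
    exact fun x hx => (hd x hx).differentiableAt.differentiableWithinAt
  · rw [interior_Icc]
    intro x hx
    rw [(hd x hx).deriv]
    exact h x hx

theorem lt_of_deriv_pos {f f' : ℝ → ℝ} {a b : ℝ} (hab : a < b) (hc : ContinuousOn f (Icc a b))
    (hd : ∀ x ∈ Ioo a b, HasDerivAt f (f' x) x) (h : ∀ x ∈ Ioo a b, 0 < f' x) : f a < f b := by
  refine strictMonoOn_of_deriv_pos (convex_Icc a b) hc ?_ (left_mem_Icc.2 hab.le)
    (right_mem_Icc.2 hab.le) hab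
  rw [interior_Icc]
  intro x hx
  rw [(hd x hx).deriv]
  exact h x hx

/-- The dihedral angle at the exceptional edge of length `b`, the others having length `1`. -/
def angle (b : ℝ) : ℝ := arccos ((2 - b ^ 2) / (4 - b ^ 2))

/-- The dihedral angle at the edge opposite to the exceptional one. -/
def angleOpp (b : ℝ) : ℝ := arccos (1 - 2 * b ^ 2 / 3)

/-- The dihedral angle at the edges adjacent to the exceptional one. -/
def angleAdj (b : ℝ) : ℝ := arccos (b / (√3 * √(4 - b ^ 2)))

/-- The sum of the edge lengths, weighted by the dihedral angles. -/
def weighted (b : ℝ) : ℝ := b * angle b + angleOpp b + 4 * angleAdj b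

/-- The derivative of `angle`. -/
def angleDeriv (b : ℝ) : ℝ := 2 * b / ((4 - b ^ 2) * √(3 - b ^ 2))

/-- The degenerate value `b = 0` is included because the bound for short exceptional edges is
integrated from there. -/
theorem continuousOn_angle : ContinuousOn angle (Set.Ico 0 √3) := by
  refine continuous_arccos.comp_continuousOn (ContinuousOn.div (by fun_prop) (by fun_prop) ?_)
  rintro x ⟨h0, h1⟩
  have := (Real.lt_sqrt h0).1 h1
  linarith

theorem continuousOn_weighted : ContinuousOn weighted (Set.Ico 0 √3) := by
  refine ((continuousOn_id.mul continuousOn_angle).add ?_).add (continuousOn_const.mul ?_)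
  · unfold angleOpp
    fun_prop
  · refine continuous_arccos.comp_continuousOn (ContinuousOn.div (by fun_prop) (by fun_prop) ?_)
    rintro x ⟨h0, h1⟩
    have := (Real.lt_sqrt h0).1 h1
    have h2 : 0 < √(4 - x ^ 2) := Real.sqrt_pos.2 (by linarith)
    positivity

section
variable {b : ℝ} (h0 : 0 < b) (h1 : b < √3)
include h0 h1

theorem sq_lt_three : b ^ 2 < 3 := (Real.lt_sqrt h0.le).1 h1

theorem hasDerivAt_angle : HasDerivAt angle (angleDeriv b) b := by
  have h3 := sq_lt_three h0 h1
  have h4 : 0 < 4 - b ^ 2 := by linarith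
  have hs : 0 < √(3 - b ^ 2) := Real.sqrt_pos.2 (by linarith)
  have hd : HasDerivAt (fun b : ℝ => (2 - b ^ 2) / (4 - b ^ 2)) (-4 * b / (4 - b ^ 2) ^ 2) b := by
    have hp : HasDerivAt (fun b : ℝ => b ^ 2) (2 * b) b := by simpa using hasDerivAt_pow 2 b
    refine ((hp.const_sub 2).div (hp.const_sub 4) h4.ne').congr_deriv ?_
    field_simp
    ring
  have hlt : (2 - b ^ 2) / (4 - b ^ 2) < 1 := by rw [div_lt_one h4]; linarith
  have hgt : -1 < (2 - b ^ 2) / (4 - b ^ 2) := by rw [lt_div_iff₀ h4]; linarith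
  have hsq : √(1 - ((2 - b ^ 2) / (4 - b ^ 2)) ^ 2) = 2 * √(3 - b ^ 2) / (4 - b ^ 2) := by
    rw [Real.sqrt_eq_iff_mul_self_eq_of_pos (by positivity), div_mul_div_comm, div_pow,
      mul_mul_mul_comm, Real.mul_self_sqrt (by linarith)]
    field_simp
    ring
  refine ((Real.hasDerivAt_arccos hgt.ne' hlt.ne).comp b hd).congr_deriv ?_
  rw [hsq, angleDeriv]
  field_simp
  ring

theorem hasDerivAt_angleOpp : HasDerivAt angleOpp (2 / √(3 - b ^ 2)) b := by
  have h3 := sq_lt_three h0 h1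
  have hs : 0 < √(3 - b ^ 2) := Real.sqrt_pos.2 (by linarith)
  have hd : HasDerivAt (fun b : ℝ => 1 - 2 * b ^ 2 / 3) (-(4 * b / 3)) b := by
    have hp : HasDerivAt (fun b : ℝ => b ^ 2) (2 * b) b := by simpa using hasDerivAt_pow 2 b
    refine (((hp.const_mul 2).div_const 3).const_sub 1).congr_deriv ?_
    ring
  have hlt : 1 - 2 * b ^ 2 / 3 < 1 := by have := sq_pos_of_pos h0; linarith
  have hgt : -1 < 1 - 2 * b ^ 2 / 3 := by linarith
  have hsq : √(1 - (1 - 2 * b ^ 2 / 3) ^ 2) = 2 * b * √(3 - b ^ 2) / 3 := by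
    rw [Real.sqrt_eq_iff_mul_self_eq_of_pos (by positivity), div_mul_div_comm,
      mul_mul_mul_comm, Real.mul_self_sqrt (by linarith)]
    ring
  refine ((Real.hasDerivAt_arccos hgt.ne' hlt.ne).comp b hd).congr_deriv ?_
  rw [hsq]
  field_simp
  ring

theorem hasDerivAt_angleAdj :
    HasDerivAt angleAdj (-(2 / ((4 - b ^ 2) * √(3 - b ^ 2)))) b := by
  have h3 := sq_lt_three h0 h1
  have h4 : 0 < 4 - b ^ 2 := by linarith
  have hs : 0 < √(3 - b ^ 2) := Real.sqrt_pos.2 (by linarith)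
  have hs4 : 0 < √(4 - b ^ 2) := Real.sqrt_pos.2 h4
  have hs3 : 0 < √(3 : ℝ) := Real.sqrt_pos.2 (by norm_num)
  have e4 : √(4 - b ^ 2) ^ 2 = 4 - b ^ 2 := Real.sq_sqrt h4.le
  have e3 : √(3 : ℝ) ^ 2 = 3 := Real.sq_sqrt (by norm_num)
  have es : √(3 - b ^ 2) ^ 2 = 3 - b ^ 2 := Real.sq_sqrt (by linarith)
  have hd : HasDerivAt (fun b : ℝ => b / (√3 * √(4 - b ^ 2)))
      (4 / (√3 * √(4 - b ^ 2) ^ 3)) b := by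
    have hp : HasDerivAt (fun b : ℝ => b ^ 2) (2 * b) b := by simpa using hasDerivAt_pow 2 b
    have hq := (((hp.const_sub 4).sqrt h4.ne').const_mul √3)
    refine ((hasDerivAt_id' b).div hq (by positivity)).congr_deriv ?_
    field_simp
    rw [e4]
    ring
  have hsqr : (b / (√3 * √(4 - b ^ 2))) ^ 2 < 1 := by
    rw [div_pow, mul_pow, e3, e4, div_lt_one (by positivity)]
    linarith
  have hab := (sq_lt_one_iff_abs_lt_one _).1 hsqr
  rw [abs_lt] at hab
  have hsq : √(1 - (b / (√3 * √(4 - b ^ 2))) ^ 2) = 2 * √(3 - b ^ 2) / (√3 * √(4 - b ^ 2)) := by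
    rw [Real.sqrt_eq_iff_mul_self_eq_of_pos (by positivity), ← sq, div_pow, div_pow, mul_pow, mul_pow,
      e3, e4, es]
    field_simp
    ring
  refine ((Real.hasDerivAt_arccos hab.1.ne' hab.2.ne).comp b hd).congr_deriv ?_
  rw [hsq]
  field_simp
  rw [e4]
  ring

/-- The Schläfli formula for the family. -/
theorem hasDerivAt_weighted : HasDerivAt weighted (angle b) b := by
  have h3 := sq_lt_three h0 h1
  have h4 : 0 < 4 - b ^ 2 := by linarith
  have hs : 0 < √(3 - b ^ 2) := Real.sqrt_pos.2 (by linarith)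
  -- The length-weighted derivatives of the angles cancel: over a common denominator they give `2 b²
  -- + 2 (4 - b²) - 8 = 0`.
  refine ((((hasDerivAt_id' b).mul (hasDerivAt_angle h0 h1)).add (hasDerivAt_angleOpp h0 h1)).add
    ((hasDerivAt_angleAdj h0 h1).const_mul 4)).congr_deriv ?_
  simp only [angleDeriv]
  field_simp
  ring

theorem angleDeriv_pos : 0 < angleDeriv b := by
  have h3 := sq_lt_three h0 h1
  have h4 : 0 < 4 - b ^ 2 := by linarith
  have hs : 0 < √(3 - b ^ 2) := Real.sqrt_pos.2 (by linarith)
  unfold angleDeriv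
  positivity

/-- Bound the denominator by its value at `0`, with `√3 < 1.733` and `0.288 < 2 / (4 * 1.733)`. -/
theorem le_angleDeriv : 0.288 * b ≤ angleDeriv b := by
  have h3 := sq_lt_three h0 h1
  have h4 : 0 < 4 - b ^ 2 := by linarith
  have hs : 0 < √(3 - b ^ 2) := Real.sqrt_pos.2 (by linarith)
  have hs' : √(3 - b ^ 2) ≤ 1.733 := by
    rw [Real.sqrt_le_iff]; constructor
    · norm_num
    · nlinarith [sq_nonneg b]
  unfold angleDeriv
  rw [le_div_iff₀ (by positivity)]
  have : (4 - b ^ 2) * √(3 - b ^ 2) ≤ 4 * 1.733 := by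
    apply mul_le_mul _ hs' hs.le (by norm_num)
    nlinarith [sq_nonneg b]
  nlinarith

/-- The same with the values at `1`: `√2 < 1.415` and `0.47 < 2 / (3 * 1.415)`. -/
theorem le_angleDeriv_of_one_le (hb : 1 ≤ b) : 0.47 ≤ angleDeriv b := by
  have h3 := sq_lt_three h0 h1
  have h4 : 0 < 4 - b ^ 2 := by linarith
  have hs : 0 < √(3 - b ^ 2) := Real.sqrt_pos.2 (by linarith)
  have hs' : √(3 - b ^ 2) ≤ 1.415 := by
    rw [Real.sqrt_le_iff]; constructor
    · norm_num
    · nlinarith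
  unfold angleDeriv
  rw [le_div_iff₀ (by positivity)]
  have : (4 - b ^ 2) * √(3 - b ^ 2) ≤ 3 * 1.415 := by
    apply mul_le_mul _ hs' hs.le (by norm_num)
    nlinarith
  nlinarith

end

/-! ### The length normalized comparison on the one-edge family -/

theorem one_lt_sqrt_three : (1 : ℝ) < √3 := by
  rw [Real.lt_sqrt (by norm_num)]; norm_num

theorem angle_one : angle 1 = arccos (1 / 3) := by norm_num [angle]

theorem weighted_one : weighted 1 = 6 * arccos (1 / 3) := by
  have h : (1 : ℝ) / (√3 * √3) = 1 / 3 := by rw [Real.mul_self_sqrt (by norm_num)]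
  unfold weighted angleOpp angleAdj
  rw [angle_one]
  norm_num [h]
  ring

theorem angle_zero : angle 0 = π / 3 := by
  rw [angle, show ((2 : ℝ) - 0 ^ 2) / (4 - 0 ^ 2) = cos (π / 3) by rw [cos_pi_div_three]; norm_num]
  exact arccos_cos (by positivity) (by linarith [pi_pos])

theorem weighted_zero : weighted 0 = 2 * π := by
  unfold weighted angleOpp angleAdj
  norm_num
  ring

theorem angle_lt_angle {b c : ℝ} (hb : 0 ≤ b) (hbc : b < c) (hc : c < √3) : angle b < angle c :=
  lt_of_deriv_pos hbc (continuousOn_angle.mono fun _ hx => ⟨hb.trans hx.1, hx.2.trans_lt hc⟩)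
    (fun _ hx => hasDerivAt_angle (hb.trans_lt hx.1) (hx.2.trans hc))
    fun _ hx => angleDeriv_pos (hb.trans_lt hx.1) (hx.2.trans hc)

/-- The weighted sum of the dihedral angles, relative to the total length, is minimal for the
regular tetrahedron. -/
theorem arccos_mul_lt_weighted {b : ℝ} (h0 : 0 < b) (h1 : b < √3) (hb : b ≠ 1) :
    arccos (1 / 3) * (5 + b) < weighted b := by
  have hlin : ∀ x : ℝ, HasDerivAt (fun b => arccos (1 / 3) * (5 + b)) (arccos (1 / 3)) x := by
    intro x
    simpa using ((hasDerivAt_id x).const_add 5).const_mul (arccos (1 / 3))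
  have hcont : ContinuousOn (fun b => weighted b - arccos (1 / 3) * (5 + b)) (Set.Ico 0 √3) :=
    continuousOn_weighted.sub (by fun_prop)
  -- The linear function is the tangent of `weighted` at `1`. The derivative of the difference is
  -- `angle x - arccos (1 / 3)`, whose sign changes exactly at `1` since `angle` is increasing.
  have h11 : weighted 1 - arccos (1 / 3) * (5 + 1) = 0 := by rw [weighted_one]; ring
  rcases lt_or_gt_of_ne hb with hb | hb
  · have := lt_of_deriv_pos hb (f := fun b => arccos (1 / 3) * (5 + b) - weighted b)
      (f' := fun x => arccos (1 / 3) - angle x)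
      (((by fun_prop : Continuous fun b => arccos (1 / 3) * (5 + b)).continuousOn).sub
        (continuousOn_weighted.mono fun x hx => ⟨h0.le.trans hx.1, hx.2.trans_lt one_lt_sqrt_three⟩))
      (fun x hx => (hlin x).sub (hasDerivAt_weighted (h0.trans hx.1)
        (hx.2.trans one_lt_sqrt_three)))
      (fun x hx => by
        rw [← angle_one]
        exact sub_pos.2 (angle_lt_angle (h0.trans hx.1).le hx.2 one_lt_sqrt_three))
    beta_reduce at this
    linarith
  · have := lt_of_deriv_pos hb (f := fun b => weighted b - arccos (1 / 3) * (5 + b))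
      (f' := fun x => angle x - arccos (1 / 3))
      (hcont.mono fun x hx => ⟨zero_le_one.trans hx.1, hx.2.trans_lt h1⟩)
      (fun x hx => (hasDerivAt_weighted (one_pos.trans hx.1) (hx.2.trans h1)).sub (hlin x))
      (fun x hx => by
        rw [← angle_one]
        exact sub_pos.2 (angle_lt_angle zero_le_one hx.1 (hx.2.trans h1)))
    beta_reduce at this
    linarith

/-! ### The volume normalized functional on the family -/

/-- The angle defect of the regular 600-cell. -/
def defect : ℝ := 2 * π - 5 * arccos (1 / 3)

/-- The claim is that `2π / 5 - arccos (1 / 3)` lies between `0.024` and `0.026`. As `cos (2π / 5) =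
(√5 - 1) / 4` is known exactly, the addition formula and elementary bounds for `sin` and `cos` at
these small arguments compare the cosines with `1 / 3`. -/
theorem defect_bounds : 0.12 ≤ defect ∧ defect ≤ 0.13 := by
  have h5 : √5 ^ 2 = (5 : ℝ) := Real.sq_sqrt (by norm_num)
  have h5l : (2.236 : ℝ) < √5 := by rw [Real.lt_sqrt (by norm_num)]; norm_num
  have h5u : √5 < (2.2361 : ℝ) := by rw [Real.sqrt_lt' (by norm_num)]; norm_num
  have hc : cos (2 * (π / 5)) = (√5 - 1) / 4 := by
    rw [cos_two_mul, cos_pi_div_five]; linear_combination h5 / 8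
  have hsp : 0 < sin (2 * (π / 5)) := sin_pos_of_pos_of_lt_pi (by positivity) (by linarith [pi_pos])
  have hsc := sin_sq_add_cos_sq (2 * (π / 5))
  rw [hc] at hsc
  have hsl : 0.951 < sin (2 * (π / 5)) := by
    by_contra! h
    nlinarith
  have hsu : sin (2 * (π / 5)) < 0.952 := by
    by_contra! h
    nlinarith
  have key : ∀ t : ℝ, cos (2 * (π / 5) - t) =
      (√5 - 1) / 4 * cos t + sin (2 * (π / 5)) * sin t := by
    intro t; rw [cos_sub, hc]
  have hpi := pi_gt_three
  have hpi' := pi_le_four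
  constructor
  · have : arccos (1 / 3) ≤ 2 * (π / 5) - 0.024 := by
      have h1 : cos (2 * (π / 5) - 0.024) ≤ 1 / 3 := by
        rw [key]
        have h2 := cos_le_one 0.024
        have h3 := sin_lt (show (0 : ℝ) < 0.024 by norm_num)
        have h4 := sin_nonneg_of_nonneg_of_le_pi (show (0 : ℝ) ≤ 0.024 by norm_num) (by linarith)
        nlinarith
      calc arccos (1 / 3) ≤ arccos (cos (2 * (π / 5) - 0.024)) := arccos_le_arccos h1
        _ = _ := arccos_cos (by linarith) (by linarith)
    unfold defect
    linarith
  · have : 2 * (π / 5) - 0.026 ≤ arccos (1 / 3) := by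
      have h1 : 1 / 3 ≤ cos (2 * (π / 5) - 0.026) := by
        rw [key]
        have h2 := one_sub_sq_div_two_le_cos (x := 0.026)
        have h3 := sin_gt_sub_cube (show (0 : ℝ) < 0.026 by norm_num)
        norm_num at h2 h3
        nlinarith
      calc 2 * (π / 5) - 0.026 = arccos (cos (2 * (π / 5) - 0.026)) :=
            (arccos_cos (by linarith) (by linarith)).symm
        _ ≤ _ := arccos_le_arccos h1
    unfold defect
    linarith

/-- The normalized Einstein-Hilbert-Regge functional of the family. -/
def ehr (b : ℝ) : ℝ := 2 * π * (5 + b) - 5 * weighted b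

theorem ehr_one : ehr 1 = 6 * defect := by
  rw [ehr, weighted_one, defect]; ring

theorem ehr_zero : ehr 0 = 0 := by
  rw [ehr, weighted_zero]; ring

theorem continuousOn_ehr : ContinuousOn ehr (Set.Ico 0 √3) :=
  (Continuous.continuousOn (by fun_prop)).sub (continuousOn_const.mul continuousOn_weighted)

theorem hasDerivAt_ehr {b : ℝ} (h0 : 0 < b) (h1 : b < √3) :
    HasDerivAt ehr (2 * π - 5 * angle b) b := by
  exact ((((hasDerivAt_id' b).const_add 5).const_mul (2 * π)).sub
    ((hasDerivAt_weighted h0 h1).const_mul 5)).congr_deriv (by ring)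

/-- Comparison of `ehr` with a function `u` on the interval between `b` and `c`. -/
theorem ehr_le_of_deriv {u u' : ℝ → ℝ} {b c : ℝ} (hb : 0 ≤ b) (hbc : b ≤ c) (hc : c < √3)
    (hu : ∀ x, HasDerivAt u (u' x) x) (h : ∀ x ∈ Ioo b c, 2 * π - 5 * angle x ≤ u' x)
    (h0 : ehr b ≤ u b) : ehr c ≤ u c := by
  have := le_of_deriv_nonneg hbc (f := fun x => u x - ehr x)
    (f' := fun x => u' x - (2 * π - 5 * angle x))
    ((Differentiable.continuous fun x => (hu x).differentiableAt).continuousOn.sub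
      (continuousOn_ehr.mono fun x hx => ⟨hb.trans hx.1, hx.2.trans_lt hc⟩))
    (fun x hx => (hu x).sub (hasDerivAt_ehr (hb.trans_lt hx.1) (hx.2.trans hc)))
    (fun x hx => sub_nonneg.2 (h x hx))
  beta_reduce at this
  linarith

/-- The same comparison integrated backwards from the right end `c`, for arguments below `1`, where
the value at `1` is the known one. -/
theorem ehr_le_of_deriv' {u u' : ℝ → ℝ} {b c : ℝ} (hb : 0 ≤ b) (hbc : b ≤ c) (hc : c < √3)
    (hu : ∀ x, HasDerivAt u (u' x) x) (h : ∀ x ∈ Ioo b c, u' x ≤ 2 * π - 5 * angle x)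
    (h0 : ehr c ≤ u c) : ehr b ≤ u b := by
  have := le_of_deriv_nonneg hbc (f := fun x => ehr x - u x)
    (f' := fun x => (2 * π - 5 * angle x) - u' x)
    ((continuousOn_ehr.mono fun x hx => ⟨hb.trans hx.1, hx.2.trans_lt hc⟩).sub
      (Differentiable.continuous fun x => (hu x).differentiableAt).continuousOn)
    (fun x hx => (hasDerivAt_ehr (hb.trans_lt hx.1) (hx.2.trans hc)).sub (hu x))
    (fun x hx => sub_nonneg.2 (h x hx))
  beta_reduce at this
  linarith

/-- The angle is at least `angle 0 = π / 3`, so the slope of `ehr` is at most `2π - 5π / 3`. -/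
theorem ehr_le_linear {b : ℝ} (h0 : 0 ≤ b) (h1 : b < √3) : ehr b ≤ π / 3 * b := by
  refine ehr_le_of_deriv le_rfl h0 h1 (u' := fun _ => π / 3)
    (fun x => by simpa using (hasDerivAt_id x).const_mul (π / 3)) (fun x hx => ?_) (by
      rw [ehr_zero, mul_zero])
  have := angle_lt_angle le_rfl hx.1 (hx.2.trans h1)
  rw [angle_zero] at this
  linarith

theorem angle_le_of_le_one {b : ℝ} (h0 : 0 < b) (hb : b ≤ 1) :
    angle b ≤ arccos (1 / 3) - 0.144 * (1 - b ^ 2) := by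
  have hp : ∀ x : ℝ, HasDerivAt (fun x : ℝ => 0.144 * (1 - x ^ 2)) (-(0.288 * x)) x := by
    intro x
    exact (((hasDerivAt_pow 2 x).const_sub 1).const_mul 0.144).congr_deriv (by norm_num; ring)
  have := le_of_deriv_nonneg hb (f := fun x => angle x + 0.144 * (1 - x ^ 2))
    (f' := fun x => angleDeriv x + -(0.288 * x))
    ((continuousOn_angle.mono fun x hx => ⟨h0.le.trans hx.1, hx.2.trans_lt one_lt_sqrt_three⟩).add
      (Continuous.continuousOn (by fun_prop)))
    (fun x hx => (hasDerivAt_angle (h0.trans hx.1) (hx.2.trans one_lt_sqrt_three)).add (hp x))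
    (fun x hx => by
      have := le_angleDeriv (h0.trans hx.1) (hx.2.trans one_lt_sqrt_three)
      linarith)
  beta_reduce at this
  rw [angle_one] at this
  linarith

/-- Integrates `angle_le_of_le_one`: `5 * 0.144 = 0.72`, and `-(1 - b)² (b + 2)` is an
antiderivative of `3 (1 - b²)` vanishing at `1`. -/
theorem ehr_le_of_le_one {b : ℝ} (h0 : 0 < b) (hb : b ≤ 1) :
    ehr b ≤ defect * (5 + b) - 0.24 * ((1 - b) ^ 2 * (b + 2)) := by
  refine ehr_le_of_deriv' h0.le hb one_lt_sqrt_three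
    (u := fun b => defect * (5 + b) - 0.24 * ((1 - b) ^ 2 * (b + 2)))
    (u' := fun x => defect + 0.72 * (1 - x ^ 2)) (fun x => ?_)
    (fun x hx => ?_) (by rw [ehr_one]; linarith)
  · have h1 := ((hasDerivAt_id' x).const_add 5).const_mul defect
    have h2 := ((((hasDerivAt_id' x).const_sub 1).pow 2).mul
      ((hasDerivAt_id' x).add_const 2)).const_mul 0.24
    exact (h1.sub h2).congr_deriv (by norm_num; ring)
  · have := angle_le_of_le_one (h0.trans hx.1) hx.2.le
    unfold defect
    linarith

theorem le_angle_of_one_le {b : ℝ} (hb : 1 ≤ b) (h1 : b < √3) :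
    arccos (1 / 3) + 0.47 * (b - 1) ≤ angle b := by
  have hp : ∀ x : ℝ, HasDerivAt (fun x : ℝ => 0.47 * (x - 1)) 0.47 x := by
    intro x
    simpa using ((hasDerivAt_id x).sub_const 1).const_mul 0.47
  have := le_of_deriv_nonneg hb (f := fun x => angle x - 0.47 * (x - 1))
    (f' := fun x => angleDeriv x - 0.47)
    ((continuousOn_angle.mono fun x hx => ⟨zero_le_one.trans hx.1, hx.2.trans_lt h1⟩).sub
      (Continuous.continuousOn (by fun_prop)))
    (fun x hx => (hasDerivAt_angle (one_pos.trans hx.1) (hx.2.trans h1)).sub (hp x))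
    (fun x hx => sub_nonneg.2 (le_angleDeriv_of_one_le (one_pos.trans hx.1) (hx.2.trans h1)
      hx.1.le))
  beta_reduce at this
  rw [angle_one] at this
  linarith

/-- Integrates `le_angle_of_one_le` from `1`, with `5 * 0.47 / 2 = 1.175`. -/
theorem ehr_le_of_one_le {b : ℝ} (hb : 1 ≤ b) (h1 : b < √3) :
    ehr b ≤ defect * (5 + b) - 1.175 * (b - 1) ^ 2 := by
  refine ehr_le_of_deriv zero_le_one hb h1
    (u := fun b => defect * (5 + b) - 1.175 * (b - 1) ^ 2)
    (u' := fun x => defect - 2.35 * (x - 1)) (fun x => ?_)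
    (fun x hx => ?_) (by rw [ehr_one]; linarith)
  · have h1 := ((hasDerivAt_id' x).const_add 5).const_mul defect
    have h2 := (((hasDerivAt_id' x).sub_const 1).pow 2).const_mul 1.175
    exact (h1.sub h2).congr_deriv (by norm_num; ring)
  · have := le_angle_of_one_le hx.1.le (hx.2.trans h1)
    unfold defect
    linarith

/-- From `b² ≥ 8 / 3` on, that is from just below `1.634`, the angle is at least `2π / 3`, so the
slope is at most `-4π / 3 < -4.18`. The starting value comes from `ehr_le_of_one_le` at `1.634` and
`defect ≤ 0.13`. -/
theorem ehr_le_of_large {b : ℝ} (hb : 1.634 ≤ b) (h1 : b < √3) :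
    ehr b ≤ 6 * defect * 0.503 - 4.18 * (b - 1.634) := by
  have hd := defect_bounds
  have h2 : (1.634 : ℝ) < √3 := hb.trans_lt h1
  refine ehr_le_of_deriv (by norm_num) hb h1
    (u := fun b => 6 * defect * 0.503 - 4.18 * (b - 1.634))
    (u' := fun _ => -4.18) (fun x => ?_) (fun x hx => ?_) ?_
  · simpa using (((hasDerivAt_id x).sub_const 1.634).const_mul 4.18).const_sub (6 * defect * 0.503)
  · have hx0 : (0 : ℝ) < x := lt_trans (by norm_num) hx.1
    have h3 := sq_lt_three hx0 (hx.2.trans h1)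
    have : 2 * (π / 3) ≤ angle x := by
      rw [angle, ← arccos_cos (x := 2 * (π / 3)) (by positivity) (by linarith [pi_pos])]
      apply arccos_le_arccos
      rw [cos_two_mul, cos_pi_div_three, div_le_iff₀ (by linarith)]
      nlinarith [hx.1]
    linarith [pi_gt_d2]
  · have := ehr_le_of_one_le (b := 1.634) (by norm_num) h2
    norm_num at this ⊢
    linarith

/-- With `s = 1 - b`, both sides are `1 - s` to first order, and the slack is quadratic. The sixth
power is taken as a square, rounded up to a quadratic polynomial, and then a cube. -/
theorem pow_six_lt_of_small {s : ℝ} (h0 : 0 < s) (h1 : s ≤ 0.4) :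
    (1 - s / 6 - 0.8 * s ^ 2) ^ 6 < (1 - s) ^ 2 * (3 - (1 - s) ^ 2) / 2 := by
  have hu : (1 - s / 6 - 0.8 * s ^ 2) ^ 2 ≤ 1 - s / 3 - 1.36 * s ^ 2 := by
    have : 0 ≤ s ^ 2 * ((0.4 - s) * (0.64 * s + 0.5227)) := by
      have : 0 ≤ 0.4 - s := by linarith
      positivity
    nlinarith [sq_nonneg s]
  have hw : 0 ≤ 1 - s / 3 - 1.36 * s ^ 2 := (sq_nonneg _).trans hu
  calc (1 - s / 6 - 0.8 * s ^ 2) ^ 6 = ((1 - s / 6 - 0.8 * s ^ 2) ^ 2) ^ 3 := by ring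
    _ ≤ (1 - s / 3 - 1.36 * s ^ 2) ^ 3 := pow_le_pow_left₀ (sq_nonneg _) hu 3
    _ < _ := by
      have hz : 0 < (s / 3 + 1.36 * s ^ 2) ^ 3 := by positivity
      have h2 : 0 < s ^ 2 * (2.24 - 0.73 * s - 6.06 * s ^ 2) := by
        have : 0 < 2.24 - 0.73 * s - 6.06 * s ^ 2 := by nlinarith
        positivity
      nlinarith [sq_nonneg s, pow_pos h0 3, pow_pos h0 4]

/-- The counterpart with `s = b - 1`, both sides being `1 + s` to first order. The term with `(1 / 3
- 2.38 * s) ^ 3` changes sign, hence the case distinction at `0.4`. -/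
theorem pow_six_lt_of_large {s : ℝ} (h0 : 0 < s) (h1 : s ≤ 0.634) :
    (1 + s / 6 - 1.5 * s ^ 2) ^ 6 < (1 + s) ^ 2 * (3 - (1 + s) ^ 2) / 2 := by
  have hu : (1 + s / 6 - 1.5 * s ^ 2) ^ 2 ≤ 1 + s / 3 - 2.38 * s ^ 2 := by
    have : 0 ≤ s ^ 2 * (0.59 + 0.5 * s - 2.25 * s ^ 2) := by
      have : 0 ≤ 0.59 + 0.5 * s - 2.25 * s ^ 2 := by nlinarith
      positivity
    nlinarith [sq_nonneg s]
  calc (1 + s / 6 - 1.5 * s ^ 2) ^ 6 = ((1 + s / 6 - 1.5 * s ^ 2) ^ 2) ^ 3 := by ring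
    _ ≤ (1 + s / 3 - 2.38 * s ^ 2) ^ 3 := pow_le_pow_left₀ (sq_nonneg _) hu 3
    _ < _ := by
      have h2 : 0 < s ^ 2 * (5.306 + 2.76 * s - 17.494 * s ^ 2 - s * (1 / 3 - 2.38 * s) ^ 3) := by
        have : 0 < 5.306 + 2.76 * s - 17.494 * s ^ 2 - s * (1 / 3 - 2.38 * s) ^ 3 := by
          rcases le_or_gt s 0.4 with hs | hs
          · have h3 : s * (1 / 3 - 2.38 * s) ^ 3 ≤ s / 27 := by
              have h4 : (1 / 3 - 2.38 * s) ^ 3 ≤ (1 / 3) ^ 3 :=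
                (Odd.strictMono_pow (by decide)).monotone (by linarith)
              nlinarith
            nlinarith
          · have h3 : 0.236 ≤ (2.38 * s - 1 / 3) ^ 3 := by
              have : (0.618 : ℝ) ^ 3 ≤ (2.38 * s - 1 / 3) ^ 3 :=
                (Odd.strictMono_pow (by decide)).monotone (by linarith)
              norm_num at this ⊢
              linarith
            have h5 : s * (1 / 3 - 2.38 * s) ^ 3 = -(s * (2.38 * s - 1 / 3) ^ 3) := by ring
            rw [h5]
            nlinarith
        positivity
      nlinarith [sq_nonneg s, pow_pos h0 3, pow_pos h0 4]

/-- The regular tetrahedron is the only maximum of the volume normalized functional. -/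
theorem ehr_pow_six_lt {b : ℝ} (h0 : 0 < b) (h1 : b < √3) (hb : b ≠ 1) (hpos : 0 < ehr b) :
    (ehr b / ehr 1) ^ 6 < b ^ 2 * (3 - b ^ 2) / 2 := by
  obtain ⟨hd1, hd2⟩ := defect_bounds
  have h3 := sq_lt_three h0 h1
  have he : 0 < ehr 1 := by rw [ehr_one]; linarith
  have hq : 0 ≤ ehr b / ehr 1 := by positivity
  rcases lt_or_ge b 0.6 with hs | hs
  · have h2 : ehr b / ehr 1 ≤ 1.455 * b := by
      rw [div_le_iff₀ he, ehr_one]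
      refine (ehr_le_linear h0.le h1).trans ?_
      nlinarith [pi_lt_d4]
    refine (pow_le_pow_left₀ hq h2 6).trans_lt ?_
    have h7 : b ^ 2 ≤ 0.36 := by nlinarith
    have h4 : b ^ 4 ≤ 0.36 * b ^ 2 := by nlinarith [sq_nonneg b]
    have h5 : b ^ 6 ≤ 0.1296 * b ^ 2 := by nlinarith [sq_nonneg b, pow_pos h0 4]
    have h6 := pow_pos h0 2
    have : (1.455 * b) ^ 6 = 1.455 ^ 6 * b ^ 6 := by ring
    rw [this]
    norm_num
    nlinarith
  rcases lt_or_gt_of_ne hb with hb | hb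
  · have h2 : ehr b / ehr 1 ≤ 1 - (1 - b) / 6 - 0.8 * (1 - b) ^ 2 := by
      rw [div_le_iff₀ he, ehr_one]
      refine (ehr_le_of_le_one h0 hb.le).trans ?_
      -- The case boundary `0.6` is the least value for which this works with `defect ≤ 0.13`: `0.24
      -- * 2.6 = 4.8 * 0.13`.
      have : 0 ≤ (1 - b) ^ 2 * (0.24 * (b + 2) - 4.8 * defect) := by
        have : 0 ≤ 0.24 * (b + 2) - 4.8 * defect := by linarith
        positivity
      nlinarith
    refine (pow_le_pow_left₀ hq h2 6).trans_lt ?_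
    have := pow_six_lt_of_small (s := 1 - b) (by linarith) (by linarith)
    rwa [sub_sub_cancel] at this
  rcases le_or_gt b 1.634 with hs | hs
  · have h2 : ehr b / ehr 1 ≤ 1 + (b - 1) / 6 - 1.5 * (b - 1) ^ 2 := by
      rw [div_le_iff₀ he, ehr_one]
      refine (ehr_le_of_one_le hb.le h1).trans ?_
      nlinarith [sq_nonneg (b - 1)]
    refine (pow_le_pow_left₀ hq h2 6).trans_lt ?_
    have := pow_six_lt_of_large (s := b - 1) (by linarith) (by linarith)
    rwa [add_sub_cancel] at this
  · have h2 := ehr_le_of_large hs.le h1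
    -- Near `√3` the volume tends to zero, but `ehr` is already negative there: its positivity keeps
    -- `b` away from the degenerate end.
    have h4 : b < 1.7279 := by linarith
    have h5 : ehr b / ehr 1 ≤ 0.503 := by
      rw [div_le_iff₀ he, ehr_one]; linarith
    refine (pow_le_pow_left₀ hq h5 6).trans_lt ?_
    have h6 : 0.0143 * 2.66 ≤ (3 - b ^ 2) * b ^ 2 := by
      apply mul_le_mul <;> nlinarith
    norm_num at h6 ⊢
    linarith

end OneEdge

end

end PiecewiseFlat

namespace PiecewiseFlat

noncomputable section

open Real Filter Topology Asymptotics

/-! ### Second-order expansions -/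

/-- The quadratic Taylor polynomial `a₀ + a₁ (x - c) + a₂ (x - c) ^ 2` approximates `g` at `c`. -/
def HasTaylorTwo (g : ℝ → ℝ) (c a₀ a₁ a₂ : ℝ) : Prop :=
  (fun x => g x - (a₀ + a₁ * (x - c) + a₂ * (x - c) ^ 2)) =o[𝓝 c] fun x => (x - c) ^ 2

/-- Taylor's theorem in Peano's form: the derivative of the remainder is `o(x - c)` by
differentiability of `g'`, so the remainder is `o((x - c)²)`. The parameter `a` is half the second
derivative. -/
theorem hasTaylorTwo_of_hasDerivAt {g g' : ℝ → ℝ} {c a : ℝ}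
    (hg : ∀ᶠ x in 𝓝 c, HasDerivAt g (g' x) x) (hg' : HasDerivAt g' (2 * a) c) :
    HasTaylorTwo g c (g c) (g' c) a := by
  obtain ⟨ε, hε, hs⟩ := Metric.eventually_nhds_iff_ball.1 hg
  have hd : ∀ x ∈ Metric.ball c ε, HasDerivWithinAt
      (fun x => g x - (g c + g' c * (x - c) + a * (x - c) ^ 2))
      (g' x - g' c - (x - c) * (2 * a)) (Metric.ball c ε) x := fun x hx => by
    have h1 := (hasDerivAt_id' x).sub_const c
    exact ((hs x hx).sub (((h1.const_mul (g' c)).const_add (g c)).add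
      ((h1.pow 2).const_mul a))).hasDerivWithinAt.congr_deriv (by norm_num; ring)
  have ho : (fun x => g' x - g' c - (x - c) * (2 * a)) =o[𝓝 c] fun x => (x - c) ^ 1 := by
    simpa using hasDerivAt_iff_isLittleO.1 hg'
  have := (convex_ball c ε).isLittleO_pow_succ_real (Metric.mem_ball_self hε) hd
    (ho.mono nhdsWithin_le_nhds)
  rw [nhdsWithin_eq_nhds.2 (Metric.ball_mem_nhds c hε)] at this
  simpa [HasTaylorTwo] using this

/-- `f = c + l + q + o(r ^ 2)` along the filter `F`, where `l = O(r)` and `q = O(r ^ 2)`. -/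
structure HasExpansion {α : Type*} (F : Filter α) (r f : α → ℝ) (c : ℝ) (l q : α → ℝ) : Prop where
  linear : l =O[F] r
  quadratic : q =O[F] fun x => r x ^ 2
  remainder : (fun x => f x - (c + l x + q x)) =o[F] fun x => r x ^ 2

/-! ### Calculus of second-order expansions -/

namespace HasExpansion

variable {α : Type*} {F : Filter α} {r f f₁ f₂ l l' l₁ l₂ q q' q₁ q₂ : α → ℝ} {c c' c₁ c₂ : ℝ}

theorem congr (h : HasExpansion F r f c l q) (hc : c = c') (hl : ∀ x, l x = l' x)
    (hq : ∀ x, q x = q' x) : HasExpansion F r f c' l' q' := by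
  obtain rfl : l = l' := funext hl
  obtain rfl : q = q' := funext hq
  rwa [← hc]

theorem const (c : ℝ) : HasExpansion F r (fun _ => c) c (fun _ => 0) (fun _ => 0) :=
  ⟨isBigO_zero _ _, isBigO_zero _ _, by simp⟩

theorem const_add_linear (c : ℝ) (hl : l =O[F] r) :
    HasExpansion F r (fun x => c + l x) c l (fun _ => 0) :=
  ⟨hl, isBigO_zero _ _, by simp⟩

theorem add (h₁ : HasExpansion F r f₁ c₁ l₁ q₁) (h₂ : HasExpansion F r f₂ c₂ l₂ q₂) :
    HasExpansion F r (fun x => f₁ x + f₂ x) (c₁ + c₂) (fun x => l₁ x + l₂ x)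
      (fun x => q₁ x + q₂ x) :=
  ⟨h₁.linear.add h₂.linear, h₁.quadratic.add h₂.quadratic,
    (h₁.remainder.add h₂.remainder).congr_left fun x => by ring⟩

theorem const_mul (a : ℝ) (h : HasExpansion F r f c l q) :
    HasExpansion F r (fun x => a * f x) (a * c) (fun x => a * l x) (fun x => a * q x) :=
  ⟨h.linear.const_mul_left a, h.quadratic.const_mul_left a,
    (h.remainder.const_mul_left a).congr_left fun x => by ring⟩

theorem sub (h₁ : HasExpansion F r f₁ c₁ l₁ q₁) (h₂ : HasExpansion F r f₂ c₂ l₂ q₂) :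
    HasExpansion F r (fun x => f₁ x - f₂ x) (c₁ - c₂) (fun x => l₁ x - l₂ x)
      (fun x => q₁ x - q₂ x) :=
  ⟨h₁.linear.sub h₂.linear, h₁.quadratic.sub h₂.quadratic,
    (h₁.remainder.sub h₂.remainder).congr_left fun x => by ring⟩

theorem sum {ι : Type*} (s : Finset ι) {f : ι → α → ℝ} {c : ι → ℝ} {l q : ι → α → ℝ}
    (h : ∀ i, HasExpansion F r (f i) (c i) (l i) (q i)) :
    HasExpansion F r (fun x => ∑ i ∈ s, f i x) (∑ i ∈ s, c i) (fun x => ∑ i ∈ s, l i x)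
      (fun x => ∑ i ∈ s, q i x) := by
  induction s using Finset.induction_on with
  | empty => simpa using const 0
  | insert i s hi ih =>
    simp only [Finset.sum_insert hi]
    exact (h i).add ih

variable (hr : Tendsto r F (𝓝 0))
include hr

omit hr in
theorem isBigO_sq_of_tendsto (hr : Tendsto r F (𝓝 0)) : (fun x => r x ^ 2) =O[F] r := by
  have : (fun x => r x * r x) =O[F] fun x => r x * 1 :=
    (isBigO_refl r F).mul (hr.isBigO_one ℝ)
  simpa [sq] using this

theorem sub_const_isBigO (h : HasExpansion F r f c l q) : (fun x => f x - c) =O[F] r := by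
  have h2 := isBigO_sq_of_tendsto hr
  exact ((h.linear.add (h.quadratic.trans h2)).add (h.remainder.isBigO.trans h2)).congr_left
    fun x => by ring

theorem tendsto (h : HasExpansion F r f c l q) : Tendsto f F (𝓝 c) := by
  simpa using ((h.sub_const_isBigO hr).trans_tendsto hr).add_const c

theorem mul (h₁ : HasExpansion F r f₁ c₁ l₁ q₁) (h₂ : HasExpansion F r f₂ c₂ l₂ q₂) :
    HasExpansion F r (fun x => f₁ x * f₂ x) (c₁ * c₂) (fun x => c₁ * l₂ x + c₂ * l₁ x)
      (fun x => c₁ * q₂ x + c₂ * q₁ x + l₁ x * l₂ x) := by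
  have hr2 : (fun x => r x ^ 2) =o[F] fun _ => (1 : ℝ) := by
    rw [isLittleO_one_iff]
    simpa using hr.pow 2
  have hr1 : r =o[F] fun _ => (1 : ℝ) := (isLittleO_one_iff ℝ).2 hr
  refine ⟨(h₂.linear.const_mul_left _).add (h₁.linear.const_mul_left _),
    ((h₂.quadratic.const_mul_left _).add (h₁.quadratic.const_mul_left _)).add
      ((h₁.linear.mul h₂.linear).congr_right fun x => by ring), ?_⟩
  -- With remainders `R₁`, `R₂`, the error of the product is `l₁ q₂ + q₁ (f₂ - c₂) + R₁ f₂ + (c₁ +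
  -- l₁) R₂`; the four terms are treated in this order.
  have e1 : (fun x => l₁ x * q₂ x) =o[F] fun x => r x ^ 2 :=
    ((h₁.linear.trans_isLittleO hr1).mul_isBigO h₂.quadratic).congr_right fun x => by ring
  have e2 : (fun x => q₁ x * (f₂ x - c₂)) =o[F] fun x => r x ^ 2 :=
    (h₁.quadratic.mul_isLittleO ((h₂.sub_const_isBigO hr).trans_isLittleO hr1)).congr_right
      fun x => by ring
  have e3 : (fun x => (f₁ x - (c₁ + l₁ x + q₁ x)) * f₂ x) =o[F] fun x => r x ^ 2 :=
    (h₁.remainder.mul_isBigO ((h₂.tendsto hr).isBigO_one ℝ)).congr_right fun x => by ring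
  have e4 : (fun x => (c₁ + l₁ x) * (f₂ x - (c₂ + l₂ x + q₂ x))) =o[F] fun x => r x ^ 2 := by
    have : (fun x => c₁ + l₁ x) =O[F] fun _ => (1 : ℝ) :=
      (isBigO_const_const c₁ one_ne_zero F).add (h₁.linear.trans hr1.isBigO)
    exact (this.mul_isLittleO h₂.remainder).congr_right fun x => by ring
  exact (((e1.add e2).add e3).add e4).congr_left fun x => by ring

theorem comp {g : ℝ → ℝ} {a₀ a₁ a₂ : ℝ} (hg : HasTaylorTwo g c a₀ a₁ a₂)
    (h : HasExpansion F r f c l q) :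
    HasExpansion F r (fun x => g (f x)) a₀ (fun x => a₁ * l x)
      (fun x => a₁ * q x + a₂ * l x ^ 2) := by
  have hr1 : r =o[F] fun _ => (1 : ℝ) := (isLittleO_one_iff ℝ).2 hr
  have hO := h.sub_const_isBigO hr
  refine ⟨h.linear.const_mul_left _, (h.quadratic.const_mul_left _).add
    ((h.linear.pow 2).const_mul_left _), ?_⟩
  have e1 : (fun x => g (f x) - (a₀ + a₁ * (f x - c) + a₂ * (f x - c) ^ 2)) =o[F]
      fun x => r x ^ 2 :=
    (hg.comp_tendsto (h.tendsto hr)).trans_isBigO (hO.pow 2)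
  -- The difference between `a₂ (f - c)²` and `a₂ l²`, a product of an `O(r²)` and an `o(1)` factor.
  have e2 : (fun x => a₂ * ((f x - c - l x) * (f x - c + l x))) =o[F] fun x => r x ^ 2 := by
    have hq : (fun x => f x - c - l x) =O[F] fun x => r x ^ 2 :=
      (h.quadratic.add h.remainder.isBigO).congr_left fun x => by ring
    exact ((hq.mul_isLittleO ((hO.add h.linear).trans_isLittleO hr1)).const_mul_left a₂).congr_right
      fun x => by ring
  exact ((e1.add (h.remainder.const_mul_left a₁)).add e2).congr_left fun x => by ring

omit hr in
/-- The second derivative test. -/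
theorem eventually_le (h : HasExpansion F r f c l q) (hl : ∀ᶠ x in F, l x = 0) {ε : ℝ}
    (hε : 0 < ε) (hq : ∀ᶠ x in F, q x ≤ -(ε * r x ^ 2)) : ∀ᶠ x in F, f x ≤ c := by
  filter_upwards [hl, hq, h.remainder.bound hε] with x h0 h1 h2
  rw [norm_eq_abs, norm_eq_abs, abs_of_nonneg (sq_nonneg (r x)), abs_le, h0] at h2
  linarith [h2.2]

end HasExpansion

/-- The base points of the three expansions are the values at the regular unit tetrahedron: `1 / 3`
is the cosine of the dihedral angle, `9` the product of two values of `heron`, and `4` the value of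
`cmPoly`. -/
theorem hasTaylorTwo_arccos :
    HasTaylorTwo arccos (1 / 3) (arccos (1 / 3)) (-(3 * √2 / 4)) (-(9 * √2 / 64)) := by
  have h2 : √2 ^ 2 = (2 : ℝ) := Real.sq_sqrt (by norm_num)
  have h2p : 0 < √(2 : ℝ) := by positivity
  have hs : √(1 - (1 / 3 : ℝ) ^ 2) = 2 * √2 / 3 := by
    rw [Real.sqrt_eq_iff_mul_self_eq_of_pos (by positivity)]
    linear_combination (4 / 9) * h2
  have hd : HasDerivAt (fun x => -(1 / √(1 - x ^ 2))) (2 * -(9 * √2 / 64)) (1 / 3) := by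
    have h1 : HasDerivAt (fun x : ℝ => 1 - x ^ 2) (-(2 * (1 / 3))) (1 / 3) :=
      ((hasDerivAt_pow 2 (1 / 3 : ℝ)).const_sub 1).congr_deriv (by norm_num)
    have h3 := ((h1.sqrt (by norm_num)).fun_inv (by rw [hs]; positivity)).neg
    simp only [one_div] at h3 ⊢
    refine h3.congr_deriv ?_
    rw [← one_div, hs]
    field_simp
    rw [show √2 ^ 4 = (√2 ^ 2) ^ 2 by ring, h2]
    norm_num
  have hg : ∀ᶠ x in 𝓝 (1 / 3 : ℝ), HasDerivAt arccos (-(1 / √(1 - x ^ 2))) x := by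
    filter_upwards [isOpen_Ioo.mem_nhds (show (1 / 3 : ℝ) ∈ Set.Ioo 0 1 by norm_num)] with x hx
    exact hasDerivAt_arccos (by linarith [hx.1]) (by linarith [hx.2])
  have := hasTaylorTwo_of_hasDerivAt hg hd
  rwa [hs, show -(1 / (2 * √2 / 3)) = -(3 * √2 / 4) by field_simp; rw [h2]; norm_num] at this

theorem hasTaylorTwo_inv_sqrt :
    HasTaylorTwo (fun x => (√x)⁻¹) 9 (1 / 3) (-(1 / 54)) (1 / 648) := by
  have hs : √(9 : ℝ) = 3 := by
    rw [show (9 : ℝ) = 3 ^ 2 by norm_num]; exact Real.sqrt_sq (by norm_num)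
  have hg : ∀ᶠ x in 𝓝 (9 : ℝ), HasDerivAt (fun x => (√x)⁻¹) (-(x⁻¹ * (√x)⁻¹ / 2)) x := by
    filter_upwards [lt_mem_nhds (show (0 : ℝ) < 9 by norm_num)] with x hx
    have hp := Real.sqrt_pos.2 hx
    have hq := Real.sq_sqrt hx.le
    refine ((Real.hasDerivAt_sqrt hx.ne').fun_inv hp.ne').congr_deriv ?_
    rw [hq]
    field_simp
  have hd : HasDerivAt (fun x => -(x⁻¹ * (√x)⁻¹ / 2)) (2 * (1 / 648)) 9 := by
    refine (((hasDerivAt_inv (show (9 : ℝ) ≠ 0 by norm_num)).mul hg.self_of_nhds).div_const 2).neg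
      |>.congr_deriv ?_
    rw [hs]
    norm_num
  have := hasTaylorTwo_of_hasDerivAt hg hd
  rw [hs] at this
  norm_num at this ⊢
  exact this

theorem hasTaylorTwo_sqrt : HasTaylorTwo (fun x => √x) 4 2 (1 / 4) (-(1 / 64)) := by
  have hs : √(4 : ℝ) = 2 := by
    rw [show (4 : ℝ) = 2 ^ 2 by norm_num]; exact Real.sqrt_sq (by norm_num)
  have hg : ∀ᶠ x in 𝓝 (4 : ℝ), HasDerivAt (fun x => √x) (1 / (2 * √x)) x := by
    filter_upwards [lt_mem_nhds (show (0 : ℝ) < 4 by norm_num)] with x hx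
    exact Real.hasDerivAt_sqrt hx.ne'
  have hd : HasDerivAt (fun x => 1 / (2 * √x)) (2 * -(1 / 64)) 4 := by
    have := ((hg.self_of_nhds.const_mul 2).fun_inv (by rw [hs]; norm_num))
    simp only [one_div] at this ⊢
    refine this.congr_deriv ?_
    rw [hs]
    norm_num
  have := hasTaylorTwo_of_hasDerivAt hg hd
  rw [hs] at this
  norm_num at this ⊢
  exact this

/-! ### The regular tetrahedron -/

section

variable {α : Type*} {F : Filter α} {r : α → ℝ} (hr : Tendsto r F (𝓝 0))
  {a b c d e f : α → ℝ} (ha : a =O[F] r) (hb : b =O[F] r) (hc : c =O[F] r) (hd : d =O[F] r)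
  (he : e =O[F] r) (hf : f =O[F] r)
include hr

theorem HasExpansion.one_add_sq (ha : a =O[F] r) :
    HasExpansion F r (fun x => (1 + a x) ^ 2) 1 (fun x => 2 * a x) (fun x => a x ^ 2) := by
  have h := HasExpansion.const_add_linear 1 ha
  have := (h.mul hr h).congr (c' := 1) (l' := fun x => 2 * a x) (q' := fun x => a x ^ 2)
    (by ring) (fun x => by ring) (fun x => by ring)
  simpa only [← sq] using this

theorem HasExpansion.heron (ha : a =O[F] r) (hb : b =O[F] r) (hc : c =O[F] r) :
    HasExpansion F r (fun x => heron ((1 + a x) ^ 2) ((1 + b x) ^ 2) ((1 + c x) ^ 2)) 3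
      (fun x => 4 * (a x + b x + c x))
      (fun x => 8 * (a x * b x + b x * c x + c x * a x) - 2 * (a x ^ 2 + b x ^ 2 + c x ^ 2)) := by
  have A := one_add_sq hr ha
  have B := one_add_sq hr hb
  have C := one_add_sq hr hc
  have := ((((((A.const_mul 2).mul hr B).add ((B.const_mul 2).mul hr C)).add
    ((C.const_mul 2).mul hr A)).sub (A.mul hr A)).sub (B.mul hr B)).sub (C.mul hr C)
  simp only [PiecewiseFlat.heron]
  simp only [sq (((1 : ℝ) + _) ^ 2)]
  exact this.congr (by ring) (fun x => by ring) (fun x => by ring)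

include ha hb hc hd he hf

theorem HasExpansion.hinge :
    HasExpansion F r (fun x => hinge ((1 + a x) ^ 2) ((1 + b x) ^ 2) ((1 + c x) ^ 2)
        ((1 + d x) ^ 2) ((1 + e x) ^ 2) ((1 + f x) ^ 2)) 1
      (fun x => 2 * (b x + c x + d x + e x) - 4 * f x)
      (fun x => -4 * a x ^ 2 + 4 * a x * (b x + c x + d x + e x) - 8 * a x * f x + b x ^ 2 + c x ^ 2
        + d x ^ 2 + e x ^ 2 - 4 * b x * c x + 4 * b x * e x + 4 * c x * d x - 4 * d x * e x
        - 2 * f x ^ 2) := by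
  have A := one_add_sq hr ha
  have B := one_add_sq hr hb
  have C := one_add_sq hr hc
  have D := one_add_sq hr hd
  have E := one_add_sq hr he
  have G := one_add_sq hr hf
  have := ((A.const_mul 2).mul hr ((B.add C).sub G)).sub
    (((A.add B).sub D).mul hr ((A.add C).sub E))
  simp only [PiecewiseFlat.hinge]
  exact this.congr (by ring) (fun x => by ring) (fun x => by ring)

theorem HasExpansion.cmPoly :
    HasExpansion F r (fun x => cmPoly ((1 + a x) ^ 2) ((1 + b x) ^ 2) ((1 + c x) ^ 2)
        ((1 + d x) ^ 2) ((1 + e x) ^ 2) ((1 + f x) ^ 2)) 4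
      (fun x => 4 * (a x + b x + c x + d x + e x + f x))
      (fun x => 4 * (a x + b x + c x + d x + e x + f x) ^ 2
        - 10 * (a x ^ 2 + b x ^ 2 + c x ^ 2 + d x ^ 2 + e x ^ 2 + f x ^ 2)
        - 8 * (a x * f x + b x * e x + c x * d x)) := by
  have A := one_add_sq hr ha
  have B := one_add_sq hr hb
  have C := one_add_sq hr hc
  have D := one_add_sq hr hd
  have E := one_add_sq hr he
  have G := one_add_sq hr hf
  have h1 := (A.add B).sub D
  have h2 := (A.add C).sub E
  have h3 := (B.add C).sub G
  have := (((((((A.const_mul 8).mul hr B).mul hr C)).add (((h1.const_mul 2).mul hr h2).mul hr h3)).sub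
    ((A.const_mul 2).mul hr (h3.mul hr h3))).sub ((B.const_mul 2).mul hr (h2.mul hr h2))).sub
    ((C.const_mul 2).mul hr (h1.mul hr h1))
  simp only [PiecewiseFlat.cmPoly]
  simp only [sq (_ - ((1 : ℝ) + _) ^ 2)]
  exact (this.congr (by ring) (fun x => by ring) (fun x => by ring))

theorem HasExpansion.volOf :
    HasExpansion F r (fun x => Triangulation.volOf (1 + a x) (1 + b x) (1 + c x) (1 + d x) (1 + e x) (1 + f x))
      (√2 / 12 * 1) (fun x => √2 / 12 * ((a x + b x + c x + d x + e x + f x) / 2))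
      (fun x => √2 / 12 * (3 / 8 * (a x + b x + c x + d x + e x + f x) ^ 2
        - 5 / 4 * (a x ^ 2 + b x ^ 2 + c x ^ 2 + d x ^ 2 + e x ^ 2 + f x ^ 2)
        - (a x * f x + b x * e x + c x * d x))) := by
  have h := ((cmPoly hr ha hb hc hd he hf).comp hr hasTaylorTwo_sqrt).const_mul (√2 / 24)
  have h2 : √(288 : ℝ) = 12 * √2 := by
    rw [show (288 : ℝ) = 12 ^ 2 * 2 by norm_num, Real.sqrt_mul (by norm_num),
      Real.sqrt_sq (by norm_num)]
  have h3 : √2 ^ 2 = (2 : ℝ) := Real.sq_sqrt (by norm_num)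
  have : ∀ t : ℝ, √(t / 288) = √2 / 24 * √t := by
    intro t
    rw [Real.sqrt_div' _ (by norm_num), h2]
    field_simp
    rw [h3]
    ring
  simp only [Triangulation.volOf, this]
  exact h.congr (by ring) (fun x => by ring) (fun x => by ring)

theorem HasExpansion.tetAngle :
    HasExpansion F r (fun x => tetAngle (1 + a x) (1 + b x) (1 + c x) (1 + d x) (1 + e x) (1 + f x))
      (arccos (1 / 3)) (fun x => √2 * ((a x - b x - c x - d x - e x) / 3 + f x))
      (fun x => √2 * (13 / 36 * a x ^ 2 - 7 / 18 * a x * (b x + c x + d x + e x)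
        + (a x * f x - (b x + c x + d x + e x) * f x - b x * e x - c x * d x) / 2
        - 7 / 36 * (b x ^ 2 + c x ^ 2 + d x ^ 2 + e x ^ 2) + 3 / 2 * (b x * c x + d x * e x)
        + 11 / 18 * (b x * d x + c x * e x) + f x ^ 2 / 4)) := by
  have h1 := ((heron hr ha hb hd).mul hr (heron hr ha hc he)).congr (c' := 9)
    (l' := fun x => 24 * a x + 12 * (b x + c x + d x + e x))
    (q' := fun x => 4 * a x ^ 2 + 40 * a x * (b x + c x + d x + e x)
      - 6 * (b x ^ 2 + c x ^ 2 + d x ^ 2 + e x ^ 2) + 16 * (b x * c x + b x * e x + c x * d x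
      + d x * e x) + 24 * (b x * d x + c x * e x)) (by norm_num) (fun x => by ring)
      (fun x => by ring)
  have h2 := ((hinge hr ha hb hc hd he hf).mul hr (h1.comp hr hasTaylorTwo_inv_sqrt)).congr
    (c' := 1 / 3) (l' := fun x => 4 / 9 * (-a x + b x + c x + d x + e x - 3 * f x))
    (q' := fun x => 2 / 27 * (-7 * a x ^ 2 + 8 * a x * (b x + c x + d x + e x) - 12 * a x * f x
      + 3 * (b x ^ 2 + c x ^ 2 + d x ^ 2 + e x ^ 2) - 28 * (b x * c x + d x * e x)
      - 12 * (b x * d x + c x * e x) + 8 * (b x * e x + c x * d x)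
      + 12 * (b x + c x + d x + e x) * f x - 9 * f x ^ 2)) (by norm_num) (fun x => by ring)
      (fun x => by ring)
  have h3 := (h2.comp hr hasTaylorTwo_arccos).congr (c' := arccos (1 / 3))
    (l' := fun x => √2 * ((a x - b x - c x - d x - e x) / 3 + f x))
      (q' := (fun x => √2 * (13 / 36 * a x ^ 2 - 7 / 18 * a x * (b x + c x + d x + e x)
        + (a x * f x - (b x + c x + d x + e x) * f x - b x * e x - c x * d x) / 2
        - 7 / 36 * (b x ^ 2 + c x ^ 2 + d x ^ 2 + e x ^ 2) + 3 / 2 * (b x * c x + d x * e x)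
        + 11 / 18 * (b x * d x + c x * e x) + f x ^ 2 / 4))) rfl (fun x => by ring)
      (fun x => by ring)
  -- Merging the two square roots in `edgeAngle` into one needs a sign, which holds close to the
  -- regular tetrahedron.
  have h0 : ∀ᶠ x in F, 0 < PiecewiseFlat.heron ((1 + a x) ^ 2) ((1 + b x) ^ 2) ((1 + d x) ^ 2) :=
    ((heron hr ha hb hd).tendsto hr).eventually (lt_mem_nhds (by norm_num))
  refine ⟨h3.linear, h3.quadratic, h3.remainder.congr' ?_ EventuallyEq.rfl⟩
  filter_upwards [h0] with x hx
  simp only [PiecewiseFlat.tetAngle, edgeAngle, div_eq_mul_inv, Real.sqrt_mul hx.le]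

/-- That the linear part is just the common angle times the total change of length is Schläfli's
formula to first order. -/
theorem HasExpansion.angleSum :
    HasExpansion F r (fun x => Triangulation.angleSum (1 + a x) (1 + b x) (1 + c x) (1 + d x) (1 + e x) (1 + f x))
      (6 * arccos (1 / 3)) (fun x => arccos (1 / 3) * (a x + b x + c x + d x + e x + f x))
      (fun x => √2 * ((a x ^ 2 + b x ^ 2 + c x ^ 2 + d x ^ 2 + e x ^ 2 + f x ^ 2) / 3
        + 4 / 3 * (a x * f x + b x * e x + c x * d x)
        - (a x + b x + c x + d x + e x + f x) ^ 2 / 6)) := by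
  have h1 := (tetAngle hr ha hb hc hd he hf).mul hr (const_add_linear 1 ha)
  have h2 := (tetAngle hr hb ha hc hd hf he).mul hr (const_add_linear 1 hb)
  have h3 := (tetAngle hr hc ha hb he hf hd).mul hr (const_add_linear 1 hc)
  have h4 := (tetAngle hr hd ha he hb hf hc).mul hr (const_add_linear 1 hd)
  have h5 := (tetAngle hr he ha hd hc hf hb).mul hr (const_add_linear 1 he)
  have h6 := (tetAngle hr hf hb hd hc he ha).mul hr (const_add_linear 1 hf)
  exact (((((h1.add h2).add h3).add h4).add h5).add h6).congr (by ring) (fun x => by ring)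
    (fun x => by ring)

end

end

end PiecewiseFlat

namespace PiecewiseFlat

noncomputable section

open Real Filter Topology Asymptotics Triangulation

/-! ### Homogeneity and symmetry of the functionals of one tetrahedron -/

theorem tetAngle_mul {s : ℝ} (hs : 0 < s) (a b c d e f : ℝ) :
    tetAngle (s * a) (s * b) (s * c) (s * d) (s * e) (s * f) = tetAngle a b c d e f := by
  have h : ∀ x y z, √(heron ((s * x) ^ 2) ((s * y) ^ 2) ((s * z) ^ 2)) =
      s ^ 2 * √(heron (x ^ 2) (y ^ 2) (z ^ 2)) := by
    intro x y z
    rw [show heron ((s * x) ^ 2) ((s * y) ^ 2) ((s * z) ^ 2) =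
      (s ^ 2) ^ 2 * heron (x ^ 2) (y ^ 2) (z ^ 2) by unfold heron; ring,
      Real.sqrt_mul (by positivity), Real.sqrt_sq (by positivity)]
  rw [tetAngle, tetAngle, edgeAngle, edgeAngle, h, h, show hinge ((s * a) ^ 2) ((s * b) ^ 2)
    ((s * c) ^ 2) ((s * d) ^ 2) ((s * e) ^ 2) ((s * f) ^ 2) =
    s ^ 4 * hinge (a ^ 2) (b ^ 2) (c ^ 2) (d ^ 2) (e ^ 2) (f ^ 2) by unfold hinge; ring,
    show ∀ u v : ℝ, s ^ 2 * u * (s ^ 2 * v) = s ^ 4 * (u * v) from fun u v => by ring,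
    mul_div_mul_left _ _ (by positivity)]

theorem angleSum_mul {s : ℝ} (hs : 0 < s) (a b c d e f : ℝ) :
    angleSum (s * a) (s * b) (s * c) (s * d) (s * e) (s * f) = s * angleSum a b c d e f := by
  simp only [angleSum, tetAngle_mul hs]
  ring

theorem volOf_mul {s : ℝ} (hs : 0 < s) (a b c d e f : ℝ) :
    volOf (s * a) (s * b) (s * c) (s * d) (s * e) (s * f) = s ^ 3 * volOf a b c d e f := by
  rw [volOf, volOf, show cmPoly ((s * a) ^ 2) ((s * b) ^ 2) ((s * c) ^ 2) ((s * d) ^ 2) ((s * e) ^ 2)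
    ((s * f) ^ 2) / 288 = (s ^ 3) ^ 2 * (cmPoly (a ^ 2) (b ^ 2) (c ^ 2) (d ^ 2) (e ^ 2) (f ^ 2) / 288)
    by unfold cmPoly; ring, Real.sqrt_mul (by positivity), Real.sqrt_sq (by positivity)]

/-- Invariance of a function of the six edge lengths of a tetrahedron under the relabelings of its
vertices. -/
structure IsSymmetric {α : Type*} (F : ℝ → ℝ → ℝ → ℝ → ℝ → ℝ → α) : Prop where
  first : ∀ a b c d e f, F a d e b c f = F a b c d e f
  middle : ∀ a b c d e f, F b a c d f e = F a b c d e f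
  last : ∀ a b c d e f, F a c b e d f = F a b c d e f

/-- Relabelings act transitively on the six edges, so the position of the exceptional edge is
immaterial. -/
theorem IsSymmetric.eq_of_exceptional {α : Type*} {F : ℝ → ℝ → ℝ → ℝ → ℝ → ℝ → α}
    (h : IsSymmetric F) (a b : ℝ) (c : Fin 6) :
    F (Function.update (fun _ => a) c b 0) (Function.update (fun _ => a) c b 1)
      (Function.update (fun _ => a) c b 2) (Function.update (fun _ => a) c b 3)
      (Function.update (fun _ => a) c b 4) (Function.update (fun _ => a) c b 5) =
    F b a a a a a := by
  have h1 : F a b a a a a = F b a a a a a := h.middle b a a a a a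
  have h2 : F a a b a a a = F b a a a a a := (h.last a b a a a a).trans h1
  have h3 : F a a a b a a = F b a a a a a := (h.first a b a a a a).trans h1
  have h4 : F a a a a b a = F b a a a a a := (h.first a a b a a a).trans h2
  have h5 : F a a a a a b = F b a a a a a := (h.middle a a a a b a).trans h4
  fin_cases c <;> simp [h1, h2, h3, h4, h5]

theorem isSymmetric_angleSum : IsSymmetric angleSum := by
  have e1 : ∀ a b c d e f, tetAngle a d e b c f = tetAngle a b c d e f := fun a b c d e f =>
    edgeAngle_swap_first _ _ _ _ _ _
  have e2 : ∀ a b c d e f, tetAngle a c b e d f = tetAngle a b c d e f := fun a b c d e f =>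
    edgeAngle_swap_last _ _ _ _ _ _
  refine ⟨fun a b c d e f => ?_, fun a b c d e f => ?_, fun a b c d e f => ?_⟩
  · unfold angleSum
    rw [e1 a b c d e f, e2 f b d c e a]
    ring
  · unfold angleSum
    rw [e2 c a b e f d, e1 d a e b f c]
    ring
  · unfold angleSum
    rw [e2 a b c d e f, e1 f b d c e a]
    ring

theorem isSymmetric_volOf : IsSymmetric volOf := by
  refine ⟨fun a b c d e f => ?_, fun a b c d e f => ?_, fun a b c d e f => ?_⟩ <;>
  · unfold volOf cmPoly
    congr 2
    ring

theorem isSymmetric_isNondegenerate : IsSymmetric IsNondegenerate :=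
  ⟨fun _ _ _ _ _ _ => propext ⟨.swap_first, .swap_first⟩,
    fun _ _ _ _ _ _ => propext ⟨.swap_middle, .swap_middle⟩,
    fun _ _ _ _ _ _ => propext ⟨.swap_last, .swap_last⟩⟩

/-- The Cayley-Menger determinant factors as `2 a² b² (3 a² - b²)`. -/
theorem IsNondegenerate.lt_sqrt_three_mul {a b : ℝ} (h : IsNondegenerate b a a a a a) :
    b < √3 * a := by
  have ha := h.b_pos
  have hb := h.a_pos
  have hv := h.vol
  rw [show cmPoly (b ^ 2) (a ^ 2) (a ^ 2) (a ^ 2) (a ^ 2) (a ^ 2) =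
    2 * (b ^ 2 * a ^ 2) * (3 * a ^ 2 - b ^ 2) by unfold cmPoly; ring] at hv
  have h3 := (pos_iff_pos_of_mul_pos hv).1 (by positivity)
  refine lt_of_pow_lt_pow_left₀ 2 (by positivity) ?_
  rw [mul_pow, Real.sq_sqrt (by norm_num)]
  linarith

theorem volOf_exceptional {a b : ℝ} (ha : 0 < a) (hb : 0 < b) :
    volOf b a a a a a = a * b * √(3 * a ^ 2 - b ^ 2) / 12 := by
  rw [volOf, show cmPoly (b ^ 2) (a ^ 2) (a ^ 2) (a ^ 2) (a ^ 2) (a ^ 2) / 288 =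
    (a * b / 12) ^ 2 * (3 * a ^ 2 - b ^ 2) by unfold cmPoly; ring, Real.sqrt_mul (by positivity),
    Real.sqrt_sq (by positivity)]
  ring

theorem angleSum_exceptional {b : ℝ} (h0 : 0 < b) (h1 : b < √3) :
    angleSum b 1 1 1 1 1 = OneEdge.weighted b := by
  have h3 := OneEdge.sq_lt_three h0 h1
  have h4 : 0 < 4 - b ^ 2 := by linarith
  have hs3 : √3 * √3 = (3 : ℝ) := Real.mul_self_sqrt (by norm_num)
  have q1 : heron (b ^ 2) 1 1 = b ^ 2 * (4 - b ^ 2) := by unfold heron; ring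
  have q2 : heron 1 (b ^ 2) 1 = b ^ 2 * (4 - b ^ 2) := by unfold heron; ring
  have q3 : heron 1 1 (b ^ 2) = b ^ 2 * (4 - b ^ 2) := by unfold heron; ring
  have q4 : heron 1 1 1 = 3 := by norm_num [heron]
  have hs : √(b ^ 2 * (4 - b ^ 2)) = b * √(4 - b ^ 2) := by
    rw [Real.sqrt_mul (by positivity), Real.sqrt_sq h0.le]
  have hq : √(4 - b ^ 2) * √(4 - b ^ 2) = 4 - b ^ 2 := Real.mul_self_sqrt h4.le
  have hqp := Real.sqrt_pos.2 h4
  have t0 : tetAngle b 1 1 1 1 1 = OneEdge.angle b := by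
    rw [tetAngle, edgeAngle, one_pow, q1, hs, OneEdge.angle, mul_mul_mul_comm, hq]
    congr 1
    unfold hinge
    field_simp
    ring
  have t5 : tetAngle 1 1 1 1 1 b = OneEdge.angleOpp b := by
    rw [tetAngle, edgeAngle, one_pow, q4, hs3, OneEdge.angleOpp]
    congr 1
    unfold hinge
    ring
  have t1 : tetAngle 1 b 1 1 1 1 = OneEdge.angleAdj b := by
    rw [tetAngle, edgeAngle, one_pow, q2, q4, hs, OneEdge.angleAdj]
    congr 1
    unfold hinge
    field_simp
    ring
  unfold angleSum OneEdge.weighted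
  simp only [t0, t1, t5]
  ring

/-! ### The functionals on the invariant metrics -/

namespace Icosian

/-- The Einstein-Hilbert-Regge functional per vertex in terms of the lengths of the edge types. -/
def ehrOf (x : Fin 6 → ℝ) : ℝ := 2 * π * ∑ i, x i - (∑ m, onLab angleSum x m) / 4

/-- The volume per vertex in terms of the lengths of the edge types. -/
def volumeOf (x : Fin 6 → ℝ) : ℝ := (∑ m, onLab volOf x m) / 4

theorem ehrOf_smul {s : ℝ} (hs : 0 < s) (x : Fin 6 → ℝ) : ehrOf (s • x) = s * ehrOf x := by
  simp only [ehrOf, onLab, Pi.smul_apply, smul_eq_mul, angleSum_mul hs, ← Finset.mul_sum]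
  ring

theorem volumeOf_smul {s : ℝ} (hs : 0 < s) (x : Fin 6 → ℝ) :
    volumeOf (s • x) = s ^ 3 * volumeOf x := by
  simp only [volumeOf, onLab, Pi.smul_apply, smul_eq_mul, volOf_mul hs, ← Finset.mul_sum]
  ring

/-- The labels of a tetrahedron form a permutation of the six types by `lab_injective`, so type `k`
occurs on exactly one edge. -/
theorem onLab_update {α : Type*} {F : ℝ → ℝ → ℝ → ℝ → ℝ → ℝ → α} (hF : IsSymmetric F) (a b : ℝ)
    (k : Fin 6) (m : Fin 20) : onLab F (Function.update (fun _ => a) k b) m = F b a a a a a := by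
  obtain ⟨c, rfl⟩ := Finite.surjective_of_injective (fun c c' h => lab_injective m c c' h) k
  rw [← hF.eq_of_exceptional a b c]
  have h : ∀ c', lab m c' = lab m c ↔ c' = c := fun c' => ⟨lab_injective m c' c, congrArg _⟩
  simp only [onLab, Function.update_apply, h]

theorem ehrOf_update {b : ℝ} (h0 : 0 < b) (h1 : b < √3) (k : Fin 6) :
    ehrOf (Function.update (fun _ => 1) k b) = OneEdge.ehr b := by
  simp only [ehrOf, onLab_update isSymmetric_angleSum, angleSum_exceptional h0 h1]
  rw [Finset.sum_update_of_mem (Finset.mem_univ k)]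
  simp [Finset.card_sdiff, OneEdge.ehr]
  ring

theorem volumeOf_update {b : ℝ} (h0 : 0 < b) (k : Fin 6) :
    volumeOf (Function.update (fun _ => 1) k b) = 5 * (b * √(3 - b ^ 2)) / 12 := by
  simp only [volumeOf, onLab_update isSymmetric_volOf, volOf_exceptional one_pos h0]
  simp
  ring

theorem ehrOf_one : ehrOf (fun _ => 1) = 6 * OneEdge.defect := by
  have := ehrOf_update one_pos OneEdge.one_lt_sqrt_three 0
  rwa [OneEdge.ehr_one, Function.update_eq_self_iff.2 rfl] at this

theorem volumeOf_one : volumeOf (fun _ => 1) = 5 * √2 / 12 := by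
  have := volumeOf_update one_pos 0
  rw [Function.update_eq_self_iff.2 rfl] at this
  rw [this]
  norm_num

/-! ### Second-order expansions at the regular metric -/

section
variable {F : Filter (Fin 6 → ℝ)} (hF : Tendsto (fun h : Fin 6 → ℝ => ‖h‖) F (𝓝 0))
include hF

omit hF in
theorem isBigO_apply (i : Fin 6) : (fun h : Fin 6 → ℝ => h i) =O[F] fun h => ‖h‖ :=
  IsBigO.of_bound 1 (.of_forall fun h => by simpa using norm_le_pi_norm h i)

/-- Although the labelings differ, summing over the twenty tetrahedra leaves a quadratic form in `∑
h i` and `∑ h i ^ 2` alone; the same happens for `ehrOf`. -/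
theorem hasExpansion_volumeOf : HasExpansion F (fun h => ‖h‖) (fun h => volumeOf (1 + h))
    (5 * √2 / 12) (fun h => 5 * √2 / 24 * ∑ i, h i)
    (fun h => √2 / 48 * (11 / 2 * (∑ i, h i) ^ 2 - 23 * ∑ i, h i ^ 2)) := by
  have h := (HasExpansion.sum Finset.univ fun m : Fin 20 => HasExpansion.volOf hF
    (isBigO_apply (lab m 0)) (isBigO_apply (lab m 1)) (isBigO_apply (lab m 2))
    (isBigO_apply (lab m 3)) (isBigO_apply (lab m 4)) (isBigO_apply (lab m 5))).const_mul
    (1 / 4)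
  have h' := h.congr (c' := 5 * √2 / 12) (l' := fun h => 5 * √2 / 24 * ∑ i, h i)
    (q' := fun h => √2 / 48 * (11 / 2 * (∑ i, h i) ^ 2 - 23 * ∑ i, h i ^ 2))
    (by simp; ring) (fun x => by simp [Fin.sum_univ_succ, lab, labTable]; ring)
    (fun x => by simp [Fin.sum_univ_succ, lab, labTable]; ring)
  refine ⟨h'.1, h'.2, h'.3.congr_left fun x => ?_⟩
  simp only [volumeOf, onLab, Pi.add_apply, Pi.one_apply]
  ring

theorem hasExpansion_ehrOf : HasExpansion F (fun h => ‖h‖) (fun h => ehrOf (1 + h))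
    (6 * OneEdge.defect) (fun h => OneEdge.defect * ∑ i, h i)
    (fun h => √2 * ((∑ i, h i) ^ 2 / 6 - ∑ i, h i ^ 2)) := by
  have h := (HasExpansion.sum Finset.univ fun m : Fin 20 => HasExpansion.angleSum hF
    (isBigO_apply (lab m 0)) (isBigO_apply (lab m 1)) (isBigO_apply (lab m 2))
    (isBigO_apply (lab m 3)) (isBigO_apply (lab m 4)) (isBigO_apply (lab m 5))).const_mul
    (1 / 4)
  have hl := (HasExpansion.sum Finset.univ fun i : Fin 6 =>
    HasExpansion.const_add_linear (F := F) 1 (isBigO_apply i)).const_mul (2 * π)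
  have h' := (hl.sub h).congr (c' := 6 * OneEdge.defect) (l' := fun h => OneEdge.defect * ∑ i, h i)
    (q' := fun h => √2 * ((∑ i, h i) ^ 2 / 6 - ∑ i, h i ^ 2))
    (by simp [OneEdge.defect]; ring)
    (fun x => by simp [Fin.sum_univ_succ, lab, labTable, OneEdge.defect]; ring)
    (fun x => by simp [Fin.sum_univ_succ, lab, labTable]; ring)
  refine ⟨h'.1, h'.2, h'.3.congr_left fun x => ?_⟩
  simp only [ehrOf, onLab, Pi.add_apply, Pi.one_apply]
  ring

omit hF in
theorem norm_sq_le_sum_sq (h : Fin 6 → ℝ) : ‖h‖ ^ 2 ≤ ∑ i, h i ^ 2 := by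
  have : ‖h‖ ≤ √(∑ i, h i ^ 2) := by
    refine (pi_norm_le_iff_of_nonneg (Real.sqrt_nonneg _)).2 fun i => ?_
    rw [norm_eq_abs]
    exact Real.abs_le_sqrt (Finset.single_le_sum (f := fun i => h i ^ 2)
      (fun i _ => sq_nonneg _) (Finset.mem_univ i))
  calc ‖h‖ ^ 2 ≤ √(∑ i, h i ^ 2) ^ 2 := pow_le_pow_left₀ (norm_nonneg _) this 2
    _ = _ := Real.sq_sqrt (Finset.sum_nonneg fun i _ => sq_nonneg _)

variable (hs : ∀ᶠ h in F, ∑ i, h i = 0)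
include hs

/-- On `∑ h i = 0` the linear term disappears and the quadratic one is `-√2 ∑ h i ^ 2`. -/
theorem eventually_ehrOf_le : ∀ᶠ h in F, ehrOf (1 + h) ≤ 6 * OneEdge.defect := by
  refine (hasExpansion_ehrOf hF).eventually_le (ε := 1) (hs.mono fun h h0 => by simp [h0]) one_pos
    (hs.mono fun h h0 => ?_)
  have h1 := norm_sq_le_sum_sq h
  have h2 : 1 ≤ √(2 : ℝ) := by rw [Real.one_le_sqrt]; norm_num
  simp only [h0]
  nlinarith [sq_nonneg ‖h‖]

/-- Comparison of `VEHR` with the cube root removed. On `∑ h i = 0` the quadratic term of the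
difference is `(6 * defect)²` times `23 / 8 * √2 * defect - 5 / 2` times the sum of squares. -/
theorem eventually_ehrOf_pow_le : ∀ᶠ h in F, ehrOf (1 + h) ^ 3 * (5 * √2 / 12) ≤
    (6 * OneEdge.defect) ^ 3 * volumeOf (1 + h) := by
  have hE := hasExpansion_ehrOf hF
  have h := ((((hE.mul hF hE).mul hF hE).const_mul (5 * √2 / 12)).sub
    ((hasExpansion_volumeOf hF).const_mul ((6 * OneEdge.defect) ^ 3)))
  obtain ⟨hd1, hd2⟩ := OneEdge.defect_bounds
  have h2 : √2 ^ 2 = (2 : ℝ) := Real.sq_sqrt (by norm_num)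
  have h3 : √(2 : ℝ) < 1.5 := by rw [Real.sqrt_lt' (by norm_num)]; norm_num
  refine (h.eventually_le (ε := (6 * OneEdge.defect) ^ 2) (hs.mono fun h h0 => by simp [h0])
    (by positivity) (hs.mono fun h h0 => ?_)).mono fun x hx => ?_
  · have h1 := norm_sq_le_sum_sq h
    simp only [h0]
    have h4 : 0 ≤ (6 * OneEdge.defect) ^ 2 * (∑ i, h i ^ 2 - ‖h‖ ^ 2) :=
      mul_nonneg (sq_nonneg _) (sub_nonneg.2 h1)
    -- Of the `5 / 2`, one unit is spent on `ε`; the remaining `3 / 2` dominates since the defect is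
    -- at most `0.13`.
    have h5 : 0 ≤ (6 * OneEdge.defect) ^ 2 * (∑ i, h i ^ 2) *
        (3 / 2 - 23 / 8 * √2 * OneEdge.defect) := by
      refine mul_nonneg (mul_nonneg (sq_nonneg _) (Finset.sum_nonneg fun i _ => sq_nonneg _)) ?_
      nlinarith
    refine le_of_sub_nonneg (le_of_le_of_eq (add_nonneg h4 h5) ?_)
    linear_combination (-45 * OneEdge.defect ^ 2 * ∑ i, h i ^ 2) * h2
  · have : (5 : ℝ) * √2 / 12 * (6 * OneEdge.defect * (6 * OneEdge.defect) * (6 * OneEdge.defect)) -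
      (6 * OneEdge.defect) ^ 3 * (5 * √2 / 12) = 0 := by ring
    linarith

end

end Icosian

end

end PiecewiseFlat

namespace PiecewiseFlat

noncomputable section

open Real Filter Topology Triangulation

namespace Icosian

/-! ### Comparison of the normalized functionals -/

theorem card_pos : (0 : ℝ) < Fintype.card icosians :=
  Nat.cast_pos.2 (Fintype.card_pos_iff.2 ⟨1⟩)

theorem cbrt_mul_pow_three (a : ℝ) {v : ℝ} (hv : 0 ≤ v) : (a * v ^ (1 / 3 : ℝ)) ^ 3 = a ^ 3 * v := by
  rw [mul_pow, ← Real.rpow_natCast (v ^ (1 / 3 : ℝ)), ← Real.rpow_mul hv]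
  norm_num

/-- Cubing is strictly increasing on all of `ℝ`, so the signs of `a` and `b` play no role. -/
theorem div_cbrt_le_div_cbrt_iff {a b v w : ℝ} (hv : 0 < v) (hw : 0 < w) :
    a / v ^ (1 / 3 : ℝ) ≤ b / w ^ (1 / 3 : ℝ) ↔ a ^ 3 * w ≤ b ^ 3 * v := by
  rw [div_le_div_iff₀ (by positivity) (by positivity), ← cbrt_mul_pow_three a hw.le,
    ← cbrt_mul_pow_three b hv.le]
  exact (Odd.strictMono_pow (by decide : Odd 3)).le_iff_le.symm

section
variable {ℓ ℓ' : cell600.edges → ℝ} (hℓ : ℓ ∈ invariantMetrics) (hℓ' : ℓ' ∈ invariantMetrics)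
include hℓ

theorem param_pos (i : Fin 6) : 0 < param ℓ i := by
  rw [param, ← apply_edgeAt]
  exact pos_of_mem_met hℓ.1 _

theorem sum_param_pos : 0 < ∑ i, param ℓ i :=
  Finset.sum_pos (fun i _ => param_pos hℓ i) Finset.univ_nonempty

theorem volumeOf_param_pos : 0 < volumeOf (param ℓ) := by
  refine div_pos (Finset.sum_pos (fun m _ => ?_) Finset.univ_nonempty) (by norm_num)
  exact Real.sqrt_pos.2 (div_pos (isNondegenerate_onLab hℓ m).vol (by norm_num))

theorem LEHR_eq : cell600.LEHR ℓ = ehrOf (param ℓ) / ∑ i, param ℓ i := by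
  rw [LEHR, EHR_eq_param hℓ, totalLength_eq_param hℓ, mul_div_mul_left _ _ card_pos.ne', ehrOf]

theorem VEHR_eq : cell600.VEHR ℓ = Fintype.card icosians * ehrOf (param ℓ) /
    (Fintype.card icosians * volumeOf (param ℓ)) ^ (1 / 3 : ℝ) := by
  rw [VEHR, EHR_eq_param hℓ, totalVolume_eq hℓ, ehrOf, volumeOf]

include hℓ'

theorem LEHR_le_iff : cell600.LEHR ℓ ≤ cell600.LEHR ℓ' ↔
    ehrOf (param ℓ) * ∑ i, param ℓ' i ≤ ehrOf (param ℓ') * ∑ i, param ℓ i := by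
  rw [LEHR_eq hℓ, LEHR_eq hℓ', div_le_div_iff₀ (sum_param_pos hℓ) (sum_param_pos hℓ')]

theorem VEHR_le_iff : cell600.VEHR ℓ ≤ cell600.VEHR ℓ' ↔
    ehrOf (param ℓ) ^ 3 * volumeOf (param ℓ') ≤ ehrOf (param ℓ') ^ 3 * volumeOf (param ℓ) := by
  have h1 := volumeOf_param_pos hℓ
  have h2 := volumeOf_param_pos hℓ'
  have h3 := card_pos
  rw [VEHR_eq hℓ, VEHR_eq hℓ', div_cbrt_le_div_cbrt_iff (by positivity) (by positivity)]
  rw [show ∀ n a v : ℝ, (n * a) ^ 3 * (n * v) = n ^ 4 * (a ^ 3 * v) from fun n a v => by ring,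
    show ∀ n a v : ℝ, (n * a) ^ 3 * (n * v) = n ^ 4 * (a ^ 3 * v) from fun n a v => by ring]
  exact mul_le_mul_iff_right₀ (by positivity)

end

theorem const_eq_smul (c : ℝ) : (fun _ : Fin 6 => c) = c • fun _ => (1 : ℝ) := by
  ext; simp

theorem update_eq_smul {a : ℝ} (ha : a ≠ 0) (b : ℝ) (k : Fin 6) :
    Function.update (fun _ : Fin 6 => a) k b = a • Function.update (fun _ => 1) k (b / a) := by
  ext i
  by_cases h : i = k
  · subst h; simp [mul_div_cancel₀ _ ha]
  · simp [h]

theorem sum_update_const (a b : ℝ) (k : Fin 6) :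
    ∑ i, Function.update (fun _ : Fin 6 => a) k b i = 5 * a + b := by
  rw [Finset.sum_update_of_mem (Finset.mem_univ k)]
  simp [Finset.card_sdiff]
  ring

section
variable {ℓ ℓ' : cell600.edges → ℝ} (hℓ : ℓ ∈ invariantMetrics) (hℓ' : ℓ' ∈ invariantMetrics)
  {c : ℝ} (hc : param ℓ' = fun _ => c)
include hℓ hℓ' hc

/-- By homogeneity the value of `LEHR` at an equal length metric is the angle defect, whatever the
scale. -/
theorem LEHR_le_regular_iff : cell600.LEHR ℓ ≤ cell600.LEHR ℓ' ↔
    ehrOf (param ℓ) ≤ OneEdge.defect * ∑ i, param ℓ i := by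
  have hc0 : 0 < c := by simpa [hc] using param_pos hℓ' 0
  rw [LEHR_le_iff hℓ hℓ', hc, const_eq_smul, ehrOf_smul hc0, ehrOf_one]
  simp
  constructor <;> intro h <;> nlinarith

theorem VEHR_le_regular_iff : cell600.VEHR ℓ ≤ cell600.VEHR ℓ' ↔
    ehrOf (param ℓ) ^ 3 * (5 * √2 / 12) ≤ (6 * OneEdge.defect) ^ 3 * volumeOf (param ℓ) := by
  have hc0 : 0 < c := by simpa [hc] using param_pos hℓ' 0
  rw [VEHR_le_iff hℓ hℓ', hc, const_eq_smul, ehrOf_smul hc0, ehrOf_one, volumeOf_smul hc0,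
    volumeOf_one, show ehrOf (param ℓ) ^ 3 * (c ^ 3 * (5 * √2 / 12)) =
      c ^ 3 * (ehrOf (param ℓ) ^ 3 * (5 * √2 / 12)) by ring, mul_pow c, mul_assoc]
  exact mul_le_mul_iff_right₀ (by positivity)

theorem regular_le_LEHR_iff : cell600.LEHR ℓ' ≤ cell600.LEHR ℓ ↔
    OneEdge.defect * ∑ i, param ℓ i ≤ ehrOf (param ℓ) := by
  have hc0 : 0 < c := by simpa [hc] using param_pos hℓ' 0
  rw [LEHR_le_iff hℓ' hℓ, hc, const_eq_smul, ehrOf_smul hc0, ehrOf_one]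
  simp
  constructor <;> intro h <;> nlinarith

theorem regular_le_VEHR_iff : cell600.VEHR ℓ' ≤ cell600.VEHR ℓ ↔
    (6 * OneEdge.defect) ^ 3 * volumeOf (param ℓ) ≤ ehrOf (param ℓ) ^ 3 * (5 * √2 / 12) := by
  have hc0 : 0 < c := by simpa [hc] using param_pos hℓ' 0
  rw [VEHR_le_iff hℓ' hℓ, hc, const_eq_smul, ehrOf_smul hc0, ehrOf_one, volumeOf_smul hc0,
    volumeOf_one, show ehrOf (param ℓ) ^ 3 * (c ^ 3 * (5 * √2 / 12)) =
      c ^ 3 * (ehrOf (param ℓ) ^ 3 * (5 * √2 / 12)) by ring, mul_pow c, mul_assoc]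
  exact mul_le_mul_iff_right₀ (by positivity)

variable {a b : ℝ} {k : Fin 6} (hab : param ℓ = Function.update (fun _ => a) k b)
include hab

omit hℓ' hc in
theorem exceptional_bounds : 0 < a ∧ 0 < b ∧ b < √3 * a := by
  have h := isNondegenerate_onLab hℓ 0
  rw [hab, onLab_update isSymmetric_isNondegenerate] at h
  exact ⟨h.b_pos, h.a_pos, h.lt_sqrt_three_mul⟩

theorem LEHR_lt_regular (hne : b ≠ a) : cell600.LEHR ℓ < cell600.LEHR ℓ' := by
  obtain ⟨ha, hb, hlt⟩ := exceptional_bounds hℓ hab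
  have h0 : 0 < b / a := by positivity
  have h1 : b / a < √3 := (div_lt_iff₀ ha).2 hlt
  have h2 : b / a ≠ 1 := fun h => hne ((div_eq_one_iff_eq ha.ne').1 h)
  have h3 := OneEdge.arccos_mul_lt_weighted h0 h1 h2
  rw [← not_le, regular_le_LEHR_iff hℓ hℓ' hc, not_le, hab, update_eq_smul ha.ne', ehrOf_smul ha,
    ehrOf_update h0 h1, ← update_eq_smul ha.ne', sum_update_const,
    show 5 * a + b = a * (5 + b / a) by field_simp, mul_left_comm]
  refine mul_lt_mul_of_pos_left ?_ ha
  rw [OneEdge.ehr, OneEdge.defect]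
  linarith

theorem VEHR_lt_regular (hne : b ≠ a) : cell600.VEHR ℓ < cell600.VEHR ℓ' := by
  obtain ⟨ha, hb, hlt⟩ := exceptional_bounds hℓ hab
  have h0 : 0 < b / a := by positivity
  have h1 : b / a < √3 := (div_lt_iff₀ ha).2 hlt
  have h2 : b / a ≠ 1 := fun h => hne ((div_eq_one_iff_eq ha.ne').1 h)
  have hd : 0 < OneEdge.defect := by linarith [OneEdge.defect_bounds.1]
  rw [← not_le, regular_le_VEHR_iff hℓ hℓ' hc, not_le, hab, update_eq_smul ha.ne', ehrOf_smul ha,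
    ehrOf_update h0 h1, volumeOf_smul ha, volumeOf_update h0, ← OneEdge.ehr_one, mul_pow a,
    mul_assoc, mul_left_comm (OneEdge.ehr 1 ^ 3)]
  refine mul_lt_mul_of_pos_left ?_ (pow_pos ha 3)
  generalize b / a = t at h0 h1 h2
  have h3 := OneEdge.sq_lt_three h0 h1
  have hs : 0 < √(3 - t ^ 2) := Real.sqrt_pos.2 (by linarith)
  have he : 0 < OneEdge.ehr 1 := by rw [OneEdge.ehr_one]; positivity
  -- A nonpositive functional loses trivially; a positive one may be squared to reach the
  -- sixth-power inequality.
  rcases le_or_gt (OneEdge.ehr t) 0 with h4 | h4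
  · have : OneEdge.ehr t ^ 3 ≤ 0 := (by decide : Odd 3).pow_nonpos_iff.2 h4
    have h5 : 0 ≤ 5 * √2 / 12 := by positivity
    exact (mul_nonpos_of_nonpos_of_nonneg this h5).trans_lt (by positivity)
  · have h5 : (OneEdge.ehr t / OneEdge.ehr 1) ^ 3 < t * √(3 - t ^ 2) / √2 := by
      refine lt_of_pow_lt_pow_left₀ 2 (by positivity) ?_
      rw [← pow_mul, div_pow (t * _), mul_pow, Real.sq_sqrt (by linarith), Real.sq_sqrt (by norm_num)]
      exact OneEdge.ehr_pow_six_lt h0 h1 h2 h4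
    rw [div_pow, div_lt_div_iff₀ (by positivity) (by positivity)] at h5
    linarith

end

/-! ### Local maxima -/

theorem continuous_param : Continuous param := by
  refine continuous_pi fun i => ?_
  unfold param len
  split_ifs
  · exact continuous_apply _
  · exact continuous_const

/-- The deviation of the edge lengths from `1`, after normalization to mean `1`. -/
def deviation (ℓ : cell600.edges → ℝ) : Fin 6 → ℝ := (6 / ∑ i, param ℓ i) • param ℓ - 1

theorem one_add_deviation (ℓ : cell600.edges → ℝ) :
    1 + deviation ℓ = (6 / ∑ i, param ℓ i) • param ℓ := add_sub_cancel _ _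

theorem sum_deviation {ℓ : cell600.edges → ℝ} (hℓ : ℓ ∈ invariantMetrics) :
    ∑ i, deviation ℓ i = 0 := by
  have := (sum_param_pos hℓ).ne'
  simp only [deviation, Pi.sub_apply, Pi.smul_apply, smul_eq_mul, Finset.sum_sub_distrib,
    ← Finset.mul_sum, div_mul_cancel₀ _ this]
  simp

theorem tendsto_deviation {ℓ : cell600.edges → ℝ} (hℓ : ℓ ∈ invariantMetrics) {c : ℝ}
    (hc : param ℓ = fun _ => c) : Tendsto (fun ℓ => ‖deviation ℓ‖) (𝓝 ℓ) (𝓝 0) := by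
  have hc0 : 0 < c := by simpa [hc] using param_pos hℓ 0
  have h0 : deviation ℓ = 0 := by
    ext i
    simp [deviation, hc]
    field_simp
    ring
  have hcont : ContinuousAt deviation ℓ := by
    have h1 : ContinuousAt (fun ℓ => 6 / ∑ i, param ℓ i) ℓ :=
      continuousAt_const.div (continuous_finsetSum _ fun i _ =>
        (continuous_apply i).comp continuous_param).continuousAt (sum_param_pos hℓ).ne'
    exact (h1.smul continuous_param.continuousAt).sub continuousAt_const
  have := hcont.norm
  rwa [ContinuousAt, h0, norm_zero] at this

section
variable {ℓ' : cell600.edges → ℝ} (hℓ' : ℓ' ∈ invariantMetrics) {c : ℝ} (hc : param ℓ' = fun _ => c)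
include hℓ' hc

/-- By scale invariance only the normalized lengths `1 + deviation ℓ` matter. The expansion is
applied along the image of the neighbourhood filter under `deviation`, where the coordinates sum to
zero. -/
theorem isLocalMaxOn_LEHR : IsLocalMaxOn cell600.LEHR invariantMetrics ℓ' := by
  have h := eventually_ehrOf_le (F := map deviation (𝓝[invariantMetrics] ℓ'))
    (tendsto_map'_iff.2 ((tendsto_deviation hℓ' hc).mono_left nhdsWithin_le_nhds))
    (eventually_map.2 (eventually_mem_nhdsWithin.mono fun ℓ hℓ => sum_deviation hℓ))
  filter_upwards [eventually_map.1 h, self_mem_nhdsWithin] with ℓ h1 hℓ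
  have h2 := sum_param_pos hℓ
  rw [one_add_deviation, ehrOf_smul (by positivity), div_mul_eq_mul_div, div_le_iff₀ h2] at h1
  rw [LEHR_le_regular_iff hℓ hℓ' hc]
  linarith

theorem isLocalMaxOn_VEHR : IsLocalMaxOn cell600.VEHR invariantMetrics ℓ' := by
  have h := eventually_ehrOf_pow_le (F := map deviation (𝓝[invariantMetrics] ℓ'))
    (tendsto_map'_iff.2 ((tendsto_deviation hℓ' hc).mono_left nhdsWithin_le_nhds))
    (eventually_map.2 (eventually_mem_nhdsWithin.mono fun ℓ hℓ => sum_deviation hℓ))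
  filter_upwards [eventually_map.1 h, self_mem_nhdsWithin] with ℓ h1 hℓ
  have h2 : 0 < 6 / ∑ i, param ℓ i := div_pos (by norm_num) (sum_param_pos hℓ)
  rw [one_add_deviation, ehrOf_smul h2, volumeOf_smul h2, mul_pow, mul_assoc,
    mul_left_comm ((6 * OneEdge.defect) ^ 3)] at h1
  rw [VEHR_le_regular_iff hℓ hℓ' hc]
  exact le_of_mul_le_mul_left h1 (pow_pos h2 3)

end

end Icosian

end

end PiecewiseFlat

namespace PiecewiseFlat

noncomputable section

open Real Triangulation

theorem Triangulation.len_self {V : Type} [Fintype V] (T : Triangulation V) (ℓ : T.edges → ℝ) (x : V) :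
    T.len ℓ x x = 0 := by
  rw [len, dif_neg]
  intro h
  have := T.card_of_mem_edges h
  simp at this

/-! ### Tetrahedra with one exceptional edge -/

/-- The number of the edge between two vertices of a tetrahedron, in the order
`01, 02, 03, 12, 13, 23`. -/
def pairIndex : Fin 4 → Fin 4 → Fin 6 := ![![0, 0, 1, 2], ![0, 0, 3, 4], ![1, 3, 0, 5], ![2, 4, 5, 0]]

/-- Vertex permutations act transitively on the edges. The diagonal values of `pairIndex` are
placeholders, hence the restriction to `i ≠ j`. -/
theorem exists_perm_pairIndex : ∀ c c' : Fin 6, ∃ τ : Equiv.Perm (Fin 4), ∀ i j, i ≠ j →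
    (pairIndex (τ i) (τ j) = c' ↔ pairIndex i j = c) := by
  decide +kernel

theorem exists_tetrahedron {a b : ℝ} (ha : 0 < a) (hb : 0 < b) (h : b < √3 * a) :
    ∃ q : Fin 4 → EuclideanSpace ℝ (Fin 3), AffineIndependent ℝ q ∧ ∀ i j, dist (q i) (q j) =
      if i = j then 0 else if pairIndex i j = 0 then b else a := by
  have h3 : b ^ 2 < 3 * a ^ 2 := by
    have := pow_lt_pow_left₀ h hb.le two_ne_zero
    rwa [mul_pow, Real.sq_sqrt (by norm_num)] at this
  have hs : √(3 * a ^ 2 - b ^ 2) ^ 2 = 3 * a ^ 2 - b ^ 2 := Real.sq_sqrt (by linarith)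
  have hsp : 0 < √(3 * a ^ 2 - b ^ 2) := Real.sqrt_pos.2 (by linarith)
  set r := √(3 * a ^ 2 - b ^ 2)
  -- The exceptional edge lies on the first axis and the opposite one at height `r / 2` along the
  -- second; the other squared lengths are `(b² + a² + r²) / 4 = a²`.
  refine ⟨![!₂[b / 2, 0, 0], !₂[-b / 2, 0, 0], !₂[0, a / 2, r / 2], !₂[0, -a / 2, r / 2]], ?_, ?_⟩
  · rw [affineIndependent_iff_of_fintype]
    intro w hw h0
    rw [Finset.univ.weightedVSub_eq_linear_combination hw] at h0
    have e0 := congrArg (fun v : EuclideanSpace ℝ (Fin 3) => v 0) h0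
    have e1 := congrArg (fun v : EuclideanSpace ℝ (Fin 3) => v 1) h0
    have e2 := congrArg (fun v : EuclideanSpace ℝ (Fin 3) => v 2) h0
    simp [Fin.sum_univ_four] at e0 e1 e2 hw
    have f0 : w 0 - w 1 = 0 := by
      have : (w 0 - w 1) * b = 0 := by linarith
      exact (mul_eq_zero.1 this).resolve_right hb.ne'
    have f1 : w 2 - w 3 = 0 := by
      have : (w 2 - w 3) * a = 0 := by linarith
      exact (mul_eq_zero.1 this).resolve_right ha.ne'
    have f2 : w 2 + w 3 = 0 := by
      have : (w 2 + w 3) * r = 0 := by linarith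
      exact (mul_eq_zero.1 this).resolve_right hsp.ne'
    intro i
    fin_cases i <;> simp <;> linarith
  · have hd : ∀ x y z t u v c : ℝ, 0 ≤ c → (x - t) ^ 2 + (y - u) ^ 2 + (z - v) ^ 2 = c ^ 2 →
        dist (!₂[x, y, z] : EuclideanSpace ℝ (Fin 3)) !₂[t, u, v] = c := by
      intro x y z t u v c hc he
      rw [EuclideanSpace.dist_eq, ← Real.sqrt_sq hc, ← he]
      simp [Fin.sum_univ_three, Real.dist_eq, sq_abs]
    intro i j
    fin_cases i <;> fin_cases j <;> simp [pairIndex] <;>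
      exact hd _ _ _ _ _ _ _ (by first | exact hb.le | exact ha.le)
        (by first | ring1 | linear_combination hs / 4)

namespace Icosian

/-! ### Edge types -/

theorem mapEquiv_shift_mul (g h : icosians) (s : Finset icosians) :
    mapEquiv (shift g) (mapEquiv (shift h) s) = mapEquiv (shift (g * h)) s := by
  rw [mapEquiv_apply, mapEquiv_apply, mapEquiv_apply, Finset.map_map]
  congr 1
  exact Function.Embedding.ext fun x => (mul_assoc g h x).symm

theorem mapEquiv_shift_one (s : Finset icosians) : mapEquiv (shift 1) s = s := by
  rw [show shift 1 = 1 from Equiv.ext fun x => one_mul x]; exact Finset.map_refl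

theorem isTranslate_refl (e : cell600.edges) : IsTranslate e e :=
  (isTranslate_iff _ _).2 ⟨1, (mapEquiv_shift_one _).symm⟩

theorem isTranslate_symm {e e' : cell600.edges} (h : IsTranslate e e') : IsTranslate e' e := by
  obtain ⟨g, hg⟩ := (isTranslate_iff _ _).1 h
  exact (isTranslate_iff _ _).2 ⟨g⁻¹, by
    rw [hg, mapEquiv_shift_mul, inv_mul_cancel, mapEquiv_shift_one]⟩

theorem isTranslate_trans {e e' e'' : cell600.edges} (h : IsTranslate e e')
    (h' : IsTranslate e' e'') : IsTranslate e e'' := by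
  obtain ⟨g, hg⟩ := (isTranslate_iff _ _).1 h
  obtain ⟨g', hg'⟩ := (isTranslate_iff _ _).1 h'
  exact (isTranslate_iff _ _).2 ⟨g' * g, by rw [hg', hg, mapEquiv_shift_mul]⟩

/-- The edge of type `i` at `1`. -/
def edgeOf (i : Fin 6) : cell600.edges := edgeAt (i.castLE (by norm_num))

theorem isTranslate_edgeOf (i : Fin 12) : IsTranslate (edgeOf (edgeType i)) (edgeAt i) := by
  rcases eq_castLE_or i with h | h
  · rw [edgeOf, ← h]; exact isTranslate_refl _
  · generalize edgeType i = j at h ⊢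
    subst h
    refine isTranslate_symm ((isTranslate_iff _ _).2 ⟨nbr (j.castLE (by norm_num)), ?_⟩)
    rw [edgeAt, mapEquiv_shift_duo, mul_one, nbr_add_six, mul_inv_cancel]
    exact duo_eq_duo_iff.2 (.inr ⟨rfl, rfl⟩)

theorem exists_isTranslate_edgeOf (e : cell600.edges) : ∃ i, IsTranslate (edgeOf i) e := by
  obtain ⟨x, y, hxy, hd⟩ := exists_eq_duo (cell600.card_of_mem_edges e.2)
  have hm := (mapEquiv_mem_edges (mapEquiv_shift_mem x⁻¹) e.1).2 e.2
  have ht : IsTranslate e ⟨_, hm⟩ := (isTranslate_iff _ _).2 ⟨x⁻¹, rfl⟩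
  obtain ⟨i, hi⟩ := exists_edgeAt (e := ⟨_, hm⟩) (by
    simp only [hd, mapEquiv_shift_duo, inv_mul_cancel]
    exact mem_duo.2 (.inl rfl))
  refine ⟨edgeType i, isTranslate_trans (isTranslate_edgeOf i) ?_⟩
  rw [hi]
  exact isTranslate_symm ht

theorem castLE_add_six_ne : ∀ i j : Fin 6,
    (j.castLE (by norm_num) : Fin 12) ≠ i.castLE (by norm_num) + 6 := by
  decide

/-- A translate of an edge at `1` that again contains `1` is the edge itself or its image under
inversion of the endpoint. The latter shifts the index by six, outside the chosen representatives.
-/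
theorem eq_of_isTranslate_edgeOf {i j : Fin 6} (h : IsTranslate (edgeOf i) (edgeOf j)) : i = j := by
  obtain ⟨g, hg⟩ := (isTranslate_iff _ _).1 h
  change duo 1 _ = mapEquiv (shift g) (duo 1 _) at hg
  rw [mapEquiv_shift_duo, mul_one] at hg
  rcases duo_eq_duo_iff.1 hg with ⟨rfl, h1⟩ | ⟨h1, h2⟩
  · rw [one_mul, nbr_inj] at h1
    exact (Fin.castLE_injective _ h1).symm
  · rw [eq_comm, mul_eq_one_iff_eq_inv, ← nbr_add_six] at h1
    rw [← h2, nbr_inj] at h1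
    exact absurd h1 (castLE_add_six_ne i j)

/-- The type of an edge. -/
def typeOf (e : cell600.edges) : Fin 6 := (exists_isTranslate_edgeOf e).choose

theorem isTranslate_typeOf (e : cell600.edges) : IsTranslate (edgeOf (typeOf e)) e :=
  (exists_isTranslate_edgeOf e).choose_spec

theorem isTranslate_iff_typeOf {e e' : cell600.edges} : IsTranslate e e' ↔ typeOf e' = typeOf e := by
  constructor
  · intro h
    exact (eq_of_isTranslate_edgeOf (isTranslate_trans (isTranslate_trans (isTranslate_typeOf e) h)
      (isTranslate_symm (isTranslate_typeOf e')))).symm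
  · intro h
    refine isTranslate_trans (isTranslate_symm (isTranslate_typeOf e)) ?_
    rw [← h]
    exact isTranslate_typeOf e'

theorem typeOf_edgeOf (i : Fin 6) : typeOf (edgeOf i) = i :=
  eq_of_isTranslate_edgeOf (isTranslate_typeOf _)

theorem apply_eq_param {ℓ : cell600.edges → ℝ} (hℓ : ∀ e e', IsTranslate e e' → ℓ e' = ℓ e)
    (e : cell600.edges) : ℓ e = param ℓ (typeOf e) := by
  rw [hℓ _ _ (isTranslate_typeOf e), param, ← apply_edgeAt]
  rfl

/-- The edge lengths `x i` on the edges of type `i`. -/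
def ofParam (x : Fin 6 → ℝ) (e : cell600.edges) : ℝ := x (typeOf e)

theorem ofParam_eq (x : Fin 6 → ℝ) (e e' : cell600.edges) (h : IsTranslate e e') :
    ofParam x e' = ofParam x e := by
  rw [ofParam, ofParam, isTranslate_iff_typeOf.1 h]

theorem param_ofParam (x : Fin 6 → ℝ) : param (ofParam x) = x := by
  ext i
  rw [param, ← apply_edgeAt]
  exact congrArg x (typeOf_edgeOf i)

/-! ### Enumerations of the tetrahedra -/

/-- The vertices of `base m`. -/
def vertexAt (m : Fin 20) : Fin 4 → icosians := ![1, nbr (tri m 0), nbr (tri m 1), nbr (tri m 2)]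

theorem vertexAt_injective (m : Fin 20) : Function.Injective (vertexAt m) := by
  obtain ⟨h1, h2, h3⟩ := inner_tri m
  have h1 := ne_of_inner_eq h1
  have h2 := ne_of_inner_eq h2
  have h3 := ne_of_inner_eq h3
  have h0 := fun i => ne_of_inner_eq (inner_one_nbr i)
  intro i j
  fin_cases i <;> fin_cases j <;>
    simp [vertexAt, h0, h1, h2, h3, h1.symm, h2.symm, h3.symm, (h0 _).symm]

theorem mem_base_iff (m : Fin 20) (x : icosians) : x ∈ base m ↔ ∃ i, vertexAt m i = x := by
  rw [base, mem_quad]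
  simp [vertexAt, Fin.exists_fin_succ, eq_comm]

theorem len_vertexAt {ℓ : cell600.edges → ℝ} (hℓ : ∀ e e', IsTranslate e e' → ℓ e' = ℓ e)
    (m : Fin 20) (i j : Fin 4) : cell600.len ℓ (vertexAt m i) (vertexAt m j) =
      if i = j then 0 else param ℓ (lab m (pairIndex i j)) := by
  have key : ∀ i j, i < j → cell600.len ℓ (vertexAt m i) (vertexAt m j) =
      param ℓ (lab m (pairIndex i j)) := by
    obtain ⟨h1, h2, h3⟩ := edgeType_quot m
    obtain ⟨h4, h5, h6⟩ := edgeType_tri m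
    intro i j hij
    fin_cases i <;> fin_cases j <;> first
      | exact absurd hij (by decide)
      | simp [vertexAt, pairIndex, len_one_nbr hℓ, len_nbr_nbr hℓ h1, len_nbr_nbr hℓ h2,
          len_nbr_nbr hℓ h3, h4, h5, h6]
  have hsymm : ∀ i j, pairIndex i j = pairIndex j i := by decide
  rcases lt_trichotomy i j with h | rfl | h
  · rw [if_neg h.ne, key i j h]
  · rw [if_pos rfl, len_self]
  · rw [if_neg h.ne', len_comm, key j i h, hsymm]

theorem exists_mapEquiv_base {t : Finset icosians} (ht : t ∈ cell600.tets) :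
    ∃ g m, t = mapEquiv (shift g) (base m) := by
  obtain ⟨x, hx⟩ := Finset.card_pos.1 (by rw [cell600.card_tets t ht]; norm_num : 0 < t.card)
  obtain ⟨m, hm⟩ := exists_base ((mapEquiv_shift_mem x⁻¹ t).2 ht) (by
    have := (mem_mapEquiv (shift x⁻¹) t x).2 hx
    rwa [shift_apply, inv_mul_cancel] at this)
  exact ⟨x, m, by rw [hm, mapEquiv_shift_mul, mul_inv_cancel, mapEquiv_shift_one]⟩

theorem exists_enumeration {t : Finset icosians} (ht : t ∈ cell600.tets) :
    ∃ (m : Fin 20) (f : Fin 4 ≃ t), ∀ ℓ : cell600.edges → ℝ,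
      (∀ e e', IsTranslate e e' → ℓ e' = ℓ e) → ∀ i j, cell600.len ℓ (f i) (f j) =
        if i = j then 0 else param ℓ (lab m (pairIndex i j)) := by
  obtain ⟨g, m, rfl⟩ := exists_mapEquiv_base ht
  refine ⟨m, (enumSet _ (vertexAt_injective m) _ (mem_base_iff m)).trans (restrictEquiv (shift g) _),
    fun ℓ hℓ i j => (len_mul_left hℓ g _ _).trans (len_vertexAt hℓ m i j)⟩

theorem exists_lab (m : Fin 20) (k : Fin 6) : ∃ c, lab m c = k :=
  Finite.surjective_of_injective (fun c c' h => lab_injective m c c' h) k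

theorem update_lab {m : Fin 20} {c k : Fin 6} (hc : lab m c = k) (a b : ℝ) (c' : Fin 6) :
    Function.update (fun _ => a) k b (lab m c') = if c' = c then b else a := by
  have h : lab m c' = lab m c ↔ c' = c := ⟨lab_injective m c' c, congrArg _⟩
  rw [Function.update_apply, ← hc]
  simp only [h]

theorem ofParam_update_mem_congruentMetrics {a b : ℝ} (ha : 0 < a) (hb : 0 < b) (h : b < √3 * a)
    (k : Fin 6) : ofParam (Function.update (fun _ => a) k b) ∈ congruentMetrics := by
  have hinv := ofParam_eq (Function.update (fun _ => a) k b)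
  refine ⟨⟨fun t ht => ?_, hinv⟩, fun s hs t ht => ?_⟩
  · obtain ⟨m, f, hf⟩ := exists_enumeration ht
    obtain ⟨c, hc⟩ := exists_lab m k
    obtain ⟨q, hq, hqd⟩ := exists_tetrahedron ha hb h
    -- Move the exceptional edge of this tetrahedron to position `0`, where the model tetrahedron
    -- has it.
    obtain ⟨τ, hτ⟩ := exists_perm_pairIndex c 0
    refine ⟨fun x => q (τ (f.symm x)), hq.comp_embedding (f.symm.trans τ).toEmbedding,
      fun x y => ?_⟩
    obtain ⟨i, rfl⟩ := f.surjective x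
    obtain ⟨j, rfl⟩ := f.surjective y
    rw [hf _ hinv, hqd, f.symm_apply_apply, f.symm_apply_apply, param_ofParam, update_lab hc]
    by_cases hij : i = j
    · rw [if_pos hij, if_pos (congrArg τ hij)]
    · rw [if_neg hij, if_neg (τ.injective.ne hij)]
      simp only [hτ i j hij]
  · obtain ⟨m, f, hf⟩ := exists_enumeration hs
    obtain ⟨m', f', hf'⟩ := exists_enumeration ht
    obtain ⟨c, hc⟩ := exists_lab m k
    obtain ⟨c', hc'⟩ := exists_lab m' k
    obtain ⟨τ, hτ⟩ := exists_perm_pairIndex c c'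
    refine ⟨f.symm.trans (τ.trans f'), fun x y => ?_⟩
    obtain ⟨i, rfl⟩ := f.surjective x
    obtain ⟨j, rfl⟩ := f.surjective y
    simp only [Equiv.trans_apply, f.symm_apply_apply]
    rw [hf _ hinv, hf' _ hinv, param_ofParam, update_lab hc, update_lab hc']
    by_cases hij : i = j
    · rw [if_pos hij, if_pos (congrArg τ hij)]
    · rw [if_neg hij, if_neg (τ.injective.ne hij)]
      simp only [hτ i j hij]

/-! ### Classification of the metrics with congruent tetrahedra -/

/-- The set `A` of edges of a tetrahedron contains a pair of opposite edges. -/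
def HasOpposite (A : Fin 6 → Bool) : Prop := ∃ c, A c ∧ A (5 - c)

instance (A : Fin 6 → Bool) : Decidable (HasOpposite A) :=
  inferInstanceAs (Decidable (∃ c, A c ∧ A (5 - c)))

/-- In the edge order `01, 02, 03, 12, 13, 23`, opposite edges have indices summing to five.
Congruent tetrahedra agree on whether a set of edge types, or its complement, contains an opposite
pair; running over all subsets of the six types, this alone leaves sets with at most one element or
at most one missing. -/
theorem exists_exceptional_of_hasOpposite : ∀ A : Fin 6 → Bool,
    (∀ m, HasOpposite (A ∘ lab m) ↔ HasOpposite (A ∘ lab 0)) →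
    (∀ m, HasOpposite ((fun i => !A i) ∘ lab m) ↔ HasOpposite ((fun i => !A i) ∘ lab 0)) →
    (∃ k, ∀ j, j ≠ k → A j) ∨ (∃ k, ∀ j, j ≠ k → !A j) := by
  decide +kernel

/-- Permutations of the vertices carry opposite edges to opposite edges, so having an opposite pair
is invariant under congruence. -/
theorem exists_pairIndex_eq : ∀ c, ∃ i j k l, i ≠ j ∧ k ≠ l ∧ pairIndex i j = c ∧
    pairIndex k l = 5 - c ∧ ∀ τ : Equiv.Perm (Fin 4),
      pairIndex (τ k) (τ l) = 5 - pairIndex (τ i) (τ j) := by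
  decide +kernel

theorem HasOpposite.of_perm {A B : Fin 6 → Bool} (τ : Equiv.Perm (Fin 4))
    (h : ∀ i j, i ≠ j → A (pairIndex i j) = B (pairIndex (τ i) (τ j))) (hA : HasOpposite A) :
    HasOpposite B := by
  obtain ⟨c, h1, h2⟩ := hA
  obtain ⟨i, j, k, l, hij, hkl, rfl, hc, hτ⟩ := exists_pairIndex_eq c
  rw [h i j hij] at h1
  rw [← hc, h k l hkl, hτ] at h2
  exact ⟨_, h1, h2⟩

theorem hasOpposite_lab {ℓ : cell600.edges → ℝ} (hℓ : ℓ ∈ congruentMetrics) (P : ℝ → Bool)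
    (m m' : Fin 20) (h : HasOpposite ((fun i => P (param ℓ i)) ∘ lab m)) :
    HasOpposite ((fun i => P (param ℓ i)) ∘ lab m') := by
  obtain ⟨σ, hσ⟩ := hℓ.2 _ (base_mem_tets m) _ (base_mem_tets m')
  set f := enumSet _ (vertexAt_injective m) _ (mem_base_iff m)
  set f' := enumSet _ (vertexAt_injective m') _ (mem_base_iff m')
  refine h.of_perm (f.trans (σ.trans f'.symm)) fun i j hij => ?_
  have h1 : cell600.len ℓ (f i) (f j) = _ := len_vertexAt hℓ.1.2 m i j
  have h2 : ∀ i j, cell600.len ℓ (f' i) (f' j) = _ := len_vertexAt hℓ.1.2 m'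
  have h3 := hσ (f i) (f j)
  rw [h1, ← f'.apply_symm_apply (σ (f i)), ← f'.apply_symm_apply (σ (f j)), h2, if_neg hij,
    if_neg (by simpa using hij)] at h3
  simp only [Function.comp_apply, Equiv.trans_apply, h3]

theorem exists_exceptional {ℓ : cell600.edges → ℝ} (hℓ : ℓ ∈ congruentMetrics) (P : ℝ → Prop) :
    (∃ k, ∀ j, j ≠ k → P (param ℓ j)) ∨ ∃ k, ∀ j, j ≠ k → ¬P (param ℓ j) := by
  have := exists_exceptional_of_hasOpposite (fun i => decide (P (param ℓ i)))
    (fun m => ⟨hasOpposite_lab hℓ (fun r => decide (P r)) _ _, hasOpposite_lab hℓ (fun r => decide (P r)) _ _⟩)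
    (fun m => ⟨hasOpposite_lab hℓ (fun r => !decide (P r)) _ _,
      hasOpposite_lab hℓ (fun r => !decide (P r)) _ _⟩)
  simpa using this

/-- Apply the dichotomy to the types with the same length as type `0`, and likewise type `1`. If
neither set has five elements, both are singletons; but then the union of the two has exactly two
elements, which the dichotomy excludes. -/
theorem param_eq_update {ℓ : cell600.edges → ℝ} (hℓ : ℓ ∈ congruentMetrics) :
    ∃ k a b, param ℓ = Function.update (fun _ => a) k b := by
  have hex : ∀ i k, (∀ j, j ≠ k → param ℓ j = param ℓ i) →
      ∃ k a b, param ℓ = Function.update (fun _ => a) k b := by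
    intro i k h
    refine ⟨k, param ℓ i, param ℓ k, ?_⟩
    ext j
    by_cases hj : j = k
    · subst hj; simp
    · simp [hj, h j hj]
  rcases exists_exceptional hℓ (· = param ℓ 0) with ⟨k, h⟩ | ⟨k, h⟩
  · exact hex 0 k h
  rcases exists_exceptional hℓ (· = param ℓ 1) with ⟨k', h'⟩ | ⟨k', h'⟩
  · exact hex 1 k' h'
  obtain rfl : k = 0 := by by_contra hk; exact h 0 (Ne.symm hk) rfl
  obtain rfl : k' = 1 := by by_contra hk; exact h' 1 (Ne.symm hk) rfl
  rcases exists_exceptional hℓ (fun r => r = param ℓ 0 ∨ r = param ℓ 1) with ⟨k, hk⟩ | ⟨k, hk⟩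
  · obtain ⟨j, h0, h1, hj⟩ : ∃ j : Fin 6, j ≠ 0 ∧ j ≠ 1 ∧ j ≠ k :=
      (by decide : ∀ k : Fin 6, ∃ j : Fin 6, j ≠ 0 ∧ j ≠ 1 ∧ j ≠ k) k
    exact ((hk j hj).elim (h j h0) (h' j h1)).elim
  · by_cases h0 : k = 0
    · exact (hk 1 (by rw [h0]; decide) (.inr rfl)).elim
    · exact (hk 0 (Ne.symm h0) (.inl rfl)).elim

end Icosian

end

end PiecewiseFlat

namespace PiecewiseFlat

noncomputable section

open Real Filter Topology

/-! ### Metrics with equal edge lengths -/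

namespace Triangulation

variable {V : Type} [Fintype V] (T : Triangulation V)

/-- The number of tetrahedra that contain the set `e`. -/
def degree (e : Finset V) : ℕ := (T.tets.filter fun t => e ⊆ t).card

variable {T}

omit [Fintype V] in
theorem duo_mem_edges_of_mem {t : Finset V} (ht : t ∈ T.tets) {x y : V} (hx : x ∈ t) (hy : y ∈ t)
    (hxy : x ≠ y) : duo x y ∈ T.edges :=
  Finset.mem_biUnion.2 ⟨t, ht, Finset.mem_powersetCard.2 ⟨fun z hz => by
    rcases mem_duo.1 hz with rfl | rfl <;> assumption, card_duo hxy⟩⟩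

omit [Fintype V] in
theorem exists_eq_quad_of_duo_subset {t : Finset V} (ht : t.card = 4) {i j : V} (hij : i ≠ j)
    (h : duo i j ⊆ t) : ∃ k l, i ≠ k ∧ i ≠ l ∧ j ≠ k ∧ j ≠ l ∧ k ≠ l ∧ t = quad i j k l := by
  obtain ⟨a, b, c, h1, h2, h3, h4, h5, h6, rfl⟩ :=
    exists_eq_quad_of_mem ht (h (mem_duo.2 (.inl rfl)))
  have hj : j ∈ quad i a b c := h (mem_duo.2 (.inr rfl))
  rcases mem_quad.1 hj with rfl | rfl | rfl | rfl
  · exact absurd rfl hij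
  · exact ⟨b, c, h2, h3, h4, h5, h6, rfl⟩
  · exact ⟨a, c, h1, h3, h4.symm, h6, h5, by ext x; simp only [mem_quad]; tauto⟩
  · exact ⟨a, b, h1, h2, h5.symm, h6.symm, h4, by ext x; simp only [mem_quad]; tauto⟩

omit [Fintype V] in
theorem len_of_duo_mem {ℓ : T.edges → ℝ} {x y : V} (h : duo x y ∈ T.edges) :
    T.len ℓ x y = ℓ ⟨duo x y, h⟩ := dif_pos h

omit [Fintype V] in
theorem dihedralAngle_const {c : ℝ} (hc : (fun _ => c) ∈ T.met) {t e : Finset V} (ht : t ∈ T.tets)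
    (he : e ∈ T.edges) (h : e ⊆ t) :
    dihedralAngle (T.len fun _ => c) t e = arccos (1 / 3) := by
  have hc0 : 0 < c := pos_of_mem_met hc ⟨e, he⟩
  obtain ⟨i, j, hij, rfl⟩ := exists_eq_duo (T.card_of_mem_edges he)
  obtain ⟨k, l, hik, hil, hjk, hjl, hkl, rfl⟩ :=
    exists_eq_quad_of_duo_subset (T.card_tets t ht) hij h
  have hlen : ∀ x y, x ∈ quad i j k l → y ∈ quad i j k l → x ≠ y → T.len (fun _ => c) x y = c :=
    fun x y hx hy hxy => len_of_duo_mem (duo_mem_edges_of_mem ht hx hy hxy)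
  have mi : i ∈ quad i j k l := by simp [mem_quad]
  have mj : j ∈ quad i j k l := by simp [mem_quad]
  have mk : k ∈ quad i j k l := by simp [mem_quad]
  have ml : l ∈ quad i j k l := by simp [mem_quad]
  rw [dihedralAngle_quad_duo hc ht hij hik hil hjk hjl hkl, atTet, hlen i j mi mj hij,
    hlen i k mi mk hik, hlen i l mi ml hil, hlen j k mj mk hjk, hlen j l mj ml hjl,
    hlen k l mk ml hkl]
  have := tetAngle_mul hc0 1 1 1 1 1 1
  rw [mul_one] at this
  rw [this, tetAngle, edgeAngle]
  norm_num [heron, hinge, Real.mul_self_sqrt]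

omit [Fintype V] in
theorem edgeCurvature_const {c : ℝ} (hc : (fun _ => c) ∈ T.met) (e : T.edges) :
    T.edgeCurvature (fun _ => c) e = (2 * π - T.degree e.1 * arccos (1 / 3)) * c := by
  rw [edgeCurvature, Finset.sum_congr rfl fun t ht => dihedralAngle_const hc
    (Finset.mem_filter.1 ht).1 e.2 (Finset.mem_filter.1 ht).2, Finset.sum_const, nsmul_eq_mul,
    degree]

omit [Fintype V] in
theorem tetVolume_update {c : ℝ} (s : ℝ) (e : T.edges) {t : Finset V} (ht : t ∈ T.tets) :
    tetVolume (T.len (Function.update (fun _ => c) e s)) t =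
      if e.1 ⊆ t then volOf s c c c c c else volOf c c c c c c := by
  have hlen : ∀ x y, x ∈ t → y ∈ t → x ≠ y → T.len (Function.update (fun _ => c) e s) x y =
      if duo x y = e.1 then s else c := by
    intro x y hx hy hxy
    rw [len_of_duo_mem (duo_mem_edges_of_mem ht hx hy hxy), Function.update_apply]
    simp only [Subtype.ext_iff]
  by_cases he : e.1 ⊆ t
  · obtain ⟨i, j, hij, hd⟩ := exists_eq_duo (T.card_of_mem_edges e.2)
    rw [if_pos he]
    rw [hd] at he hlen
    obtain ⟨k, l, hik, hil, hjk, hjl, hkl, rfl⟩ :=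
      exists_eq_quad_of_duo_subset (T.card_tets t ht) hij he
    have mi : i ∈ quad i j k l := by simp [mem_quad]
    have mj : j ∈ quad i j k l := by simp [mem_quad]
    have mk : k ∈ quad i j k l := by simp [mem_quad]
    have ml : l ∈ quad i j k l := by simp [mem_quad]
    rw [tetVolume_quad hij hik hil hjk hjl hkl, atTet, hlen i j mi mj hij,
      hlen i k mi mk hik, hlen i l mi ml hil, hlen j k mj mk hjk, hlen j l mj ml hjl,
      hlen k l mk ml hkl]
    simp [duo_eq_duo_iff, hjk.symm, hjl.symm, hik.symm, hil.symm, hij.symm, hij]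
  · obtain ⟨i, hi⟩ := Finset.card_pos.1 (by rw [T.card_tets t ht]; norm_num : 0 < t.card)
    obtain ⟨j, k, l, hij, hik, hil, hjk, hjl, hkl, rfl⟩ :=
      exists_eq_quad_of_mem (T.card_tets t ht) hi
    have hlen' : ∀ x y, x ∈ quad i j k l → y ∈ quad i j k l → x ≠ y →
        T.len (Function.update (fun _ => c) e s) x y = c := by
      intro x y hx hy hxy
      rw [hlen x y hx hy hxy, if_neg]
      intro h
      refine he (h ▸ fun z hz => ?_)
      rcases mem_duo.1 hz with rfl | rfl <;> assumption
    have mj : j ∈ quad i j k l := by simp [mem_quad]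
    have mk : k ∈ quad i j k l := by simp [mem_quad]
    have ml : l ∈ quad i j k l := by simp [mem_quad]
    rw [if_neg he, tetVolume_quad hij hik hil hjk hjl hkl, atTet, hlen' i j hi mj hij,
      hlen' i k hi mk hik, hlen' i l hi ml hil, hlen' j k mj mk hjk, hlen' j l mj ml hjl,
      hlen' k l mk ml hkl]

theorem hasDerivAt_volOf {c : ℝ} (hc : 0 < c) :
    HasDerivAt (fun s => volOf s c c c c c) (√2 / 24 * c ^ 2) c := by
  have h2 : √2 ^ 2 = (2 : ℝ) := Real.sq_sqrt (by norm_num)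
  have hs : √(3 * c ^ 2 - c ^ 2) = √2 * c := by
    rw [show 3 * c ^ 2 - c ^ 2 = 2 * c ^ 2 by ring, Real.sqrt_mul (by norm_num), Real.sqrt_sq hc.le]
  have h1 : HasDerivAt (fun s : ℝ => 3 * c ^ 2 - s ^ 2) (-(2 * c)) c := by
    simpa using (hasDerivAt_pow 2 c).const_sub (3 * c ^ 2)
  have h3 : HasDerivAt (fun s => c * s * √(3 * c ^ 2 - s ^ 2) / 12) (√2 / 24 * c ^ 2) c := by
    refine ((((hasDerivAt_id' c).const_mul c).mul (h1.sqrt (by nlinarith))).div_const 12).congr_deriv ?_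
    rw [hs]
    field_simp
    linear_combination (12 : ℝ) * h2
  refine h3.congr_of_eventuallyEq ?_
  filter_upwards [lt_mem_nhds hc] with s hs
  exact volOf_exceptional hc hs

omit [Fintype V] in
-- As a function of one edge length, the total volume is the number of incident tetrahedra times the
-- one-edge volume, plus a constant.
theorem edgeVolume_const {c : ℝ} (hc : (fun _ => c) ∈ T.met) (e : T.edges) :
    T.edgeVolume (fun _ => c) e = T.degree e.1 * (√2 / 24 * c ^ 3) := by
  have hc0 : 0 < c := pos_of_mem_met hc e
  have htot : ∀ s, T.totalVolume (Function.update (fun _ => c) e s) =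
      T.degree e.1 * volOf s c c c c c +
        (T.tets.filter fun t => ¬ e.1 ⊆ t).card * volOf c c c c c c := by
    intro s
    rw [totalVolume, Finset.sum_congr rfl fun t ht => tetVolume_update s e ht, Finset.sum_ite,
      Finset.sum_const, Finset.sum_const, nsmul_eq_mul, nsmul_eq_mul, degree]
  rw [edgeVolume]
  simp only [htot]
  rw [(((hasDerivAt_volOf hc0).const_mul (T.degree e.1 : ℝ)).add_const _).deriv]
  ring

omit [Fintype V] in
theorem isLEinstein_const {c : ℝ} (hc : (fun _ => c) ∈ T.met) {n : ℕ}
    (hn : ∀ e : T.edges, T.degree e.1 = n) : T.IsLEinstein fun _ => c :=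
  ⟨hc, 2 * π - n * arccos (1 / 3), fun e => by rw [edgeCurvature_const hc, hn]⟩

omit [Fintype V] in
theorem isVEinstein_const {c : ℝ} (hc : (fun _ => c) ∈ T.met) {n : ℕ} (hn0 : n ≠ 0)
    (hn : ∀ e : T.edges, T.degree e.1 = n) : T.IsVEinstein fun _ => c := by
  refine ⟨hc, (2 * π - n * arccos (1 / 3)) * c / (n * (√2 / 24 * c ^ 3)), fun e => ?_⟩
  have hc0 : 0 < c := pos_of_mem_met hc e
  rw [edgeCurvature_const hc, edgeVolume_const hc, hn, div_mul_cancel₀]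
  positivity

omit [Fintype V] in
theorem degree_mapEquiv {ρ : Equiv.Perm V} (h : ∀ t, mapEquiv ρ t ∈ T.tets ↔ t ∈ T.tets)
    (e : Finset V) : T.degree (mapEquiv ρ e) = T.degree e :=
  (Finset.card_equiv (mapEquiv ρ) fun t => by
    rw [Finset.mem_filter, Finset.mem_filter, h, subset_mapEquiv]).symm

omit [Fintype V] in
theorem degree_eq_card {n : ℕ} {b : Fin n → Finset V} (hb : Function.Injective b)
    (hbT : ∀ m, b m ∈ T.tets) {e : Finset V} (he : ∀ t ∈ T.tets, e ⊆ t → ∃ m, b m = t)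
    {p : Fin n → Prop} [DecidablePred p] (hp : ∀ m, e ⊆ b m ↔ p m) :
    T.degree e = (Finset.univ.filter p).card := by
  refine (Finset.card_bij (fun m _ => b m) (fun m hm => ?_) (fun _ _ _ _ h => hb h)
    fun t ht => ?_).symm
  · exact Finset.mem_filter.2 ⟨hbT m, (hp m).2 (Finset.mem_filter.1 hm).2⟩
  · obtain ⟨h1, h2⟩ := Finset.mem_filter.1 ht
    obtain ⟨m, rfl⟩ := he t h1 h2
    exact ⟨m, Finset.mem_filter.2 ⟨Finset.mem_univ _, (hp m).1 h2⟩, rfl⟩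

omit [Fintype V] in
theorem duo_subset {i j : V} {t : Finset V} : duo i j ⊆ t ↔ i ∈ t ∧ j ∈ t := by
  simp [duo, Finset.insert_subset_iff]

end Triangulation

open Triangulation

/-! ### Edge degrees of the 600-cell and the characterization of the maxima -/

namespace Icosian

theorem card_filter_tri : ∀ i : Fin 12, (Finset.univ.filter fun m : Fin 20 =>
    i = tri m 0 ∨ i = tri m 1 ∨ i = tri m 2).card = 5 := by
  decide +kernel

/-- Translate the edge to one at `1` and count the tetrahedra at `1` that contain its other
endpoint. -/
theorem degree_eq_five (e : cell600.edges) : cell600.degree e.1 = 5 := by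
  obtain ⟨g, hg⟩ := (isTranslate_iff _ _).1 (isTranslate_typeOf e)
  rw [hg, degree_mapEquiv (mapEquiv_shift_mem g), ← card_filter_tri ((typeOf e).castLE (by norm_num))]
  refine degree_eq_card base_injective base_mem_tets
    (fun t ht h => exists_base ht (duo_subset.1 h).1) fun m => ?_
  rw [← nbr_mem_base]
  exact duo_subset.trans (and_iff_right (mem_quad.2 (.inl rfl)))

theorem eq_const {ℓ : cell600.edges → ℝ} (hℓ : ℓ ∈ invariantMetrics) {c : ℝ}
    (hc : param ℓ = fun _ => c) : ℓ = fun _ => c := by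
  ext e
  rw [apply_eq_param hℓ.2 e, hc]

theorem exists_param_eq_const {ℓ : cell600.edges → ℝ} (h : cell600.IsEqualLength ℓ) :
    ∃ c, param ℓ = fun _ => c := by
  refine ⟨param ℓ 0, funext fun i => ?_⟩
  rw [param, param, ← apply_edgeAt, ← apply_edgeAt]
  exact h _ _

theorem const_mem_congruentMetrics {a : ℝ} (ha : 0 < a) : (fun _ => a) ∈ congruentMetrics := by
  have := ofParam_update_mem_congruentMetrics ha ha
    (lt_mul_of_one_lt_left ha OneEdge.one_lt_sqrt_three) 0
  rwa [Function.update_eq_self_iff.2 rfl] at this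

theorem param_const (a : ℝ) : param (fun _ => a) = fun _ => a := by
  ext i
  rw [param, ← apply_edgeAt]

/-- Common to both functionals. A metric with one exceptional type is beaten by the unit metric,
which belongs to the family; all remaining metrics in the family have equal lengths and are compared
by `hle`. -/
theorem isMaxOn_iff {Φ : (cell600.edges → ℝ) → ℝ}
    (hlt : ∀ ℓ ∈ invariantMetrics, ∀ ℓ' ∈ invariantMetrics, ∀ c, param ℓ' = (fun _ => c) →
      ∀ a b k, param ℓ = Function.update (fun _ => a) k b → b ≠ a → Φ ℓ < Φ ℓ')
    (hle : ∀ ℓ ∈ invariantMetrics, ∀ ℓ' ∈ invariantMetrics, ∀ c, param ℓ' = (fun _ => c) →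
      ∀ a, param ℓ = (fun _ => a) → Φ ℓ ≤ Φ ℓ') {ℓ : cell600.edges → ℝ} (hℓ : ℓ ∈ congruentMetrics) :
    IsMaxOn Φ congruentMetrics ℓ ↔ cell600.IsEqualLength ℓ := by
  constructor
  · intro h
    obtain ⟨k, a, b, hp⟩ := param_eq_update hℓ
    by_cases hab : b = a
    · rw [hab, Function.update_eq_self_iff.2 rfl] at hp
      rw [eq_const hℓ.1 hp]
      exact fun _ _ => rfl
    · have h1 := const_mem_congruentMetrics one_pos
      exact absurd (h h1) (not_le.2 (hlt ℓ hℓ.1 _ h1.1 1 (param_const 1) a b k hp hab))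
  · intro h ℓ₁ hℓ₁
    obtain ⟨c, hc⟩ := exists_param_eq_const h
    obtain ⟨k, a, b, hp⟩ := param_eq_update hℓ₁
    by_cases hab : b = a
    · rw [hab, Function.update_eq_self_iff.2 rfl] at hp
      exact hle ℓ₁ hℓ₁.1 ℓ hℓ.1 c hc a hp
    · exact (hlt ℓ₁ hℓ₁.1 ℓ hℓ.1 c hc a b k hp hab).le

theorem isMaxOn_LEHR_iff {ℓ : cell600.edges → ℝ} (hℓ : ℓ ∈ congruentMetrics) :
    IsMaxOn cell600.LEHR congruentMetrics ℓ ↔ cell600.IsEqualLength ℓ := by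
  refine isMaxOn_iff (fun ℓ hℓ ℓ' hℓ' c hc a b k hp => LEHR_lt_regular hℓ hℓ' hc hp)
    (fun ℓ hℓ ℓ' hℓ' c hc a hp => ?_) hℓ
  have ha : 0 < a := by simpa [hp] using param_pos hℓ 0
  rw [LEHR_le_regular_iff hℓ hℓ' hc, hp, const_eq_smul, ehrOf_smul ha, ehrOf_one]
  simp
  linarith

theorem isMaxOn_VEHR_iff {ℓ : cell600.edges → ℝ} (hℓ : ℓ ∈ congruentMetrics) :
    IsMaxOn cell600.VEHR congruentMetrics ℓ ↔ cell600.IsEqualLength ℓ := by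
  refine isMaxOn_iff (fun ℓ hℓ ℓ' hℓ' c hc a b k hp => VEHR_lt_regular hℓ hℓ' hc hp)
    (fun ℓ hℓ ℓ' hℓ' c hc a hp => ?_) hℓ
  have ha : 0 < a := by simpa [hp] using param_pos hℓ 0
  rw [VEHR_le_regular_iff hℓ hℓ' hc, hp, const_eq_smul, ehrOf_smul ha, volumeOf_smul ha, ehrOf_one,
    volumeOf_one]
  exact le_of_eq (by ring)

theorem isLEinstein_of_isEqualLength {ℓ : cell600.edges → ℝ} (hℓ : ℓ ∈ invariantMetrics)
    (h : cell600.IsEqualLength ℓ) : cell600.IsLEinstein ℓ := by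
  obtain ⟨c, hc⟩ := exists_param_eq_const h
  obtain rfl := eq_const hℓ hc
  exact isLEinstein_const hℓ.1 degree_eq_five

theorem isVEinstein_of_isEqualLength {ℓ : cell600.edges → ℝ} (hℓ : ℓ ∈ invariantMetrics)
    (h : cell600.IsEqualLength ℓ) : cell600.IsVEinstein ℓ := by
  obtain ⟨c, hc⟩ := exists_param_eq_const h
  obtain rfl := eq_const hℓ hc
  exact isVEinstein_const hℓ.1 (by norm_num) degree_eq_five

end Icosian

end

end PiecewiseFlat

open PiecewiseFlat in
theorem theorem5p8 :
    -- the boundary of the 600-cell is a triangulation of the three-sphere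
    Nonempty (cell600.realization ≃ₜ Metric.sphere (0 : EuclideanSpace ℝ (Fin 4)) 1) ∧
    -- the invariant metrics have constant scalar curvature in both normalizations
    (∀ ℓ ∈ invariantMetrics,
      cell600.HasConstLScalarCurvature ℓ ∧ cell600.HasConstVScalarCurvature ℓ) ∧
    -- the family of invariant metrics with congruent tetrahedra contains the equal length metrics
    -- and, for each edge, those with one length on its translates and another length elsewhere
    (∀ a : ℝ, 0 < a → (fun _ => a) ∈ congruentMetrics) ∧
    (∀ (e₀ : cell600.edges) (a b : ℝ), 0 < a → 0 < b → b < √3 * a →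
      ∃ ℓ ∈ congruentMetrics, (∀ e, IsTranslate e₀ e → ℓ e = b) ∧
        ∀ e, ¬ IsTranslate e₀ e → ℓ e = a) ∧
    -- over this family, the maximum of each functional is attained exactly at equal lengths
    (∀ ℓ ∈ congruentMetrics,
      IsMaxOn cell600.LEHR congruentMetrics ℓ ↔ cell600.IsEqualLength ℓ) ∧
    (∀ ℓ ∈ congruentMetrics,
      IsMaxOn cell600.VEHR congruentMetrics ℓ ↔ cell600.IsEqualLength ℓ) ∧
    -- and it is an Einstein metric
    (∀ ℓ ∈ congruentMetrics,
      IsMaxOn cell600.LEHR congruentMetrics ℓ → cell600.IsLEinstein ℓ) ∧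
    (∀ ℓ ∈ congruentMetrics,
      IsMaxOn cell600.VEHR congruentMetrics ℓ → cell600.IsVEinstein ℓ) ∧
    -- among all invariant metrics, the equal length metrics are local maxima of both functionals
    (∀ ℓ ∈ invariantMetrics, cell600.IsEqualLength ℓ →
      IsLocalMaxOn cell600.LEHR invariantMetrics ℓ ∧
      IsLocalMaxOn cell600.VEHR invariantMetrics ℓ) := by
  refine ⟨Icosian.nonempty_homeomorph_sphere, fun ℓ hℓ => Icosian.hasConstScalarCurvature hℓ,
    fun a ha => Icosian.const_mem_congruentMetrics ha, fun e₀ a b ha hb h =>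
      ⟨_, Icosian.ofParam_update_mem_congruentMetrics ha hb h (Icosian.typeOf e₀), ?_, ?_⟩,
    fun ℓ hℓ => Icosian.isMaxOn_LEHR_iff hℓ, fun ℓ hℓ => Icosian.isMaxOn_VEHR_iff hℓ,
    fun ℓ hℓ h => Icosian.isLEinstein_of_isEqualLength hℓ.1 ((Icosian.isMaxOn_LEHR_iff hℓ).1 h),
    fun ℓ hℓ h => Icosian.isVEinstein_of_isEqualLength hℓ.1 ((Icosian.isMaxOn_VEHR_iff hℓ).1 h),
    fun ℓ hℓ h => ?_⟩
  · intro e he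
    rw [Icosian.ofParam, Icosian.isTranslate_iff_typeOf.1 he, Function.update_self]
  · intro e he
    rw [Icosian.ofParam, Function.update_of_ne fun h => he (Icosian.isTranslate_iff_typeOf.2 h)]
  · obtain ⟨c, hc⟩ := Icosian.exists_param_eq_const h
    exact ⟨Icosian.isLocalMaxOn_LEHR hℓ hc, Icosian.isLocalMaxOn_VEHR hℓ hc⟩
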